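/- Let $n\ge 3$ be an integer, let $k$ be a commutative ring in which $n-1$ is invertible, and let $\mathbf T=(T_1,\dots,T_r)$ be a tuple of (finite, possibly empty) trees. Conventions. Trees are taken up to deleting vertices of valence two, and are regarded as structures on their leaf sets (a one-vertex tree has one leaf). The level of a tree is the maximal valence of its nodes, i.e. of its vertices of valence at least three (and $0$ if there are none). An amalgamation of $X$ and $Y$ is a tree $Z$ with leaves labelled by the disjoint union of the leaf sets of $X$ and $Y$ (every leaf has a label, and may have several), such that the labels from $X$ span $X$ and those from $Y$ span $Y$; amalgamations of three trees are defined likewise. For an embedding $Y\to Z$ of trees let $\mu_\tau(Y\to Z)=\mu_\tau(Z)/\mu_\tau(Y)\in\mathbf Z[\tau,(\tau-1)^{-1}]$, where $\mu_\tau(\emptyset)=1$ and $$\mu_\tau(T)=\frac{(-1)^{n_3(T)}\,\tau}{(\tau-1)^{\ell(T)}}\prod_{i\ge 3}(\tau-i+1)^{n_i(T)}$$ for a nonempty tree $T$ with $\ell(T)$ leaves and $n_i(T)$ nodes of valence at least $i$, and let $\mu_n(Y\to Z)\in k$ be its specialization at $\tau=n$. This is a $k$-valued measure on the class of all trees: it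 is $1$ on isomorphisms, it is multiplicative in compositions, and $\mu_n(X\to Y)=\sum_Z\mu_n(X'\to Z)$ for embeddings $X\to Y$ and $X\to X'$, the sum being over the amalgamations $Z$ of $Y$ and $X'$ over $X$. It takes the value $-(n-2)/(n-1)$ both on the inclusion of the two-leaf tree into the three-leaf tree and on the inclusion of the three-leaf tree into the four-leaf tree with two nodes. It restricts to a measure on the class of trees of level $\le n$. The arboreal algebra $A^{\mathbf T}_k(n)$ is the free $k$-module with basis the elements $\phi_Z$, for all $i,j$ and all amalgamations $Z$ of $T_i$ and $T_j$ (up to isomorphism). The product is composition: for amalgamations $Y_1$ of $T_i,T_j$ and $Y_2$ of $T_{j'},T_l$ we have $\phi_{Y_2}\phi_{Y_1}=0$ if $j\ne j'$, and otherwise $$\phi_{Y_2}\,\phi_{Y_1}=\sum_{Y_3}\sum_Z\mu_n(Y_3\to Z)\,\phi_{Y_3},$$ where $Y_3$ runs over the amalgamations of $T_i,T_l$, and $Z$ over the amalgamations of $T_i,T_j,T_l$ extending $Y_1,Y_2,Y_3$. The algebra $B^{\mathbf T}_k(n)$ is defined in the same way, but with the $T_i$ of level $>n$ omitted from $\mathbf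 T$ and only amalgamations (of two or three trees) of level $\le n$ allowed. Both are associative algebras with unit, the unit being the sum of the elements $\phi_{T_i}$ (with $T_i$ regarded as an amalgamation of $T_i$ with itself). Then there is a surjective $k$-linear homomorphism of unital rings $$F\colon A^{\mathbf T}_k(n)\to B^{\mathbf T}_k(n)$$ with $F(\phi_Z)=\phi_Z$ if the amalgamation $Z$ has level $\le n$, and $F(\phi_Z)=0$ otherwise. If every $T_i$ has level $\le n/2$ and, in case $n=3$, no $T_i$ has exactly two leaves, then $F$ is an isomorphism. -/

import Mathlib

open scoped BigOperators

namespace Arboreal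

universe u

/-! ### Leaf-labelled structures and trees -/

/-- The data carried by a label set `I` whose elements label the leaves of a tree (one leaf may
carry several labels): `same a b` says that `a` and `b` label the same leaf, and
`rel a b c d` is the quaternary relation `R(a, b; c, d)` between the labelled leaves.
Recording it on labels makes "isomorphism of labelled trees" into equality. -/
@[ext] structure Labelled (I : Type) where
  same : I → I → Prop
  rel : I → I → I → I → Prop

instance {I : Type} [Finite I] : Finite (Labelled I) :=
  Finite.of_injective
    (fun Z : Labelled I => ((Z.same, Z.rel) : (I → I → Prop) × (I → I → I → I → Prop)))
    (fun _ _ h => Labelled.ext (congrArg Prod.fst h) (congrArg Prod.snd h))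

/-- Pull back along a map of labels: the structure spanned by the leaves with labels `g j`. -/
def Labelled.restrict {I J : Type} (Z : Labelled I) (g : J → I) : Labelled J where
  same a b := Z.same (g a) (g b)
  rel a b c d := Z.rel (g a) (g b) (g c) (g d)

/-- A finite (possibly empty) tree graph `G` whose leaves are labelled by `I` and which induces the
structure `Z`. The leaves are the vertices of valence one; the vertex of a
one-vertex tree (valence zero) counts as a leaf too. Vertices of valence two are allowed. -/
structure TreeModel {I : Type} (Z : Labelled I) where
  V : Type
  finite : Finite V
  G : SimpleGraph V
  preconnected : G.Preconnected
  acyclic : G.IsAcyclic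
  leaf : I → V
  range_leaf : ∀ v, v ∈ Set.range leaf ↔ (G.neighborSet v).ncard ≤ 1
  same_iff : ∀ a b, Z.same a b ↔ leaf a = leaf b
  rel_iff : ∀ a b c d, Z.rel a b c d ↔
    [leaf a, leaf b, leaf c, leaf d].Nodup ∧
      ∃ (p : G.Path (leaf a) (leaf b)) (q : G.Path (leaf c) (leaf d)) (e : Sym2 V),
        e ∈ p.1.edges ∧ e ∈ q.1.edges

/-- The valence of a vertex of the tree. -/
noncomputable def TreeModel.valence {I : Type} {Z : Labelled I} (M : TreeModel Z) (v : M.V) : ℕ :=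
  (M.G.neighborSet v).ncard

/-- `Z` is the structure of a tree with leaves labelled by `I`. -/
def Labelled.IsTree {I : Type} (Z : Labelled I) : Prop := Nonempty (TreeModel Z)

/-- The number of leaves, i.e. of classes of labels. -/
noncomputable def Labelled.leafCount {I : Type} (Z : Labelled I) : ℕ := (Set.range Z.same).ncard

open Classical in
/-- For `i ≥ 3`: the number of nodes of valence at least `i` in the tree. It is the same for every
tree inducing `Z` (nodes of valence two are not seen); for `i = 3` it is the number of nodes of
the reduced tree. -/
noncomputable def Labelled.nodeCount {I : Type} (Z : Labelled I) (i : ℕ) : ℕ :=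
  if h : Z.IsTree then {v : h.some.V | i ≤ h.some.valence v}.ncard else 0

open Classical in
/-- The level: the maximal valence of a node of the reduced tree (zero if there is no node, that
is, if there are at most two leaves). -/
noncomputable def Labelled.level {I : Type} (Z : Labelled I) : ℕ :=
  if h : Z.IsTree then
    sSup {d : ℕ | 3 ≤ d ∧ ∃ v : h.some.V, h.some.valence v = d} else 0

/-- Membership in the class of trees of level `≤ N`; for `N = ⊤` this is the class of all trees. -/
def Labelled.InClass {I : Type} (N : ℕ∞) (Z : Labelled I) : Prop :=
  Z.IsTree ∧ (Z.level : ℕ∞) ≤ N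

/-- A tree structure: a finite set with a quaternary relation that is isomorphic to the leaf set of
a finite tree, with its relation "the paths `a—b` and `c—d` share an edge". -/
structure TreeStructure where
  carrier : Type
  finite : Finite carrier
  rel : carrier → carrier → carrier → carrier → Prop
  isTree : Labelled.IsTree ⟨Eq, rel⟩

instance : CoeSort TreeStructure Type := ⟨TreeStructure.carrier⟩

instance (X : TreeStructure) : Finite X := X.finite

/-- A tree structure, every leaf being labelled by itself. -/
def TreeStructure.toLabelled (X : TreeStructure) : Labelled X := ⟨Eq, X.rel⟩

/-- The level of a tree structure. -/
noncomputable def TreeStructure.level (X : TreeStructure) : ℕ := X.toLabelled.level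

/-! ### The measure -/

section Measure

variable {k : Type u} [CommRing k]

/-- The value `μ_t(Y → Z)` of the measure with parameter `t` on the embedding into the tree `Z` of
the subtree `Y` spanned by the labels `g j`. For an indeterminate `τ`, it is
`μ_τ(Z) / μ_τ(Y)`, where `μ_τ(∅) = 1` and, for a nonempty tree `T` with `ℓ` leaves and `n_i` nodes of
valence at least `i`, `μ_τ(T) = (-1) ^ n_3 * τ * (τ - 1) ^ (-ℓ) * ∏_{i ≥ 3} (τ - i + 1) ^ n_i`;
common factors are cancelled before `τ` is specialised to `t`. (A valence is at
most the number of leaves, so that the product below contains all factors.) -/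
noncomputable def treeMeasure (t : k) {J I : Type} (g : J → I) (Z : Labelled I) : k :=
  (if (Z.restrict g).leafCount = 0 ∧ Z.leafCount ≠ 0 then t else 1) *
    (-1) ^ (Z.nodeCount 3 - (Z.restrict g).nodeCount 3) *
    Ring.inverse (t - 1) ^ (Z.leafCount - (Z.restrict g).leafCount) *
    ∏ i ∈ Finset.Icc 3 Z.leafCount,
      (t - (i : k) + 1) ^ (Z.nodeCount i - (Z.restrict g).nodeCount i)

/-- `μ` is a measure on the class of trees of level `≤ N`. Here `μ g Z` is the value of `μ` on the
embedding `Z.restrict g → Z`; this embedding is an isomorphism iff `g` meets every leaf. -/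
structure IsMeasure (N : ℕ∞) (μ : ∀ {J I : Type}, (J → I) → Labelled I → k) : Prop where
  iso : ∀ {J I : Type} [Finite J] [Finite I] (g : J → I) (Z : Labelled I), Z.InClass N →
    (∀ a, ∃ b, Z.same a (g b)) → μ g Z = 1
  comp : ∀ {K J I : Type} [Finite K] [Finite J] [Finite I] (f : K → J) (g : J → I)
    (Z : Labelled I), Z.InClass N → μ (g ∘ f) Z = μ g Z * μ f (Z.restrict g)
  amalgamation : ∀ {X Y X' : Type} [Finite X] [Finite Y] [Finite X'] (i : X → Y) (j : X → X')
    (S : Labelled Y) (S' : Labelled X'), S.InClass N → S'.InClass N →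
    S.restrict i = S'.restrict j →
    μ i S = ∑ᶠ Z : {Z : Labelled (Y ⊕ X') // Z.InClass N ∧ Z.restrict Sum.inl = S ∧
        Z.restrict Sum.inr = S' ∧ ∀ x, Z.same (Sum.inl (i x)) (Sum.inr (j x))},
      μ Sum.inr Z.1

/-- `μ` is the measure on the class of all trees with parameter `t`: the one for which the two
embeddings "three-leaf star minus a leaf" and "four-leaf tree with two nodes minus a leaf" both
have measure `-(t - 2) / (t - 1)`. These are the generators `u + v` and `u` of the universal ring
`ℤ[u, v] / (u v)` of measures on trees, so `v = 0` and `u = -(t - 2) / (t - 1)`. -/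
structure IsPrimaryMeasure (t : k) (μ : ∀ {J I : Type}, (J → I) → Labelled I → k) : Prop where
  isMeasure : IsMeasure ⊤ μ
  star : ∀ Z : Labelled (Fin 3), Z.IsTree → (∀ a b, Z.same a b ↔ a = b) →
    μ (Fin.castSucc : Fin 2 → Fin 3) Z = -(t - 2) * Ring.inverse (t - 1)
  quartet : ∀ Z : Labelled (Fin 4), Z.IsTree → (∀ a b, Z.same a b ↔ a = b) → Z.rel 0 1 2 3 →
    μ (Fin.castSucc : Fin 3 → Fin 4) Z = -(t - 2) * Ring.inverse (t - 1)

end Measure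

/-! ### Amalgamations and arboreal algebras -/

/-- The (isomorphism classes of) amalgamations of `X` and `Y` of level `≤ N`: trees of level `≤ N`
with leaves labelled by the disjoint union of `X` and `Y`, in which the labels from
`X` span `X` and those from `Y` span `Y`. -/
def Amalg (N : ℕ∞) (X Y : TreeStructure) : Type :=
  {Z : Labelled (X ⊕ Y) // Z.InClass N ∧
    Z.restrict Sum.inl = X.toLabelled ∧ Z.restrict Sum.inr = Y.toLabelled}

instance (N : ℕ∞) (X Y : TreeStructure) : Finite (Amalg N X Y) :=
  inferInstanceAs (Finite {Z : Labelled (X ⊕ Y) // _})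

noncomputable instance (N : ℕ∞) (X Y : TreeStructure) : Fintype (Amalg N X Y) :=
  Fintype.ofFinite _

/-- The amalgamation of `X` with itself in which the two copies of `X` are identified. -/
def Amalg.IsIdentity {N : ℕ∞} {X : TreeStructure} (Z : Amalg N X X) : Prop :=
  ∀ x : X, Z.1.same (Sum.inl x) (Sum.inr x)

/-- The labels of types 1 and 2 among the labels of three types. -/
def lab12 {X₁ X₂ X₃ : Type} : X₁ ⊕ X₂ → X₁ ⊕ X₂ ⊕ X₃ := Sum.map id Sum.inl

/-- The labels of types 2 and 3. -/
def lab23 {X₁ X₂ X₃ : Type} : X₂ ⊕ X₃ → X₁ ⊕ X₂ ⊕ X₃ := Sum.inr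

/-- The labels of types 1 and 3. -/
def lab13 {X₁ X₂ X₃ : Type} : X₁ ⊕ X₃ → X₁ ⊕ X₂ ⊕ X₃ := Sum.map id Sum.inr

/-- The amalgamations of `X₁`, `X₂`, `X₃` (of level `≤ N`) extending `Y₁`, `Y₂` and `Y₃`. -/
def Triple {N : ℕ∞} {X₁ X₂ X₃ : TreeStructure}
    (Y₁ : Amalg N X₁ X₂) (Y₂ : Amalg N X₂ X₃) (Y₃ : Amalg N X₁ X₃) : Type :=
  {Z : Labelled (X₁ ⊕ X₂ ⊕ X₃) // Z.InClass N ∧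
    Z.restrict lab12 = Y₁.1 ∧ Z.restrict lab23 = Y₂.1 ∧ Z.restrict lab13 = Y₃.1}

instance {N : ℕ∞} {X₁ X₂ X₃ : TreeStructure}
    (Y₁ : Amalg N X₁ X₂) (Y₂ : Amalg N X₂ X₃) (Y₃ : Amalg N X₁ X₃) : Finite (Triple Y₁ Y₂ Y₃) :=
  inferInstanceAs (Finite {Z : Labelled (X₁ ⊕ X₂ ⊕ X₃) // _})

noncomputable instance {N : ℕ∞} {X₁ X₂ X₃ : TreeStructure}
    (Y₁ : Amalg N X₁ X₂) (Y₂ : Amalg N X₂ X₃) (Y₃ : Amalg N X₁ X₃) : Fintype (Triple Y₁ Y₂ Y₃) :=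
  Fintype.ofFinite _

section Algebra

variable {k : Type u} [CommRing k]

/-- The coefficient of `φ_{Y₃}` in the composition `φ_{Y₂} ∘ φ_{Y₁}`, i.e. the sum of
`μ_t(Y₃ → Z)` over the amalgamations `Z` of `X₁`, `X₂`, `X₃` extending `Y₁`, `Y₂`, `Y₃`. -/
noncomputable def structureConstant (t : k) {N : ℕ∞} {X₁ X₂ X₃ : TreeStructure}
    (Y₁ : Amalg N X₁ X₂) (Y₂ : Amalg N X₂ X₃) (Y₃ : Amalg N X₁ X₃) : k :=
  ∑ Z : Triple Y₁ Y₂ Y₃, treeMeasure t lab13 Z.1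

variable {ι : Type} [Fintype ι]

/-- The endomorphism algebra of `⨁ᵢ Vec_{Tᵢ}` in the category attached to the class of trees of
level `≤ N` and the measure `μ_t`. As a module it is `⨁_{i,j} Hom(Vec_{Tᵢ}, Vec_{Tⱼ})`, and
`Hom(Vec_X, Vec_Y)` is the free module on the finite set of amalgamations of `X` and `Y`. The
component `f i j` of an element `f` is its part in `Hom(Vec_{Tᵢ}, Vec_{Tⱼ})`. (Passing to the
Karoubi envelope does not change endomorphism algebras.) -/
def ArborealAlgebra (N : ℕ∞) (_t : k) (T : ι → TreeStructure) : Type u :=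
  ∀ i j, Amalg N (T i) (T j) → k

namespace ArborealAlgebra

variable {N : ℕ∞} {t : k} {T : ι → TreeStructure}

instance : AddCommGroup (ArborealAlgebra N t T) :=
  inferInstanceAs (AddCommGroup (∀ i j, Amalg N (T i) (T j) → k))

instance : Module k (ArborealAlgebra N t T) :=
  inferInstanceAs (Module k (∀ i j, Amalg N (T i) (T j) → k))

/-- `f * g` is the composition `f ∘ g`. -/
noncomputable instance : Mul (ArborealAlgebra N t T) where
  mul f g := fun i l Y₃ => ∑ j, ∑ Y₁ : Amalg N (T i) (T j), ∑ Y₂ : Amalg N (T j) (T l),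
    f j l Y₂ * g i j Y₁ * structureConstant t Y₁ Y₂ Y₃

open Classical in
/-- The identity endomorphism: the sum of the identity amalgamations of the `T i`. -/
noncomputable instance : One (ArborealAlgebra N t T) where
  one := fun i => Pi.single i
    (fun Z : Amalg N (T i) (T i) => if Z.IsIdentity then (1 : k) else 0)

noncomputable instance : NonUnitalNonAssocRing (ArborealAlgebra N t T) where
  left_distrib f g h := by
    funext i l Y₃
    change (∑ j, ∑ Y₁ : Amalg N (T i) (T j), ∑ Y₂ : Amalg N (T j) (T l),
      f j l Y₂ * (g i j Y₁ + h i j Y₁) * structureConstant t Y₁ Y₂ Y₃) =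
      (∑ j, ∑ Y₁ : Amalg N (T i) (T j), ∑ Y₂ : Amalg N (T j) (T l),
      f j l Y₂ * g i j Y₁ * structureConstant t Y₁ Y₂ Y₃) +
      (∑ j, ∑ Y₁ : Amalg N (T i) (T j), ∑ Y₂ : Amalg N (T j) (T l),
      f j l Y₂ * h i j Y₁ * structureConstant t Y₁ Y₂ Y₃)
    simp only [mul_add, add_mul, Finset.sum_add_distrib]
  right_distrib f g h := by
    funext i l Y₃
    change (∑ j, ∑ Y₁ : Amalg N (T i) (T j), ∑ Y₂ : Amalg N (T j) (T l),
      (f j l Y₂ + g j l Y₂) * h i j Y₁ * structureConstant t Y₁ Y₂ Y₃) =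
      (∑ j, ∑ Y₁ : Amalg N (T i) (T j), ∑ Y₂ : Amalg N (T j) (T l),
      f j l Y₂ * h i j Y₁ * structureConstant t Y₁ Y₂ Y₃) +
      (∑ j, ∑ Y₁ : Amalg N (T i) (T j), ∑ Y₂ : Amalg N (T j) (T l),
      g j l Y₂ * h i j Y₁ * structureConstant t Y₁ Y₂ Y₃)
    simp only [add_mul, Finset.sum_add_distrib]
  zero_mul f := by
    funext i l Y₃
    change (∑ j, ∑ Y₁ : Amalg N (T i) (T j), ∑ Y₂ : Amalg N (T j) (T l),
      (0 : k) * f i j Y₁ * structureConstant t Y₁ Y₂ Y₃) = 0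
    simp
  mul_zero f := by
    funext i l Y₃
    change (∑ j, ∑ Y₁ : Amalg N (T i) (T j), ∑ Y₂ : Amalg N (T j) (T l),
      f j l Y₂ * (0 : k) * structureConstant t Y₁ Y₂ Y₃) = 0
    simp

open Classical in
/-- The basis element `φ_Z : Vec_{Tᵢ} → Vec_{Tⱼ}` of an amalgamation `Z` of `Tᵢ` and `Tⱼ`. -/
noncomputable def phi (t : k) {i j : ι} (Z : Amalg N (T i) (T j)) : ArborealAlgebra N t T :=
  Pi.single i (Pi.single j (Pi.single Z (1 : k)))

end ArborealAlgebra

end Algebra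

/-- The multiplication is associative and `1` is a two-sided unit: the remaining axioms that make a
`NonUnitalNonAssocRing` with a `1` into a ring. -/
structure IsUnitalAssociative (A : Type u) [NonUnitalNonAssocRing A] [One A] : Prop where
  mul_assoc : ∀ x y z : A, x * y * z = x * (y * z)
  one_mul : ∀ x : A, 1 * x = x
  mul_one : ∀ x : A, x * 1 = x

/-- The arboreal algebra `A^T_k(t)`, built from all trees. -/
abbrev AlgA {k : Type u} [CommRing k] {r : ℕ} (t : k) (T : Fin r → TreeStructure) : Type u :=
  ArborealAlgebra ⊤ t T

/-- The arboreal algebra `B^T_k(n)`, built from the trees of level `≤ n`, with the measure `μ_n`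
and with the entries of `T` of level `> n` omitted. -/
abbrev AlgB (k : Type u) [CommRing k] {r : ℕ} (n : ℕ) (T : Fin r → TreeStructure) : Type u :=
  ArborealAlgebra (n : ℕ∞) (n : k) (fun i : {i : Fin r // (T i).level ≤ n} => T i.1)

end Arboreal

namespace Arboreal

/-! ### Metric facts about trees -/

section TreeMetric

variable {V : Type*} {G : SimpleGraph V}

/-! The homomorphism is truncation: an element is a coefficient function on amalgamations, and it is
restricted to those of level `≤ n`. That this respects products rests on one vanishing,
`treeMeasure_eq_zero`: at `τ = n` the factor `τ - i + 1` with `i = n + 1` is zero, and it occurs in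
`μ_n(Y → Z)` as soon as `Y` has level `≤ n` and `Z` has not. So only triples `Z` of level `≤ n`
contribute to the coefficient of `φ_{Y₃}` when `Y₃` has level `≤ n`, and such a `Z` forces `Y₁`,
`Y₂` and the middle tree to have level `≤ n` (`structureConstant_toTop`,
`structureConstant_eq_zero`). The same vanishing shows that `μ_n` restricts to a measure on level `≤
n`.

For bijectivity, a node of an amalgamation of `X` and `Y` restricts to a point of `X` and a point of
`Y`. Each branch at the node carries a label from `X` or from `Y`, so its valence is at most the sum
of the numbers of branches at these points. Each number is at most `n / 2`: for nodes by hypothesis,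
for midpoints of edges because `2 ≤ n / 2` when `n ≥ 4`. For `n = 3` the trees have no nodes, hence
at most two leaves, and two are excluded. So no basis element is killed.

The longer part is that `μ_t` is a measure and that the algebras are associative. Trees are handled
through their splits: the sides of the edges form a compatible split system that induces the
structure (`TreeModel.inducedBy`), and conversely such a system comes from a tree
(`InducedBy.isTree`). A point of the tree becomes a partition of the labels (`IsPos`), and nodes are
the points with at least three classes, which makes level and node counts intrinsic. Extensions by
one leaf correspond to points (`ext_attach`, `IsPos.exists_attach_eq`), and their measure depends
only on the number of branches (`treeMeasure_extension`). For two such extensions the amalgamation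
axiom reduces, apart from degenerate cases, to an identity of weights (`sum_pointsOver_attach`); the
general case follows by induction on missing leaves. Associativity is then formal: both bracketings
are sums over amalgamations of four trees (`sum_structureConstant_mul`). -/

theorem dist_adj_cases (hG : G.IsTree) {u v : V} (h : G.Adj u v) (w : V) :
    G.dist u w = G.dist v w + 1 ∨ G.dist v w = G.dist u w + 1 := by
  have := hG.dist_eq_dist_add_one_of_adj w h
  simpa only [G.dist_comm (u := w)] using this

theorem exists_adj_closer (hG : G.Connected) {v w : V} (h : v ≠ w) :
    ∃ u, G.Adj v u ∧ G.dist u w + 1 = G.dist v w := by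
  obtain ⟨p, hp⟩ := hG.exists_walk_length_eq_dist v w
  cases p with
  | nil => exact absurd rfl h
  | cons hadj q =>
    refine ⟨_, hadj, le_antisymm ?_ ?_⟩
    · rw [← hp, SimpleGraph.Walk.length_cons]
      exact Nat.succ_le_succ (SimpleGraph.dist_le q)
    · exact (hG.dist_triangle (v := _)).trans_eq (by
        rw [SimpleGraph.dist_eq_one_iff_adj.2 hadj, add_comm])

/-- Prefixing the edge to a geodesic from the neighbour gives a geodesic from `v`. Paths in a tree
are unique, so both neighbours are the second vertex of the same path. -/
theorem closer_unique (hG : G.IsTree) {v u₁ u₂ w : V} (h₁ : G.Adj v u₁) (h₂ : G.Adj v u₂)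
    (d₁ : G.dist u₁ w < G.dist v w) (d₂ : G.dist u₂ w < G.dist v w) : u₁ = u₂ := by
  have key : ∀ u, G.Adj v u → G.dist u w < G.dist v w →
      ∃ p : G.Path v w, p.1.snd = u := by
    intro u hu hd
    obtain ⟨q, hq⟩ := hG.connected.exists_walk_length_eq_dist u w
    have hlen : (SimpleGraph.Walk.cons hu q).length = G.dist v w := by
      rcases dist_adj_cases hG hu w with h | h
      · rw [SimpleGraph.Walk.length_cons, hq, h]
      · omega
    exact ⟨⟨_, SimpleGraph.Walk.isPath_of_length_eq_dist _ hlen⟩, by simp⟩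
  obtain ⟨p, rfl⟩ := key u₁ h₁ d₁
  obtain ⟨q, rfl⟩ := key u₂ h₂ d₂
  rw [(hG.isAcyclic.subsingleton_path v w).elim p q]

theorem closer_of_adj (hG : G.IsTree) {u v x y : V} (huv : G.Adj u v) (hxy : G.Adj x y)
    (hne : s(x, y) ≠ s(u, v)) (hx : G.dist u x < G.dist v x) : G.dist u y < G.dist v y := by
  by_contra hy
  have e1 := dist_adj_cases hG huv x
  have e2 := dist_adj_cases hG huv y
  have e3 := dist_adj_cases hG hxy u
  have e4 := dist_adj_cases hG hxy v
  rw [G.dist_comm (u := x), G.dist_comm (u := y)] at e3 e4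
  by_cases hxu : x = u
  · subst hxu
    have h0 : G.dist x x = 0 := SimpleGraph.dist_self
    have : G.dist v y = 0 := by omega
    have := (hG.connected.dist_eq_zero_iff).1 this
    subst this
    exact hne rfl
  -- The neighbour `z` of `x` towards `u` and the neighbour `y` are both closer to `v` than `x`, so
  -- they coincide; but `y` is farther from `u`.
  · obtain ⟨z, hz, hzd⟩ := exists_adj_closer hG.connected hxu
    have t1 := hG.connected.dist_triangle (u := z) (v := u) (w := v)
    rw [SimpleGraph.dist_eq_one_iff_adj.2 huv] at t1
    rw [G.dist_comm (u := x), G.dist_comm (u := z)] at hzd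
    have hzy : z = y := by
      refine closer_unique hG hz hxy (w := v) ?_ ?_
      · rw [G.dist_comm (u := x) (v := v)]
        rw [G.dist_comm (u := z) (v := u)] at t1
        omega
      · rw [G.dist_comm (u := x) (v := v), G.dist_comm (u := y) (v := v)]
        omega
    subst hzy
    omega

theorem mem_edges_of_sides (hG : G.IsTree) {u v a b : V} (huv : G.Adj u v) (p : G.Walk a b)
    (ha : G.dist u a < G.dist v a) (hb : G.dist v b < G.dist u b) : s(u, v) ∈ p.edges := by
  obtain ⟨d, hd, h1, h2⟩ := p.exists_boundary_dart {w | G.dist u w < G.dist v w} ha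
    (by simpa using hb.le)
  by_contra hcon
  have hne : s(d.fst, d.snd) ≠ s(u, v) := by
    intro h
    apply hcon
    rw [← h]
    exact SimpleGraph.Walk.edges_eq_map_darts p ▸ List.mem_map_of_mem hd
  exact h2 (closer_of_adj hG huv d.adj hne h1)

/-- A path uses the edge only once. If its first edge is `u—v`, the remainder avoids that edge and
stays on one side; otherwise the first edge does not change the side and induction applies. -/
theorem sides_of_mem_edges (hG : G.IsTree) {u v : V} (huv : G.Adj u v) {a b : V}
    (p : G.Walk a b) (hp : p.IsPath) (he : s(u, v) ∈ p.edges) :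
    G.dist u a < G.dist v a ↔ G.dist v b < G.dist u b := by
  induction p with
  | nil => simp at he
  | @cons a c b h q ih =>
    rw [SimpleGraph.Walk.edges_cons, List.mem_cons] at he
    rw [SimpleGraph.Walk.cons_isPath_iff] at hp
    have hnot : s(a, c) ∉ q.edges := fun hmem =>
      hp.2 (SimpleGraph.Walk.fst_mem_support_of_mem_edges q hmem)
    have c1 := dist_adj_cases hG huv a
    have c2 := dist_adj_cases hG huv c
    have c3 := dist_adj_cases hG huv b
    by_cases hac : s(u, v) = s(a, c)
    · rw [← hac] at hnot
      have hcb : G.dist u c < G.dist v c ↔ G.dist u b < G.dist v b := by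
        constructor
        · intro h1
          by_contra h2
          exact hnot (mem_edges_of_sides hG huv q h1 (by omega))
        · intro h1
          by_contra h2
          exact hnot (by
            rw [Sym2.eq_swap]
            exact mem_edges_of_sides hG huv.symm q (by omega) h1)
      have h0 := SimpleGraph.dist_eq_one_iff_adj.2 huv
      have h0' := SimpleGraph.dist_eq_one_iff_adj.2 huv.symm
      rcases Sym2.eq_iff.1 hac with ⟨rfl, rfl⟩ | ⟨rfl, rfl⟩ <;>
        simp only [SimpleGraph.dist_self] at * <;> omega
    · have he' := he.resolve_left hac
      have := ih hp.1 he'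
      refine Iff.trans ?_ this
      constructor
      · exact closer_of_adj hG huv h (fun h => hac h.symm)
      · exact closer_of_adj hG huv h.symm (fun h => hac (h.symm.trans Sym2.eq_swap))

/-- A geodesic between opposite sides crosses the edge, so it can be cut at `v`. -/
theorem dist_through_edge (hG : G.IsTree) {u v w x : V} (huv : G.Adj u v)
    (hw : G.dist v w < G.dist u w) (hx : G.dist u x < G.dist v x) :
    G.dist w x = G.dist w v + 1 + G.dist u x := by
  classical
  obtain ⟨p, hp⟩ := hG.connected.exists_walk_length_eq_dist w x
  have he := mem_edges_of_sides hG huv.symm p hw hx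
  have hv := SimpleGraph.Walk.fst_mem_support_of_mem_edges p he
  have hlen := congrArg SimpleGraph.Walk.length (p.take_spec hv)
  rw [SimpleGraph.Walk.length_append, hp] at hlen
  have h1 := SimpleGraph.dist_le (p.takeUntil v hv)
  have h2 := SimpleGraph.dist_le (p.dropUntil v hv)
  have h3 := hG.connected.dist_triangle (u := w) (v := v) (w := x)
  have := dist_adj_cases hG huv x
  omega

/-- By `dist_through_edge`, the distances from a vertex beyond `v` to `x` and to `y` differ exactly
as those from `u` do, so this vertex is on the same side of `x—y` as `u`. -/
theorem sides_disjoint (hG : G.IsTree) {u v x y : V} (huv : G.Adj u v)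
    (hx : G.dist u x < G.dist v x) (hy : G.dist u y < G.dist v y)
    (hu : G.dist x u < G.dist y u) (w : V) :
    ¬ (G.dist v w < G.dist u w ∧ G.dist y w < G.dist x w) := by
  rintro ⟨h1, h2⟩
  have e1 := dist_through_edge hG huv h1 hx
  have e2 := dist_through_edge hG huv h1 hy
  rw [G.dist_comm (u := x) (v := w), G.dist_comm (u := y) (v := w)] at h2
  rw [G.dist_comm (u := x) (v := u), G.dist_comm (u := y) (v := u)] at hu
  omega

/-- Two sides of edges of a tree are compatible. -/
theorem sides_compatible (hG : G.IsTree) {u v x y : V} (huv : G.Adj u v) (hxy : G.Adj x y)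
    (w₁ w₂ w₃ w₄ : V)
    (h₁ : G.dist u w₁ < G.dist v w₁ ∧ G.dist x w₁ < G.dist y w₁)
    (h₂ : G.dist u w₂ < G.dist v w₂ ∧ G.dist y w₂ < G.dist x w₂)
    (h₃ : G.dist v w₃ < G.dist u w₃ ∧ G.dist x w₃ < G.dist y w₃)
    (h₄ : G.dist v w₄ < G.dist u w₄ ∧ G.dist y w₄ < G.dist x w₄) : False := by
  by_cases hne : s(x, y) = s(u, v)
  · rcases Sym2.eq_iff.1 hne with ⟨rfl, rfl⟩ | ⟨rfl, rfl⟩ <;> omega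
  -- Each of two distinct edges lies on one side of the other. In each of the four resulting cases
  -- `sides_disjoint` makes one of the four intersections empty.
  have cx := dist_adj_cases hG huv x
  have cu := dist_adj_cases hG hxy u
  by_cases hx : G.dist u x < G.dist v x
  · have hy := closer_of_adj hG huv hxy hne hx
    by_cases hu : G.dist x u < G.dist y u
    · exact sides_disjoint hG huv hx hy hu w₄ h₄
    · exact sides_disjoint hG huv hy hx (by omega) w₃ h₃
  · have hx' : G.dist v x < G.dist u x := by omega
    have hne' : s(x, y) ≠ s(v, u) := fun h => hne (h.trans Sym2.eq_swap)
    have hy := closer_of_adj hG huv.symm hxy hne' hx'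
    have cv := dist_adj_cases hG hxy v
    by_cases hu : G.dist x v < G.dist y v
    · exact sides_disjoint hG huv.symm hx' hy hu w₂ h₂
    · exact sides_disjoint hG huv.symm hy hx' (by omega) w₁ h₁

/-- Each side of an edge of a finite tree contains a vertex of valence one. -/
theorem exists_leaf_in_side [Finite V] (hG : G.IsTree) {u v : V} (huv : G.Adj u v) :
    ∃ w, G.dist u w < G.dist v w ∧ (G.neighborSet w).ncard ≤ 1 := by
  have hu : G.dist u u < G.dist v u := by
    rw [SimpleGraph.dist_self, SimpleGraph.dist_eq_one_iff_adj.2 huv.symm]; exact one_pos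
  -- For a vertex of this side at maximal distance from `v`, every neighbour is closer to `v`, and
  -- `closer_unique` leaves at most one.
  obtain ⟨w, hw, hmax⟩ := Set.Finite.exists_maximalFor (fun w => G.dist v w)
    {w | G.dist u w < G.dist v w} (Set.toFinite _) ⟨u, hu⟩
  refine ⟨w, hw, (Set.ncard_le_one (Set.toFinite _)).2 ?_⟩
  have key : ∀ x ∈ G.neighborSet w, G.dist x v < G.dist w v := by
    intro x hx
    rcases dist_adj_cases hG hx v with h | h
    · omega
    · exfalso
      have t := hG.connected.dist_triangle (u := u) (v := w) (w := x)
      rw [SimpleGraph.dist_eq_one_iff_adj.2 hx] at t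
      rw [G.dist_comm (u := x), G.dist_comm (u := w) (v := v)] at h
      have hw' : G.dist u w < G.dist v w := hw
      have := hmax (show x ∈ {w | G.dist u w < G.dist v w} from
        (by show G.dist u x < G.dist v x; omega)) (by simp only; omega)
      simp only at this
      omega
  intro x hx y hy
  exact closer_unique hG hx hy (key x hx) (key y hy)

/-- A set of vertices with a single edge leaving it is a side of that edge. -/
theorem side_eq_of_boundary (hG : G.Connected) {u v : V} (huv : G.Adj u v) (B : Set V)
    (hu : u ∈ B) (hv : v ∉ B) (hB : ∀ x y, G.Adj x y → x ∈ B → y ∉ B → x = u ∧ y = v) (w : V) :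
    w ∈ B ↔ G.dist u w < G.dist v w := by
  classical
  -- A geodesic from a point of `B` to `v` leaves `B` through `u`, so `u` is nearer. This is used
  -- for `B` and for its complement.
  have key : ∀ (u v : V) (B : Set V), G.Adj u v → u ∈ B → v ∉ B →
      (∀ x y, G.Adj x y → x ∈ B → y ∉ B → x = u ∧ y = v) → ∀ w ∈ B,
      G.dist u w < G.dist v w := by
    intro u v B huv hu hv hB w hw
    obtain ⟨p, hp⟩ := hG.exists_walk_length_eq_dist w v
    obtain ⟨d, hd, h1, h2⟩ := p.exists_boundary_dart B hw hv
    have hsup := p.dart_fst_mem_support_of_mem_darts hd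
    rw [(hB _ _ d.adj h1 h2).1] at hsup
    have hlen := congrArg SimpleGraph.Walk.length (p.take_spec hsup)
    rw [SimpleGraph.Walk.length_append, hp] at hlen
    have h1 := SimpleGraph.dist_le (p.takeUntil u hsup)
    have h2 := SimpleGraph.dist_le (p.dropUntil u hsup)
    rw [SimpleGraph.dist_eq_one_iff_adj.2 huv] at h2
    rw [G.dist_comm (u := w)] at hlen h1
    omega
  refine ⟨key u v B huv hu hv hB w, fun h => ?_⟩
  by_contra hw
  have := key v u Bᶜ huv.symm hv (by simpa using hu) (fun x y hxy hx hy => by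
    have := hB y x hxy.symm (by simpa using hy) hx
    exact ⟨this.2, this.1⟩) w hw
  omega

end TreeMetric

end Arboreal

namespace Arboreal

/-! ### Splits of trees -/

namespace Labelled

variable {I : Type}

/-- The leaves labelled by `a`, `b` are separated by an edge from those labelled by `c`, `d`. -/
def Sep (Z : Labelled I) (a b c d : I) : Prop :=
  (Z.same a b ∧ ¬ Z.same a c ∧ ¬ Z.same a d) ∨ (Z.same c d ∧ ¬ Z.same a c ∧ ¬ Z.same b c) ∨
    (Z.rel a c b d ∧ Z.rel a d b c)

/-- `Z` is the structure induced by the compatible split system `S`. -/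
structure InducedBy (Z : Labelled I) (S : Set (Set I)) : Prop where
  nonempty : ∀ A ∈ S, A.Nonempty
  compl : ∀ A ∈ S, Aᶜ ∈ S
  compat : ∀ A ∈ S, ∀ B ∈ S, ∀ a b c d, a ∈ A → a ∈ B → b ∈ A → b ∉ B → c ∉ A → c ∈ B →
    d ∉ A → d ∉ B → False
  same_iff : ∀ a b, Z.same a b ↔ ∀ A ∈ S, a ∈ A → b ∈ A
  leaf : ∀ a b, ¬ Z.same a b → {x | Z.same a x} ∈ S
  rel_iff : ∀ a b c d, Z.rel a b c d ↔
    (¬ Z.same a b ∧ ¬ Z.same a c ∧ ¬ Z.same a d ∧ ¬ Z.same b c ∧ ¬ Z.same b d ∧ ¬ Z.same c d) ∧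
      ∃ A ∈ S, a ∈ A ∧ b ∉ A ∧ (c ∈ A ∧ d ∉ A ∨ d ∈ A ∧ c ∉ A)

namespace InducedBy

variable {Z : Labelled I} {S : Set (Set I)} (h : Z.InducedBy S)
include h

theorem same_refl (a : I) : Z.same a a := (h.same_iff a a).2 fun _ _ => id

theorem same_symm {a b : I} (hab : Z.same a b) : Z.same b a :=
  (h.same_iff b a).2 fun A hA hb => by
    by_contra ha
    exact (h.same_iff a b).1 hab Aᶜ (h.compl A hA) ha hb

theorem same_trans {a b c : I} (hab : Z.same a b) (hbc : Z.same b c) : Z.same a c :=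
  (h.same_iff a c).2 fun A hA ha => (h.same_iff b c).1 hbc A hA ((h.same_iff a b).1 hab A hA ha)

theorem not_same_of_mem {a b : I} {A : Set I} (hA : A ∈ S) (ha : a ∈ A) (hb : b ∉ A) :
    ¬ Z.same a b := fun hab => hb ((h.same_iff a b).1 hab A hA ha)

theorem not_same_of_mem' {a b : I} {A : Set I} (hA : A ∈ S) (ha : a ∈ A) (hb : b ∉ A) :
    ¬ Z.same b a := fun hab => h.not_same_of_mem hA ha hb (h.same_symm hab)

/-- `Sep` uses only `same` and `rel`, yet detects a split `ab|cd`. For four distinct leaves, `rel a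
c b d` allows `ab|cd` or `ad|bc`, and `rel a d b c` allows `ab|cd` or `ac|bd`. Since `ad|bc` and
`ac|bd` are incompatible, both relations together force `ab|cd`. -/
theorem sep_iff {a b c d : I} :
    Z.Sep a b c d ↔ ∃ A ∈ S, a ∈ A ∧ b ∈ A ∧ c ∉ A ∧ d ∉ A := by
  constructor
  · rintro (⟨h1, h2, h3⟩ | ⟨h1, h2, h3⟩ | ⟨h1, h2⟩)
    · exact ⟨_, h.leaf a c h2, h.same_refl a, h1, h2, h3⟩
    · refine ⟨_, h.compl _ (h.leaf c a fun hh => h2 (h.same_symm hh)), ?_⟩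
      exact ⟨fun hh => h2 (h.same_symm hh), fun hh => h3 (h.same_symm hh),
        fun hh => hh (h.same_refl c), fun hh => hh h1⟩
    · obtain ⟨-, A, hA, a1, a2, a3⟩ := (h.rel_iff _ _ _ _).1 h1
      obtain ⟨-, B, hB, b1, b2, b3⟩ := (h.rel_iff _ _ _ _).1 h2
      rcases a3 with a3 | a3
      · exact ⟨A, hA, a1, a3.1, a2, a3.2⟩
      rcases b3 with b3 | b3
      · exact ⟨B, hB, b1, b3.1, b3.2, b2⟩
      exact (h.compat A hA B hB a d c b a1 b1 a3.1 b2 a2 b3.1 a3.2 b3.2).elim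
  · rintro ⟨A, hA, a1, a2, a3, a4⟩
    have n1 := h.not_same_of_mem hA a1 a3
    have n2 := h.not_same_of_mem hA a1 a4
    have n3 := h.not_same_of_mem hA a2 a3
    have n4 := h.not_same_of_mem hA a2 a4
    by_cases hab : Z.same a b
    · exact Or.inl ⟨hab, n1, n2⟩
    by_cases hcd : Z.same c d
    · exact Or.inr (Or.inl ⟨hcd, n1, n3⟩)
    refine Or.inr (Or.inr ⟨(h.rel_iff _ _ _ _).2 ⟨⟨n1, hab, n2, ?_, hcd, n4⟩, A, hA, a1, a3,
      Or.inl ⟨a2, a4⟩⟩, (h.rel_iff _ _ _ _).2 ⟨⟨n2, hab, n1, ?_, ?_, n3⟩, A, hA, a1, a4,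
      Or.inl ⟨a2, a3⟩⟩⟩)
    · exact fun hh => n3 (h.same_symm hh)
    · exact fun hh => n4 (h.same_symm hh)
    · exact fun hh => hcd (h.same_symm hh)

theorem rel_iff_sep {a b c d : I} : Z.rel a b c d ↔
    (¬ Z.same a b ∧ ¬ Z.same a c ∧ ¬ Z.same a d ∧ ¬ Z.same b c ∧ ¬ Z.same b d ∧ ¬ Z.same c d) ∧
      (Z.Sep a c b d ∨ Z.Sep a d b c) := by
  rw [h.rel_iff, h.sep_iff, h.sep_iff]
  refine and_congr_right fun _ => ?_
  constructor
  · rintro ⟨A, hA, a1, a2, a3 | a3⟩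
    · exact Or.inl ⟨A, hA, a1, a3.1, a2, a3.2⟩
    · exact Or.inr ⟨A, hA, a1, a3.1, a2, a3.2⟩
  · rintro (⟨A, hA, a1, a2, a3, a4⟩ | ⟨A, hA, a1, a2, a3, a4⟩)
    · exact ⟨A, hA, a1, a3, Or.inl ⟨a2, a4⟩⟩
    · exact ⟨A, hA, a1, a3, Or.inr ⟨a2, a4⟩⟩

theorem same_iff_sep {a b : I} : Z.same a b ↔ ¬ Z.Sep a a b b := by
  rw [h.sep_iff, h.same_iff]
  constructor
  · rintro h1 ⟨A, hA, a1, -, a3, -⟩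
    exact a3 (h1 A hA a1)
  · intro h1 A hA ha
    by_contra hb
    exact h1 ⟨A, hA, ha, ha, hb, hb⟩

end InducedBy

/-- All splits displayed by `Z`. -/
def splits (Z : Labelled I) : Set (Set I) :=
  {A | A.Nonempty ∧ Aᶜ.Nonempty ∧ ∀ a ∈ A, ∀ b ∈ A, ∀ c ∉ A, ∀ d ∉ A, Z.Sep a b c d}

/-- Replaces a split system coming from a particular tree graph by one that depends on `Z` alone.
The conditions involve at most four labels at a time, and on these a displayed split agrees with
some member of `S`. -/
theorem InducedBy.splits {Z : Labelled I} {S : Set (Set I)} (h : Z.InducedBy S) :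
    Z.InducedBy Z.splits := by
  have hsub : S ⊆ Z.splits := fun A hA =>
    ⟨h.nonempty A hA, h.nonempty _ (h.compl A hA), fun a ha b hb c hc d hd =>
      h.sep_iff.2 ⟨A, hA, ha, hb, hc, hd⟩⟩
  have hsep : ∀ {a b c d}, (∃ A ∈ Z.splits, a ∈ A ∧ b ∈ A ∧ c ∉ A ∧ d ∉ A) →
      ∃ A ∈ S, a ∈ A ∧ b ∈ A ∧ c ∉ A ∧ d ∉ A := by
    rintro a b c d ⟨A, hA, a1, a2, a3, a4⟩
    exact h.sep_iff.1 (hA.2.2 a a1 b a2 c a3 d a4)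
  have hsame : ∀ {a b A}, A ∈ Z.splits → a ∈ A → b ∉ A → ¬ Z.same a b := by
    intro a b A hA ha hb
    obtain ⟨B, hB, b1, -, b2, -⟩ := hsep ⟨A, hA, ha, ha, hb, hb⟩
    exact h.not_same_of_mem hB b1 b2
  refine ⟨fun A hA => hA.1, ?_, ?_, ?_, fun a b hab => hsub (h.leaf a b hab), ?_⟩
  · rintro A ⟨h1, h2, h3⟩
    refine ⟨h2, by rwa [compl_compl], fun a ha b hb c hc d hd => ?_⟩
    obtain ⟨B, hB, b1, b2, b3, b4⟩ := h.sep_iff.1 (h3 c (not_not.1 hc) d (not_not.1 hd) a ha b hb)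
    exact h.sep_iff.2 ⟨Bᶜ, h.compl B hB, b3, b4, not_not.2 b1, not_not.2 b2⟩
  · intro A hA B hB a b c d a1 a2 b1 b2 c1 c2 d1 d2
    obtain ⟨A', hA', x1, x2, x3, x4⟩ := h.sep_iff.1 (hA.2.2 a a1 b b1 c c1 d d1)
    obtain ⟨B', hB', y1, y2, y3, y4⟩ := h.sep_iff.1 (hB.2.2 a a2 c c2 b b2 d d2)
    exact h.compat A' hA' B' hB' a b c d x1 y1 x2 y3 x3 y2 x4 y4
  · intro a b
    constructor
    · intro hab A hA ha
      by_contra hb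
      exact hsame hA ha hb hab
    · exact fun hh => (h.same_iff a b).2 fun A hA => hh A (hsub hA)
  · intro a b c d
    rw [h.rel_iff]
    refine and_congr_right fun _ => ⟨fun ⟨A, hA, hh⟩ => ⟨A, hsub hA, hh⟩, ?_⟩
    rintro ⟨A, hA, a1, a2, a3 | a3⟩
    · obtain ⟨B, hB, b1, b2, b3, b4⟩ := hsep ⟨A, hA, a1, a3.1, a2, a3.2⟩
      exact ⟨B, hB, b1, b3, Or.inl ⟨b2, b4⟩⟩
    · obtain ⟨B, hB, b1, b2, b3, b4⟩ := hsep ⟨A, hA, a1, a3.1, a2, a3.2⟩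
      exact ⟨B, hB, b1, b3, Or.inr ⟨b2, b4⟩⟩

/-- The partition of the labels by a point of the tree: removing the point leaves
the classes of `p`. -/
structure IsPos (Z : Labelled I) (p : I → I → Prop) : Prop where
  refl : ∀ x, p x x
  symm : ∀ {x y}, p x y → p y x
  trans : ∀ {x y z}, p x y → p y z → p x z
  sep : ∀ {x y z w}, p x y → ¬ p x z → ¬ p x w → Z.Sep x y z w
  not_sep : ∀ {x y z w}, ¬ p x y → ¬ p z w → ¬ Z.Sep x y z w

/-- The partition of the labels by a node of the tree. -/
structure IsNode (Z : Labelled I) (p : I → I → Prop) : Prop extends Z.IsPos p where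
  three : ∃ a b c, ¬ p a b ∧ ¬ p a c ∧ ¬ p b c

/-- Of three distinct classes at least two miss `x`, and a pair in the class of `x` is separated
from their representatives. So a point with three branches is determined by one label in each, as
their median. -/
theorem IsPos.iff_of_three {Z : Labelled I} {p : I → I → Prop} (hp : Z.IsPos p) {a b c : I}
    (hab : ¬ p a b) (hac : ¬ p a c) (hbc : ¬ p b c) (x y : I) :
    p x y ↔ Z.Sep x y a b ∨ Z.Sep x y a c ∨ Z.Sep x y b c := by
  constructor
  · intro hxy
    by_cases ha : p x a
    · exact Or.inr (Or.inr (hp.sep hxy (fun hb => hab (hp.trans (hp.symm ha) hb))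
        (fun hc => hac (hp.trans (hp.symm ha) hc))))
    by_cases hb : p x b
    · exact Or.inr (Or.inl (hp.sep hxy ha (fun hc => hbc (hp.trans (hp.symm hb) hc))))
    exact Or.inl (hp.sep hxy ha hb)
  · intro h
    by_contra hxy
    rcases h with h | h | h
    · exact hp.not_sep hxy hab h
    · exact hp.not_sep hxy hac h
    · exact hp.not_sep hxy hbc h

theorem IsPos.ext_of_three {Z : Labelled I} {p q : I → I → Prop} (hp : Z.IsPos p)
    (hq : Z.IsPos q) {a b c : I} (hab : ¬ p a b) (hac : ¬ p a c) (hbc : ¬ p b c)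
    (hab' : ¬ q a b) (hac' : ¬ q a c) (hbc' : ¬ q b c) : p = q := by
  funext x y
  rw [hp.iff_of_three hab hac hbc, hq.iff_of_three hab' hac' hbc']

end Labelled

/-- The number of classes of an equivalence relation. -/
noncomputable def classes {I : Type} (p : I → I → Prop) : ℕ := (Set.range p).ncard

/-! ### The splits and nodes of a tree model -/

namespace TreeModel

variable {I : Type} {Z : Labelled I} (M : TreeModel Z)

theorem isTree (v : M.V) : M.G.IsTree :=
  ⟨{ preconnected := M.preconnected, nonempty := ⟨v⟩ }, M.acyclic⟩

/-- The labels on the side of `u` of the edge `u—v`. -/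
def side (u v : M.V) : Set I := {a | M.G.dist u (M.leaf a) < M.G.dist v (M.leaf a)}

theorem side_nonempty {u v : M.V} (h : M.G.Adj u v) : (M.side u v).Nonempty := by
  have := M.finite
  obtain ⟨w, hw, hle⟩ := exists_leaf_in_side (M.isTree u) h
  obtain ⟨a, rfl⟩ := (M.range_leaf w).2 hle
  exact ⟨a, hw⟩

theorem compl_side {u v : M.V} (h : M.G.Adj u v) : (M.side u v)ᶜ = M.side v u := by
  ext a
  have := dist_adj_cases (M.isTree u) h (M.leaf a)
  simp only [side, Set.mem_compl_iff, Set.mem_ofPred_eq]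
  omega

theorem notMem_side {u v : M.V} (h : M.G.Adj u v) {a : I} :
    a ∉ M.side u v ↔ a ∈ M.side v u := by
  rw [← M.compl_side h]; rfl

/-- Compatibility is `sides_compatible`. A leaf that is not alone has a single edge, whose side at
the leaf carries only the labels of that leaf. Whether two paths share an edge is read off from the
sides of their ends. -/
theorem inducedBy : Z.InducedBy {A | ∃ u v, M.G.Adj u v ∧ A = M.side u v} := by
  have := M.finite
  have hleaf : ∀ a b, M.leaf a ≠ M.leaf b → ∃ u, M.G.Adj (M.leaf a) u ∧
      {x | M.leaf a = M.leaf x} = M.side (M.leaf a) u := by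
    intro a b hab
    have hT := M.isTree (M.leaf a)
    obtain ⟨u, hu, -⟩ := exists_adj_closer hT.connected hab
    refine ⟨u, hu, ?_⟩
    ext x
    simp only [Set.mem_ofPred_eq, side]
    constructor
    · intro hx
      rw [← hx, SimpleGraph.dist_self, SimpleGraph.dist_eq_one_iff_adj.2 hu.symm]
      exact one_pos
    · intro hx
      by_contra hne
      obtain ⟨w, hw, hwd⟩ := exists_adj_closer hT.connected hne
      have h1 := (Set.ncard_le_one (Set.toFinite _)).1 ((M.range_leaf _).1 ⟨a, rfl⟩) u hu w hw
      subst h1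
      omega
  have hsame : ∀ a b, Z.same a b ↔ ∀ A ∈ {A | ∃ u v, M.G.Adj u v ∧ A = M.side u v},
      a ∈ A → b ∈ A := by
    intro a b
    rw [M.same_iff]
    constructor
    · rintro hab A ⟨u, v, -, rfl⟩ ha
      simpa [side, hab] using ha
    · intro h
      by_contra hne
      obtain ⟨u, hu, hs⟩ := hleaf a b hne
      have : b ∈ M.side (M.leaf a) u := h _ ⟨_, _, hu, rfl⟩ (by rw [← hs]; rfl)
      rw [← hs] at this
      exact hne this
  refine ⟨?_, ?_, ?_, hsame, ?_, ?_⟩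
  · rintro A ⟨u, v, h, rfl⟩
    exact M.side_nonempty h
  · rintro A ⟨u, v, h, rfl⟩
    exact ⟨v, u, h.symm, M.compl_side h⟩
  · rintro A ⟨u, v, h, rfl⟩ B ⟨x, y, h', rfl⟩ a b c d a1 a2 b1 b2 c1 c2 d1 d2
    rw [M.notMem_side h'] at b2 d2
    rw [M.notMem_side h] at c1 d1
    exact sides_compatible (M.isTree u) h h' _ _ _ _ ⟨a1, a2⟩ ⟨b1, b2⟩ ⟨c1, c2⟩ ⟨d1, d2⟩
  · intro a b hab
    obtain ⟨u, hu, hs⟩ := hleaf a b (fun h => hab ((M.same_iff a b).2 h))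
    exact ⟨_, u, hu, by rw [← hs]; ext x; exact M.same_iff a x⟩
  · intro a b c d
    rw [M.rel_iff]
    simp only [List.nodup_cons, List.mem_cons, List.not_mem_nil, not_or, or_false,
      M.same_iff, not_false_eq_true, and_true, List.nodup_nil]
    constructor
    · rintro ⟨⟨⟨h1, h2, h3⟩, ⟨h4, h5⟩, h6⟩, p, q, e, hp, hq⟩
      refine ⟨⟨h1, h2, h3, h4, h5, h6⟩, ?_⟩
      induction e with
      | _ u v =>
      have huv : M.G.Adj u v := p.1.adj_of_mem_edges hp
      have sp := sides_of_mem_edges (M.isTree u) huv p.1 p.2 hp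
      have sq := sides_of_mem_edges (M.isTree u) huv q.1 q.2 hq
      have da := dist_adj_cases (M.isTree u) huv (M.leaf a)
      have db := dist_adj_cases (M.isTree u) huv (M.leaf b)
      have dc := dist_adj_cases (M.isTree u) huv (M.leaf c)
      have dd := dist_adj_cases (M.isTree u) huv (M.leaf d)
      by_cases ha : a ∈ M.side u v
      · refine ⟨_, ⟨u, v, huv, rfl⟩, ha, ?_, ?_⟩
        · simp only [side, Set.mem_ofPred_eq] at *; omega
        · simp only [side, Set.mem_ofPred_eq] at *; omega
      · refine ⟨_, ⟨v, u, huv.symm, rfl⟩, (M.notMem_side huv).1 ha, ?_, ?_⟩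
        · simp only [side, Set.mem_ofPred_eq] at *; omega
        · simp only [side, Set.mem_ofPred_eq] at *; omega
    · rintro ⟨⟨h1, h2, h3, h4, h5, h6⟩, A, ⟨u, v, huv, rfl⟩, ha, hb, hcd⟩
      refine ⟨⟨⟨h1, h2, h3⟩, ⟨h4, h5⟩, h6⟩, ?_⟩
      have hT := M.isTree u
      obtain ⟨p, hp, -⟩ := hT.connected.exists_path_of_dist (M.leaf a) (M.leaf b)
      obtain ⟨q, hq, -⟩ := hT.connected.exists_path_of_dist (M.leaf c) (M.leaf d)
      refine ⟨⟨p, hp⟩, ⟨q, hq⟩, s(u, v),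
        mem_edges_of_sides hT huv p ha ((M.notMem_side huv).1 hb), ?_⟩
      rcases hcd with ⟨hc, hd⟩ | ⟨hd, hc⟩
      · exact mem_edges_of_sides hT huv q hc ((M.notMem_side huv).1 hd)
      · rw [Sym2.eq_swap]
        exact mem_edges_of_sides hT huv.symm q ((M.notMem_side huv).1 hc) hd

theorem sep_iff {a b c d : I} : Z.Sep a b c d ↔
    ∃ u v, M.G.Adj u v ∧ a ∈ M.side u v ∧ b ∈ M.side u v ∧ c ∈ M.side v u ∧ d ∈ M.side v u := by
  rw [M.inducedBy.sep_iff]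
  constructor
  · rintro ⟨A, ⟨u, v, h, rfl⟩, h1, h2, h3, h4⟩
    exact ⟨u, v, h, h1, h2, (M.notMem_side h).1 h3, (M.notMem_side h).1 h4⟩
  · rintro ⟨u, v, h, h1, h2, h3, h4⟩
    exact ⟨_, ⟨u, v, h, rfl⟩, h1, h2, (M.notMem_side h).2 h3, (M.notMem_side h).2 h4⟩

/-- Two labels are in the same branch at `v`. -/
def branch (v : M.V) (a b : I) : Prop := ∃ u, M.G.Adj v u ∧ a ∈ M.side u v ∧ b ∈ M.side u v

theorem leaf_ne {v : M.V} (hv : 2 ≤ M.valence v) (a : I) : v ≠ M.leaf a := by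
  rintro rfl
  have := (M.range_leaf (M.leaf a)).1 ⟨a, rfl⟩
  simp only [valence] at hv
  omega

theorem exists_side {v : M.V} (hv : 2 ≤ M.valence v) (a : I) :
    ∃ u, M.G.Adj v u ∧ a ∈ M.side u v := by
  obtain ⟨u, hu, hd⟩ := exists_adj_closer (M.isTree v).connected (M.leaf_ne hv a)
  exact ⟨u, hu, by simp only [side, Set.mem_ofPred_eq]; omega⟩

theorem side_unique {v u₁ u₂ : M.V} (h₁ : M.G.Adj v u₁) (h₂ : M.G.Adj v u₂) {a : I}
    (a₁ : a ∈ M.side u₁ v) (a₂ : a ∈ M.side u₂ v) : u₁ = u₂ :=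
  closer_unique (M.isTree v) h₁ h₂ a₁ a₂

theorem branch_iff {v u : M.V} (h : M.G.Adj v u) {a : I} (ha : a ∈ M.side u v) (b : I) :
    M.branch v a b ↔ b ∈ M.side u v := by
  constructor
  · rintro ⟨u', h', ha', hb'⟩
    rwa [M.side_unique h h' ha ha']
  · exact fun hb => ⟨u, h, ha, hb⟩

/-- Seen from `v`, everything beyond the edge lies in the direction of the first step towards it. -/
theorem branch_of_side {u w v : M.V} (h : M.G.Adj u w) (hv : M.G.dist w v < M.G.dist u v)
    {a b : I} (ha : a ∈ M.side u w) (hb : b ∈ M.side u w) : M.branch v a b := by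
  have hT := M.isTree u
  have ea := dist_through_edge hT h hv ha
  have eb := dist_through_edge hT h hv hb
  by_cases hvw : v = w
  · subst hvw
    exact ⟨u, h.symm, ha, hb⟩
  · obtain ⟨x, hx, hxd⟩ := exists_adj_closer hT.connected hvw
    have tr : ∀ y, M.G.dist w y = M.G.dist u y + 1 → M.G.dist x y ≤ M.G.dist x w + 1 + M.G.dist u y := by
      intro y hy
      have := hT.connected.dist_triangle (u := x) (v := w) (w := y)
      omega
    have ca := dist_adj_cases hT h (M.leaf a)
    have cb := dist_adj_cases hT h (M.leaf b)
    have ta := tr (M.leaf a)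
    have tb := tr (M.leaf b)
    refine ⟨x, hx, ?_, ?_⟩ <;> simp only [side, Set.mem_ofPred_eq] at * <;> omega

/-- For `not_sep`: `v` lies on one side of any edge, and by `branch_of_side` the labels on the other
side form part of one branch. The bound on the valence excludes leaves, whose own labels lie in no
branch. -/
theorem branch_isPos {v : M.V} (hv : 2 ≤ M.valence v) : Z.IsPos (M.branch v) := by
  refine ⟨fun x => ?_, ?_, ?_, ?_, ?_⟩
  · obtain ⟨u, hu, hx⟩ := M.exists_side hv x
    exact ⟨u, hu, hx, hx⟩
  · rintro x y ⟨u, hu, hx, hy⟩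
    exact ⟨u, hu, hy, hx⟩
  · rintro x y z ⟨u, hu, hx, hy⟩ h
    exact ⟨u, hu, hx, (M.branch_iff hu hy z).1 h⟩
  · rintro x y z w ⟨u, hu, hx, hy⟩ hz hw
    rw [M.branch_iff hu hx, M.notMem_side hu.symm] at hz hw
    exact M.sep_iff.2 ⟨u, v, hu.symm, hx, hy, hz, hw⟩
  · intro x y z w hxy hzw hs
    obtain ⟨s, t, hst, h1, h2, h3, h4⟩ := M.sep_iff.1 hs
    rcases dist_adj_cases (M.isTree v) hst v with h | h
    · exact hxy (M.branch_of_side hst (by omega) h1 h2)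
    · exact hzw (M.branch_of_side hst.symm (by omega) h3 h4)

/-- Branches correspond to neighbours, because every side of an edge carries a label. -/
theorem classes_branch {v : M.V} (hv : 2 ≤ M.valence v) :
    classes (M.branch v) = M.valence v := by
  symm
  have hrow : ∀ u, M.G.Adj v u → ∀ a ∈ M.side u v, M.branch v a = fun b => b ∈ M.side u v := by
    intro u hu a ha
    funext b
    exact propext (M.branch_iff hu ha b)
  refine Set.ncard_congr (fun u _ => fun b => b ∈ M.side u v) ?_ ?_ ?_
  · intro u hu
    obtain ⟨a, ha⟩ := M.side_nonempty (M.G.adj_symm hu)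
    exact ⟨a, hrow u hu a ha⟩
  · intro u u' hu hu' h
    obtain ⟨a, ha⟩ := M.side_nonempty (M.G.adj_symm hu)
    exact M.side_unique hu hu' ha ((congrFun h a).mp ha)
  · rintro _ ⟨a, rfl⟩
    obtain ⟨u, hu, ha⟩ := M.exists_side hv a
    exact ⟨u, hu, (hrow u hu a ha).symm⟩

theorem branch_isNode {v : M.V} (hv : 3 ≤ M.valence v) : Z.IsNode (M.branch v) := by
  refine ⟨M.branch_isPos (by omega), ?_⟩
  have := M.finite
  obtain ⟨s, hs, hcard⟩ := Set.exists_subset_card_eq hv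
  obtain ⟨x, y, z, hxy, hxz, hyz, rfl⟩ := Set.ncard_eq_three.1 hcard
  have hx : M.G.Adj v x := hs (by simp)
  have hy : M.G.Adj v y := hs (by simp)
  have hz : M.G.Adj v z := hs (by simp)
  obtain ⟨a, ha⟩ := M.side_nonempty hx.symm
  obtain ⟨b, hb⟩ := M.side_nonempty hy.symm
  obtain ⟨c, hc⟩ := M.side_nonempty hz.symm
  refine ⟨a, b, c, ?_, ?_, ?_⟩
  · rw [M.branch_iff hx ha]
    exact fun h => hxy (M.side_unique hx hy h hb)
  · rw [M.branch_iff hx ha]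
    exact fun h => hxz (M.side_unique hx hz h hc)
  · rw [M.branch_iff hy hb]
    exact fun h => hyz (M.side_unique hy hz h hc)

/-- At least two neighbours of `v` do not lead to `w`. Labels beyond these are in different branches
at `v`, but in the same branch at `w`. -/
theorem branch_injective {v w : M.V} (hv : 3 ≤ M.valence v)
    (h : M.branch v = M.branch w) : v = w := by
  by_contra hne
  have := M.finite
  have hT := M.isTree v
  obtain ⟨u, hu, hud⟩ := exists_adj_closer hT.connected hne
  have hcard : 1 < (M.G.neighborSet v \ {u}).ncard := by
    have := Set.ncard_sdiff_singleton_add_one (show u ∈ M.G.neighborSet v from hu) (Set.toFinite _)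
    simp only [valence] at hv
    omega
  obtain ⟨x, y, hx, hy, hxy⟩ := (Set.one_lt_ncard_iff (Set.toFinite _)).1 hcard
  have hx1 : M.G.Adj v x := hx.1
  have hy1 : M.G.Adj v y := hy.1
  obtain ⟨a, ha⟩ := M.side_nonempty hx1.symm
  obtain ⟨b, hb⟩ := M.side_nonempty hy1.symm
  have hab : ¬ M.branch v a b := by
    rw [M.branch_iff hx1 ha]
    exact fun h => hxy (M.side_unique hx1 hy1 h hb)
  apply hab
  rw [h]
  have key : ∀ z, M.G.Adj v z → z ≠ u → ∀ c ∈ M.side z v, c ∈ M.side v u := by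
    intro z hz hzu c hc
    rw [← M.notMem_side hu.symm]
    exact fun hcu => hzu (M.side_unique hz hu hc hcu)
  exact M.branch_of_side hu (by omega) (key x hx1 hx.2 a ha) (key y hy1 hy.2 b hb)

/-- The vertex is the median of three leaves in distinct classes, found by minimising the sum of the
distances to them. -/
theorem exists_branch_eq {p : I → I → Prop} (hp : Z.IsNode p) :
    ∃ v, 3 ≤ M.valence v ∧ M.branch v = p := by
  have := M.finite
  obtain ⟨a, b, c, hab, hac, hbc⟩ := hp.three
  let f : M.V → ℕ := fun v => M.G.dist v (M.leaf a) + M.G.dist v (M.leaf b) + M.G.dist v (M.leaf c)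
  obtain ⟨v, -, hmin⟩ := Set.Finite.exists_minimalFor f Set.univ (Set.toFinite _)
    ⟨M.leaf a, trivial⟩
  have hT := M.isTree v
  have hdiff : ∀ x y, ¬ p x y → M.leaf x ≠ M.leaf y := by
    intro x y hxy h
    apply hxy
    have hxy' := (M.same_iff x y).2 h
    by_contra hcon
    exact hp.not_sep hxy hcon (by
      exfalso
      have h1 := hp.sep (hp.refl x) hxy hxy
      obtain ⟨A, hA, h2, -, h3, -⟩ := M.inducedBy.sep_iff.1 h1
      exact M.inducedBy.not_same_of_mem hA h2 h3 hxy')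
  have hle : ∀ u, M.G.Adj v u → f v ≤ f u := fun u _ => by
    rcases le_total (f v) (f u) with h | h
    · exact h
    · exact hmin (Set.mem_univ u) h
  -- A step to a neighbour that is nearer to two of the three leaves would lower the sum.
  have hmove : ∀ u, M.G.Adj v u →
      ¬ (a ∈ M.side u v ∧ b ∈ M.side u v) ∧ ¬ (a ∈ M.side u v ∧ c ∈ M.side u v) ∧
      ¬ (b ∈ M.side u v ∧ c ∈ M.side u v) := by
    intro u hu
    have h0 := hle u hu
    have h1 := dist_adj_cases hT hu (M.leaf a)
    have h2 := dist_adj_cases hT hu (M.leaf b)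
    have h3 := dist_adj_cases hT hu (M.leaf c)
    simp only [f, side, Set.mem_ofPred_eq] at *
    omega
  have hside : ∀ x, v ≠ M.leaf x → ∃ u, M.G.Adj v u ∧ x ∈ M.side u v := by
    intro x hx
    obtain ⟨u, hu, hd⟩ := exists_adj_closer hT.connected hx
    exact ⟨u, hu, by simp only [side, Set.mem_ofPred_eq]; omega⟩
  -- The minimiser is none of the three leaves: from a leaf the other two are seen through its only
  -- neighbour, against `hmove`.
  have hnl : ∀ x y z, ¬ p x y → ¬ p x z →
      (∀ u, M.G.Adj v u → ¬ (y ∈ M.side u v ∧ z ∈ M.side u v)) → v ≠ M.leaf x := by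
    rintro x y z hxy hxz hyz rfl
    obtain ⟨u, hu, hy⟩ := hside y (hdiff x y hxy)
    obtain ⟨w, hw, hz⟩ := hside z (hdiff x z hxz)
    have h1 := (Set.ncard_le_one (Set.toFinite _)).1 ((M.range_leaf _).1 ⟨x, rfl⟩) u hu w hw
    subst h1
    exact hyz u hu ⟨hy, hz⟩
  have hba := fun h => hab (hp.symm h)
  have hca := fun h => hac (hp.symm h)
  have hcb := fun h => hbc (hp.symm h)
  obtain ⟨x, hx, hxa⟩ := hside a (hnl a b c hab hac fun u hu => (hmove u hu).2.2)
  obtain ⟨y, hy, hyb⟩ := hside b (hnl b a c hba hbc fun u hu => (hmove u hu).2.1)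
  obtain ⟨z, hz, hzc⟩ := hside c (hnl c a b hca hcb fun u hu => (hmove u hu).1)
  have hxy : x ≠ y := by rintro rfl; exact (hmove x hx).1 ⟨hxa, hyb⟩
  have hxz : x ≠ z := by rintro rfl; exact (hmove x hx).2.1 ⟨hxa, hzc⟩
  have hyz : y ≠ z := by rintro rfl; exact (hmove y hy).2.2 ⟨hyb, hzc⟩
  have hv : 3 ≤ M.valence v := by
    rw [valence, ← Set.ncard_eq_three.2 ⟨x, y, z, hxy, hxz, hyz, rfl⟩]
    refine Set.ncard_le_ncard ?_ (Set.toFinite _)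
    rintro _ (rfl | rfl | rfl) <;> assumption
  refine ⟨v, hv, (M.branch_isPos (by omega)).ext_of_three hp.toIsPos ?_ ?_ ?_ hab hac hbc⟩
  · rw [M.branch_iff hx hxa]
    exact fun h => (hmove x hx).1 ⟨hxa, h⟩
  · rw [M.branch_iff hx hxa]
    exact fun h => (hmove x hx).2.1 ⟨hxa, h⟩
  · rw [M.branch_iff hy hyb]
    exact fun h => (hmove y hy).2.2 ⟨hyb, h⟩

end TreeModel

namespace Labelled

variable {I : Type} {Z : Labelled I}

theorem IsTree.inducedBy (h : Z.IsTree) : Z.InducedBy Z.splits := by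
  obtain ⟨M⟩ := h
  exact M.inducedBy.splits

/-- Frees the count from the chosen tree graph: vertices of valence at least three correspond to
`IsNode` partitions, with the valence as number of classes. -/
theorem IsTree.nodeCount_eq (h : Z.IsTree) {i : ℕ} (hi : 3 ≤ i) :
    Z.nodeCount i = {p | Z.IsNode p ∧ i ≤ classes p}.ncard := by
  rw [nodeCount, dif_pos h]
  refine Set.ncard_congr (fun v _ => h.some.branch v) ?_ ?_ ?_
  · intro v hv
    have hv' : i ≤ h.some.valence v := hv
    exact ⟨h.some.branch_isNode (by omega), by rwa [h.some.classes_branch (by omega)]⟩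
  · intro v w hv hw hvw
    have hv' : i ≤ h.some.valence v := hv
    exact h.some.branch_injective (by omega) hvw
  · rintro p ⟨hp, hip⟩
    obtain ⟨v, hv, rfl⟩ := h.some.exists_branch_eq hp
    rw [h.some.classes_branch (by omega)] at hip
    exact ⟨v, hip, rfl⟩

theorem IsTree.level_le_iff (h : Z.IsTree) {N : ℕ} :
    Z.level ≤ N ↔ ∀ p, Z.IsNode p → classes p ≤ N := by
  rw [level, dif_pos h]
  have hfin := h.some.finite
  have hbdd : BddAbove {d : ℕ | 3 ≤ d ∧ ∃ v : h.some.V, h.some.valence v = d} := by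
    refine Set.Finite.bddAbove ((Set.finite_range h.some.valence).subset ?_)
    rintro d ⟨-, v, rfl⟩
    exact ⟨v, rfl⟩
  constructor
  · intro hle p hp
    obtain ⟨v, hv, rfl⟩ := h.some.exists_branch_eq hp
    rw [h.some.classes_branch (by omega)]
    exact (le_csSup hbdd ⟨hv, v, rfl⟩).trans hle
  · intro hle
    refine csSup_le' ?_
    rintro d ⟨hd, v, rfl⟩
    rw [← h.some.classes_branch (by omega)]
    exact hle _ (h.some.branch_isNode hd)

theorem inClass_iff {N : ℕ∞} :
    Z.InClass N ↔ Z.IsTree ∧ ∀ p, Z.IsNode p → (classes p : ℕ∞) ≤ N := by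
  refine and_congr_right fun h => ?_
  cases N with
  | top => simp
  | coe n =>
    simp only [Nat.cast_le]
    exact h.level_le_iff

end Labelled

end Arboreal

namespace Arboreal

/-! ### From split systems to trees -/

namespace Labelled

variable {I : Type}

/-- The sides, away from `r`, of the splits in `S`, together with the set of all labels. -/
abbrev Cluster (S : Set (Set I)) (r : I) : Type := {C : Set I // C = Set.univ ∨ C ∈ S ∧ r ∉ C}

namespace Cluster

variable {Z : Labelled I} {S : Set (Set I)} {r : I}

/-- The cluster of all labels. -/
def top (S : Set (Set I)) (r : I) : Cluster S r := ⟨Set.univ, Or.inl rfl⟩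

theorem le_iff {C D : Cluster S r} : C ≤ D ↔ C.1 ⊆ D.1 := Iff.rfl

theorem le_top (C : Cluster S r) : C ≤ top S r := Set.subset_univ C.1

theorem mem_of_ne {C : Cluster S r} (h : C ≠ top S r) : C.1 ∈ S ∧ r ∉ C.1 :=
  C.2.resolve_left fun hC => h (Subtype.ext hC)

theorem nonempty (h : Z.InducedBy S) (C : Cluster S r) : C.1.Nonempty := by
  rcases C.2 with hC | hC
  · exact ⟨r, by rw [hC]; trivial⟩
  · exact h.nonempty _ hC.1

theorem comparable (h : Z.InducedBy S) {C D : Cluster S r} {a : I} (hC : a ∈ C.1) (hD : a ∈ D.1) :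
    C ≤ D ∨ D ≤ C := by
  by_cases h1 : C = top S r
  · exact Or.inr (h1 ▸ le_top D)
  by_cases h2 : D = top S r
  · exact Or.inl (h2 ▸ le_top C)
  by_contra hcon
  rw [not_or, le_iff, le_iff, Set.not_subset, Set.not_subset] at hcon
  obtain ⟨⟨b, b1, b2⟩, c, c1, c2⟩ := hcon
  exact h.compat _ (mem_of_ne h1).1 _ (mem_of_ne h2).1 a b c r hC hD b1 b2 c2 c1
    (mem_of_ne h1).2 (mem_of_ne h2).2

theorem covBy_unique (h : Z.InducedBy S) {C D E : Cluster S r} (hD : C ⋖ D) (hE : C ⋖ E) :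
    D = E := by
  obtain ⟨a, ha⟩ := nonempty h C
  rcases comparable h (hD.le ha) (hE.le ha) with hle | hle
  · exact (hE.eq_or_eq hD.le hle).resolve_left hD.lt.ne'
  · exact ((hD.eq_or_eq hE.le hle).resolve_left hE.lt.ne').symm

theorem boundary (h : Z.InducedBy S) {C x y : Cluster S r} (hxy : (SimpleGraph.hasse _).Adj x y)
    (hx : x ≤ C) (hy : ¬ y ≤ C) : x = C ∧ C ⋖ y := by
  rw [SimpleGraph.hasse_adj] at hxy
  rcases hxy with hxy | hxy
  · obtain ⟨a, ha⟩ := nonempty h x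
    rcases comparable h (hx ha) (hxy.le ha) with hle | hle
    · have hC : C = x := (hxy.eq_or_eq hx hle).resolve_right fun hCy => hy hCy.ge
      exact ⟨hC.symm, hC ▸ hxy⟩
    · exact absurd hle hy
  · exact absurd (hxy.le.trans hx) hy

theorem exists_covBy [Finite I] {C : Cluster S r} (hC : C ≠ top S r) : ∃ D, C ⋖ D := by
  obtain ⟨D, hD, -⟩ := exists_covBy_le_of_lt ((le_top C).lt_of_ne hC)
  exact ⟨D, hD⟩

theorem reachable_top [Finite I] (C : Cluster S r) :
    (SimpleGraph.hasse (Cluster S r)).Reachable C (top S r) := by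
  induction C using WellFoundedGT.induction with
  | ind C ih =>
    by_cases hC : C = top S r
    · rw [hC]
    · obtain ⟨D, hD⟩ := exists_covBy hC
      exact (SimpleGraph.Adj.reachable (Or.inl hD)).trans (ih D hD.lt)

/-- Clusters that meet are nested, since `r` lies outside all of them except the top; hence every
cluster below the top has exactly one parent. The only edge leaving the set of clusters below `C`
goes from `C` to its parent, so every edge is a bridge. -/
theorem isTree [Finite I] (h : Z.InducedBy S) (r : I) :
    (SimpleGraph.hasse (Cluster S r)).IsTree := by
  refine ⟨{ preconnected := fun C D => (reachable_top C).trans (reachable_top D).symm,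
            nonempty := ⟨top S r⟩ }, ?_⟩
  have key : ∀ C D : Cluster S r, C ⋖ D → (SimpleGraph.hasse _).IsBridge s(C, D) := by
    intro C D hCD
    rw [SimpleGraph.isBridge_iff]
    rintro ⟨p⟩
    obtain ⟨d, -, h1, h2⟩ := p.exists_boundary_dart {x | x ≤ C} (le_refl C)
      (fun hle => hCD.lt.not_ge hle)
    have hadj := d.adj
    rw [SimpleGraph.deleteEdges_adj] at hadj
    obtain ⟨e1, e2⟩ := boundary h hadj.1 h1 h2
    refine hadj.2 ?_
    rw [e1, covBy_unique h e2 hCD]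
    rfl
  rw [SimpleGraph.isAcyclic_iff_forall_adj_isBridge]
  rintro C D (hCD | hCD)
  · exact key C D hCD
  · rw [Sym2.eq_swap]
    exact key D C hCD

/-- The clusters below `C` form one side of the edge above `C`, so the edges of the new tree give
back the splits in `S`. -/
theorem le_iff_dist [Finite I] (h : Z.InducedBy S) {C D : Cluster S r} (hCD : C ⋖ D)
    (w : Cluster S r) : w ≤ C ↔ (SimpleGraph.hasse _).dist C w < (SimpleGraph.hasse _).dist D w :=
  side_eq_of_boundary (isTree h r).connected (Or.inl hCD) {x | x ≤ C} (le_refl C)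
    (fun hle => hCD.lt.not_ge hle) (fun x y hxy hx hy => by
      obtain ⟨e1, e2⟩ := boundary h hxy hx hy
      exact ⟨e1, covBy_unique h e2 hCD⟩) w

open Classical in
/-- The vertex with a given label. -/
noncomputable def leaf (h : Z.InducedBy S) (r a : I) : Cluster S r :=
  if hr : Z.same a r then top S r else
    ⟨{x | Z.same a x}, Or.inr ⟨h.leaf a r hr, hr⟩⟩

theorem leaf_of_same (h : Z.InducedBy S) {a : I} (hr : Z.same a r) : leaf h r a = top S r :=
  dif_pos hr

theorem leaf_val (h : Z.InducedBy S) {a : I} (hr : ¬ Z.same a r) :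
    (leaf h r a).1 = {x | Z.same a x} := by
  rw [leaf, dif_neg hr]

theorem leaf_ne_top (h : Z.InducedBy S) {a : I} (hr : ¬ Z.same a r) : leaf h r a ≠ top S r := by
  intro he
  have : r ∈ (leaf h r a).1 := he ▸ trivial
  rw [leaf_val h hr] at this
  exact hr this

theorem leaf_le_iff (h : Z.InducedBy S) {C : Cluster S r} (hC : C ≠ top S r) (a : I) :
    leaf h r a ≤ C ↔ a ∈ C.1 := by
  obtain ⟨hCS, hCr⟩ := mem_of_ne hC
  by_cases hr : Z.same a r
  · rw [leaf_of_same h hr]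
    constructor
    · exact fun hle => absurd (hle (Set.mem_univ r)) hCr
    · exact fun ha => absurd ((h.same_iff a r).1 hr _ hCS ha) hCr
  · rw [le_iff, leaf_val h hr]
    exact ⟨fun hle => hle (h.same_refl a), fun ha x hx => (h.same_iff a x).1 hx _ hCS ha⟩

theorem leaf_eq_iff (h : Z.InducedBy S) (a b : I) : leaf h r a = leaf h r b ↔ Z.same a b := by
  by_cases ha : Z.same a r
  · rw [leaf_of_same h ha]
    constructor
    · intro he
      by_contra hab
      exact leaf_ne_top h (fun hb => hab (h.same_trans ha (h.same_symm hb))) he.symm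
    · intro hab
      rw [leaf_of_same h (h.same_trans (h.same_symm hab) ha)]
  · constructor
    · intro he
      have hb : ¬ Z.same b r := fun hb => leaf_ne_top h ha (he.trans (leaf_of_same h hb))
      have : b ∈ (leaf h r a).1 := by rw [he, leaf_val h hb]; exact h.same_refl b
      rwa [leaf_val h ha] at this
    · intro hab
      have hb : ¬ Z.same b r := fun hb => ha (h.same_trans hab hb)
      refine Subtype.ext ?_
      rw [leaf_val h ha, leaf_val h hb]
      ext x
      exact ⟨fun hx => h.same_trans (h.same_symm hab) hx, fun hx => h.same_trans hab hx⟩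

/-- The top carries the labels of the leaf of `r`, and its only possible child consists of all other
labels. The cluster of any other leaf is minimal and has just its parent. A cluster that is not a
leaf has a child and a parent. -/
theorem mem_range_leaf_iff [Finite I] (h : Z.InducedBy S) (C : Cluster S r) :
    C ∈ Set.range (leaf h r) ↔ ((SimpleGraph.hasse (Cluster S r)).neighborSet C).ncard ≤ 1 := by
  rw [Set.ncard_le_one (Set.toFinite _)]
  constructor
  · rintro ⟨a, rfl⟩
    by_cases ha : Z.same a r
    · rw [leaf_of_same h ha]
      have key : ∀ D, (SimpleGraph.hasse (Cluster S r)).Adj (top S r) D →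
          D.1 = {x | Z.same r x}ᶜ := by
        rintro D (hD | hD)
        · exact absurd (le_top D) hD.lt.not_ge
        · obtain ⟨hDS, hDr⟩ := mem_of_ne hD.lt.ne
          have hsub : D.1 ⊆ {x | Z.same r x}ᶜ := fun x hx hxr =>
            h.not_same_of_mem' hDS hx hDr hxr
          obtain ⟨x, hx⟩ := nonempty h D
          have hE := h.compl _ (h.leaf r x (hsub hx))
          let E : Cluster S r := ⟨_, Or.inr ⟨hE, fun hh => hh (h.same_refl r)⟩⟩
          have hEt : E ≠ top S r := fun he => by
            have : r ∈ E.1 := he ▸ trivial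
            exact this (h.same_refl r)
          have hDE : D ≤ E := hsub
          exact congrArg Subtype.val ((hD.eq_or_eq hDE (le_top E)).resolve_right hEt).symm
      intro D hD E hE
      exact Subtype.ext ((key D hD).trans (key E hE).symm)
    · have key : ∀ D, (SimpleGraph.hasse (Cluster S r)).Adj (leaf h r a) D →
          leaf h r a ⋖ D := by
        rintro D (hD | hD)
        · exact hD
        · obtain ⟨x, hx⟩ := nonempty h D
          have hax : Z.same a x := by
            have := hD.le hx
            rwa [leaf_val h ha] at this
          have hDt : D ≠ top S r := fun he => hD.lt.not_ge (he ▸ le_top _)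
          refine absurd ((leaf_le_iff h hDt a).2 ?_) hD.lt.not_ge
          exact (h.same_iff x a).1 (h.same_symm hax) _ (mem_of_ne hDt).1 hx
      intro D hD E hE
      exact covBy_unique h (key D hD) (key E hE)
  · intro hle
    by_contra hC
    have hCt : C ≠ top S r := by
      rintro rfl
      exact hC ⟨r, leaf_of_same h (h.same_refl r)⟩
    obtain ⟨a, ha⟩ := nonempty h C
    have hlt : leaf h r a < C := lt_of_le_of_ne ((leaf_le_iff h hCt a).2 ha)
      fun he => hC ⟨a, he⟩
    obtain ⟨D, -, hD⟩ := exists_le_covBy_of_lt hlt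
    obtain ⟨E, hE⟩ := exists_covBy hCt
    exact (hD.lt.trans hE.lt).ne (hle D (Or.inr hD) E (Or.inl hE))

end Cluster

/-- A structure induced by a compatible system of splits is a tree. -/
theorem InducedBy.isTree [Finite I] {Z : Labelled I} {S : Set (Set I)} (h : Z.InducedBy S) :
    Z.IsTree := by
  rcases isEmpty_or_nonempty I with hI | ⟨⟨r⟩⟩
  · exact ⟨{
      V := I
      finite := inferInstance
      G := ⊥
      preconnected := fun a => isEmptyElim a
      acyclic := SimpleGraph.isAcyclic_bot
      leaf := id
      range_leaf := fun a => isEmptyElim a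
      same_iff := fun a => isEmptyElim a
      rel_iff := fun a => isEmptyElim a }⟩
  have hT := Cluster.isTree h r
  refine ⟨{
      V := Cluster S r
      finite := inferInstance
      G := SimpleGraph.hasse _
      preconnected := hT.connected.preconnected
      acyclic := hT.isAcyclic
      leaf := Cluster.leaf h r
      range_leaf := Cluster.mem_range_leaf_iff h
      same_iff := fun a b => (Cluster.leaf_eq_iff h a b).symm
      rel_iff := ?_ }⟩
  intro a b c d
  rw [h.rel_iff]
  simp only [List.nodup_cons, List.mem_cons, List.not_mem_nil, not_or, or_false,
      Cluster.leaf_eq_iff, not_false_eq_true, and_true, List.nodup_nil]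
  constructor
  · rintro ⟨⟨h1, h2, h3, h4, h5, h6⟩, A, hA, hA'⟩
    refine ⟨⟨⟨h1, h2, h3⟩, ⟨h4, h5⟩, h6⟩, ?_⟩
    -- Clusters other than the top avoid `r`, so the complement is taken if necessary; the condition
    -- on the four labels is symmetric.
    obtain ⟨B, hB, hBr, hB'⟩ : ∃ B ∈ S, r ∉ B ∧ (a ∈ B ↔ ¬ b ∈ B) ∧ (c ∈ B ↔ ¬ d ∈ B) := by
      by_cases hr : r ∈ A
      · refine ⟨Aᶜ, h.compl A hA, fun hh => hh hr, ?_⟩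
        simp only [Set.mem_compl_iff]
        tauto
      · exact ⟨A, hA, hr, by tauto⟩
    let C : Cluster S r := ⟨B, Or.inr ⟨hB, hBr⟩⟩
    have hC : C ≠ Cluster.top S r := fun he => hBr (by
      have : r ∈ C.1 := he ▸ trivial
      exact this)
    obtain ⟨D, hD⟩ := Cluster.exists_covBy hC
    have hmem : ∀ x, x ∈ B ↔ _ := fun x =>
      (Cluster.leaf_le_iff h hC x).symm.trans (Cluster.le_iff_dist h hD _)
    have hnmem : ∀ x, x ∉ B ↔ (SimpleGraph.hasse _).dist D (Cluster.leaf h r x) <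
        (SimpleGraph.hasse _).dist C (Cluster.leaf h r x) := fun x => by
      have := dist_adj_cases hT (Or.inl hD) (Cluster.leaf h r x)
      rw [hmem]
      omega
    have hpath : ∀ x y, (x ∈ B ↔ ¬ y ∈ B) → ∃ p : (SimpleGraph.hasse _).Path
        (Cluster.leaf h r x) (Cluster.leaf h r y), s(C, D) ∈ p.1.edges := by
      intro x y hxy
      obtain ⟨p, hp, -⟩ := hT.connected.exists_path_of_dist (Cluster.leaf h r x)
        (Cluster.leaf h r y)
      refine ⟨⟨p, hp⟩, ?_⟩
      by_cases hx : x ∈ B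
      · exact mem_edges_of_sides hT (Or.inl hD) p ((hmem x).1 hx) ((hnmem y).1 (hxy.1 hx))
      · rw [Sym2.eq_swap]
        exact mem_edges_of_sides hT (Or.inr hD) p ((hnmem x).1 hx) ((hmem y).1 (by tauto))
    obtain ⟨p, hp⟩ := hpath a b hB'.1
    obtain ⟨q, hq⟩ := hpath c d hB'.2
    exact ⟨p, q, _, hp, hq⟩
  · rintro ⟨⟨⟨h1, h2, h3⟩, ⟨h4, h5⟩, h6⟩, p, q, e, hp, hq⟩
    refine ⟨⟨h1, h2, h3, h4, h5, h6⟩, ?_⟩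
    obtain ⟨C, D, hD, rfl⟩ : ∃ C D : Cluster S r, C ⋖ D ∧ e = s(C, D) := by
      induction e with
      | _ u v =>
      rcases p.1.adj_of_mem_edges hp with huv | huv
      · exact ⟨u, v, huv, rfl⟩
      · exact ⟨v, u, huv, Sym2.eq_swap⟩
    have hC : C ≠ Cluster.top S r := fun he => hD.lt.not_ge (he ▸ Cluster.le_top D)
    have hmem : ∀ x, x ∈ C.1 ↔ _ := fun x =>
      (Cluster.leaf_le_iff h hC x).symm.trans (Cluster.le_iff_dist h hD _)
    have hside : ∀ {x y} (p : (SimpleGraph.hasse _).Path (Cluster.leaf h r x)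
        (Cluster.leaf h r y)), s(C, D) ∈ p.1.edges → (x ∈ C.1 ↔ ¬ y ∈ C.1) := by
      intro x y p hp
      have h1 := sides_of_mem_edges hT (Or.inl hD) p.1 p.2 hp
      have h2 := dist_adj_cases hT (Or.inl hD) (Cluster.leaf h r y)
      rw [hmem, hmem, h1]
      omega
    have hab := hside p hp
    have hcd := hside q hq
    by_cases ha : a ∈ C.1
    · exact ⟨C.1, (Cluster.mem_of_ne hC).1, ha, hab.1 ha, by tauto⟩
    · refine ⟨C.1ᶜ, h.compl _ (Cluster.mem_of_ne hC).1, ha, ?_⟩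
      simp only [Set.mem_compl_iff]
      tauto

/-- Restricting a split system. -/
theorem InducedBy.restrict {J : Type} {Z : Labelled I} {S : Set (Set I)} (h : Z.InducedBy S)
    (g : J → I) : (Z.restrict g).InducedBy
      {B | ∃ A ∈ S, B = g ⁻¹' A ∧ B.Nonempty ∧ Bᶜ.Nonempty} := by
  refine ⟨?_, ?_, ?_, ?_, ?_, ?_⟩
  · rintro B ⟨A, hA, -, hB, -⟩
    exact hB
  · rintro B ⟨A, hA, rfl, h1, h2⟩
    exact ⟨Aᶜ, h.compl A hA, rfl, h2, by rwa [compl_compl]⟩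
  · rintro _ ⟨A, hA, rfl, -⟩ _ ⟨B, hB, rfl, -⟩ a b c d
    exact h.compat A hA B hB (g a) (g b) (g c) (g d)
  · intro a b
    refine (h.same_iff _ _).trans ⟨?_, fun hh A hA ha => ?_⟩
    · rintro hh B ⟨A, hA, rfl, -⟩ ha
      exact hh A hA ha
    · by_contra hb
      exact hb (hh (g ⁻¹' A) ⟨A, hA, rfl, ⟨a, ha⟩, ⟨b, hb⟩⟩ ha)
  · intro a b hab
    exact ⟨_, h.leaf _ _ hab, rfl, ⟨a, h.same_refl (g a)⟩, ⟨b, hab⟩⟩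
  · intro a b c d
    refine (h.rel_iff _ _ _ _).trans (and_congr_right fun _ => ⟨?_, ?_⟩)
    · rintro ⟨A, hA, ha, hb, hcd⟩
      exact ⟨g ⁻¹' A, ⟨A, hA, rfl, ⟨a, ha⟩, ⟨b, hb⟩⟩, ha, hb, hcd⟩
    · rintro ⟨B, ⟨A, hA, rfl, -⟩, ha, hb, hcd⟩
      exact ⟨A, hA, ha, hb, hcd⟩

theorem IsTree.restrict {J : Type} [Finite J] {Z : Labelled I} (h : Z.IsTree) (g : J → I) :
    (Z.restrict g).IsTree :=
  (h.inducedBy.restrict g).isTree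

end Labelled

end Arboreal

namespace Arboreal

universe u

/-! ### Substructures -/

section Classes

variable {I J : Type}

theorem classes_restrict_le [Finite I] (p : I → I → Prop) (g : J → I) :
    classes (fun a b => p (g a) (g b)) ≤ classes p := by
  have hsub : Set.range (fun a b => p (g a) (g b)) ⊆ (fun r : I → Prop => r ∘ g) '' Set.range p := by
    rintro _ ⟨a, rfl⟩
    exact ⟨p (g a), ⟨g a, rfl⟩, rfl⟩
  exact (Set.ncard_le_ncard hsub (Set.toFinite _)).trans (Set.ncard_image_le (Set.toFinite _))

theorem classes_le_of_le [Finite I] {p q : I → I → Prop} (hp : Equivalence p) (hq : ∀ x, q x x)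
    (h : ∀ {x y}, q x y → p x y) : classes p ≤ classes q := by
  classical
  let F : (I → Prop) → I → Prop := fun s => if hs : ∃ a, q a = s then p hs.choose else fun _ => True
  have hF : ∀ x, F (q x) = p x := by
    intro x
    have hs : ∃ a, q a = q x := ⟨x, rfl⟩
    simp only [F, dif_pos hs]
    have h1 : q hs.choose x := by rw [hs.choose_spec]; exact hq x
    funext y
    exact propext ⟨fun h2 => hp.trans (hp.symm (h h1)) h2, fun h2 => hp.trans (h h1) h2⟩
  have : Set.range p ⊆ F '' Set.range q := by
    rintro _ ⟨x, rfl⟩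
    exact ⟨_, ⟨x, rfl⟩, hF x⟩
  exact (Set.ncard_le_ncard this (Set.toFinite _)).trans (Set.ncard_image_le (Set.toFinite _))

theorem row_eq_iff {p : I → I → Prop} (hp : Equivalence p) {x y : I} : p x = p y ↔ p x y := by
  constructor
  · intro h
    rw [h]
    exact hp.refl y
  · intro h
    funext z
    exact propext ⟨fun h2 => hp.trans (hp.symm h) h2, fun h2 => hp.trans h h2⟩

theorem classes_eq_zero [Finite I] {p : I → I → Prop} : classes p = 0 ↔ IsEmpty I := by
  rw [classes, Set.ncard_eq_zero (Set.toFinite _), Set.range_eq_empty_iff]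

end Classes

namespace Labelled

variable {I J K : Type} {Z : Labelled I}

theorem restrict_restrict (Z : Labelled I) (g : J → I) (f : K → J) :
    (Z.restrict g).restrict f = Z.restrict (g ∘ f) := rfl

/-- Equality of trees becomes a question about splits, since `Sep` determines both `same` and `rel`.
-/
theorem InducedBy.ext_sep {Z W : Labelled I} {S S' : Set (Set I)} (hZ : Z.InducedBy S)
    (hW : W.InducedBy S') (h : ∀ a b c d, Z.Sep a b c d ↔ W.Sep a b c d) : Z = W := by
  have hs : ∀ a b, Z.same a b ↔ W.same a b := fun a b => by
    rw [hZ.same_iff_sep, hW.same_iff_sep, h]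
  refine Labelled.ext ?_ ?_
  · funext a b
    exact propext (hs a b)
  · funext a b c d
    refine propext ?_
    rw [hZ.rel_iff_sep, hW.rel_iff_sep]
    simp only [hs, h]

theorem InducedBy.sep_congr {S : Set (Set I)} (h : Z.InducedBy S) {a b c d a' b' c' d' : I}
    (ha : Z.same a a') (hb : Z.same b b') (hc : Z.same c c') (hd : Z.same d d') :
    Z.Sep a b c d ↔ Z.Sep a' b' c' d' := by
  have key : ∀ {x y}, Z.same x y → ∀ A ∈ S, x ∈ A ↔ y ∈ A := fun hxy A hA =>
    ⟨(h.same_iff _ _).1 hxy A hA, (h.same_iff _ _).1 (h.same_symm hxy) A hA⟩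
  rw [h.sep_iff, h.sep_iff]
  refine exists_congr fun A => and_congr_right fun hA => ?_
  rw [key ha A hA, key hb A hA, key hc A hA, key hd A hA]

theorem IsTree.restrict_eq_of_same [Finite J] (hZ : Z.IsTree) {f g : J → I}
    (h : ∀ a, Z.same (f a) (g a)) : Z.restrict f = Z.restrict g :=
  (hZ.restrict f).inducedBy.ext_sep (hZ.restrict g).inducedBy fun a b c d =>
    hZ.inducedBy.sep_congr (h a) (h b) (h c) (h d)

theorem IsTree.restrict_eq_self [Finite I] (hZ : Z.IsTree) {f : I → I}
    (h : ∀ a, Z.same a (f a)) : Z.restrict f = Z :=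
  (hZ.restrict_eq_of_same (f := id) h).symm

theorem IsPos.equivalence {p : I → I → Prop} (hp : Z.IsPos p) : Equivalence p :=
  ⟨hp.refl, hp.symm, hp.trans⟩

theorem IsPos.of_same {S : Set (Set I)} (h : Z.InducedBy S) {p : I → I → Prop} (hp : Z.IsPos p)
    {x y : I} (hxy : Z.same x y) : p x y := by
  by_contra hcon
  exact h.same_iff_sep.1 hxy (hp.sep (hp.refl x) hcon hcon)

theorem IsPos.restrict {p : I → I → Prop} (hp : Z.IsPos p) (g : J → I) :
    (Z.restrict g).IsPos (fun a b => p (g a) (g b)) :=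
  ⟨fun _ => hp.refl _, hp.symm, hp.trans, hp.sep, hp.not_sep⟩

/-- The median of three leaves. -/
theorem IsTree.exists_node (hZ : Z.IsTree) {a b c : I} (hab : ¬ Z.same a b) (hac : ¬ Z.same a c)
    (hbc : ¬ Z.same b c) : ∃ p, Z.IsNode p ∧ ¬ p a b ∧ ¬ p a c ∧ ¬ p b c := by
  have h := hZ.inducedBy
  -- Sides with at most one of the three labels are those that do not contain the median.
  let few : Set I → Prop := fun A => ¬ (a ∈ A ∧ b ∈ A) ∧ ¬ (a ∈ A ∧ c ∈ A) ∧ ¬ (b ∈ A ∧ c ∈ A)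
  let p : I → I → Prop := fun x y => ∃ A ∈ Z.splits, few A ∧ x ∈ A ∧ y ∈ A
  have hnot : ¬ p a b ∧ ¬ p a c ∧ ¬ p b c := by
    refine ⟨?_, ?_, ?_⟩ <;> rintro ⟨A, -, hf, h1, h2⟩
    · exact hf.1 ⟨h1, h2⟩
    · exact hf.2.1 ⟨h1, h2⟩
    · exact hf.2.2 ⟨h1, h2⟩
  refine ⟨p, ⟨⟨?_, ?_, ?_, ?_, ?_⟩, a, b, c, hnot⟩, hnot⟩
  · intro x
    have key : ∀ {y z}, ¬ Z.same y z → ¬ (y ∈ {w | Z.same x w} ∧ z ∈ {w | Z.same x w}) :=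
      fun hyz hh => hyz (h.same_trans (h.same_symm hh.1) hh.2)
    obtain ⟨y, hy⟩ : ∃ y, ¬ Z.same x y := by
      by_contra hcon
      push Not at hcon
      exact hab (h.same_trans (h.same_symm (hcon a)) (hcon b))
    exact ⟨_, h.leaf x y hy, ⟨key hab, key hac, key hbc⟩, h.same_refl x, h.same_refl x⟩
  · rintro x y ⟨A, hA, hf, hx, hy⟩
    exact ⟨A, hA, hf, hy, hx⟩
  · rintro x y z ⟨A, hA, hf, hx, hy⟩ ⟨B, hB, hf', hy', hz⟩
    by_cases hzA : z ∈ A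
    · exact ⟨A, hA, hf, hx, hzA⟩
    by_cases hxB : x ∈ B
    · exact ⟨B, hB, hf', hxB, hz⟩
    -- Compatibility would force `A` and `B` to cover everything, but together they contain at most
    -- two of `a`, `b`, `c`.
    have hcov : ∀ w, w ∈ A ∨ w ∈ B := by
      intro w
      by_contra hw
      rw [not_or] at hw
      exact h.compat A hA B hB y x z w hy hy' hx hxB hzA hz hw.1 hw.2
    have ha := hcov a
    have hb := hcov b
    have hc := hcov c
    by_cases ha' : a ∈ A <;> by_cases hb' : b ∈ A <;> by_cases hc' : c ∈ A <;>
      simp_all [few]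
  · rintro x y z w ⟨A, hA, hf, hx, hy⟩ hz hw
    exact h.sep_iff.2 ⟨A, hA, hx, hy, fun hh => hz ⟨A, hA, hf, hx, hh⟩,
      fun hh => hw ⟨A, hA, hf, hx, hh⟩⟩
  · intro x y z w hxy hzw hs
    obtain ⟨A, hA, h1, h2, h3, h4⟩ := h.sep_iff.1 hs
    -- One of `A` and `Aᶜ` contains at most one of the three labels.
    have h5 : ¬ few A := fun hf => hxy ⟨A, hA, hf, h1, h2⟩
    have h6 : ¬ few Aᶜ := fun hf => hzw ⟨Aᶜ, h.compl A hA, hf, h3, h4⟩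
    simp only [few, Set.mem_compl_iff] at h5 h6
    by_cases ha : a ∈ A <;> by_cases hb : b ∈ A <;> by_cases hc : c ∈ A <;>
      simp [ha, hb, hc] at h5 h6

/-- Three labels in distinct classes of `q` have a median in the larger tree. Its restriction keeps
them in distinct classes, so it equals `q` by `IsPos.ext_of_three`. Monotonicity of level and node
counts follows. -/
theorem IsNode.extend {g : J → I} (hZ : Z.IsTree) {q : J → J → Prop}
    (hT : (Z.restrict g).IsTree) (hq : (Z.restrict g).IsNode q) :
    ∃ p, Z.IsNode p ∧ q = fun a b => p (g a) (g b) := by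
  obtain ⟨a, b, c, hab, hac, hbc⟩ := hq.three
  have hns : ∀ {x y}, ¬ q x y → ¬ Z.same (g x) (g y) := fun hxy hs =>
    hxy (hq.toIsPos.of_same hT.inducedBy hs)
  obtain ⟨p, hp, h1, h2, h3⟩ := hZ.exists_node (hns hab) (hns hac) (hns hbc)
  exact ⟨p, hp, hq.toIsPos.ext_of_three (hp.toIsPos.restrict g) hab hac hbc h1 h2 h3⟩

theorem InClass.restrict [Finite I] [Finite J] {N : ℕ∞} (h : Z.InClass N) (g : J → I) :
    (Z.restrict g).InClass N := by
  rw [inClass_iff] at h ⊢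
  refine ⟨h.1.restrict g, fun q hq => ?_⟩
  obtain ⟨p, hp, rfl⟩ := hq.extend h.1 (h.1.restrict g)
  exact le_trans (by exact_mod_cast classes_restrict_le p g) (h.2 p hp)

theorem leafCount_restrict_le [Finite I] (g : J → I) : (Z.restrict g).leafCount ≤ Z.leafCount :=
  classes_restrict_le Z.same g

/-- Ensures that the truncated subtractions in the exponents of `treeMeasure` are true differences.
-/
theorem IsTree.nodeCount_restrict_le [Finite I] [Finite J] (hZ : Z.IsTree) (g : J → I) {i : ℕ}
    (hi : 3 ≤ i) : (Z.restrict g).nodeCount i ≤ Z.nodeCount i := by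
  rw [hZ.nodeCount_eq hi, (hZ.restrict g).nodeCount_eq hi]
  refine le_trans (Set.ncard_le_ncard (t := (fun p : I → I → Prop => fun a b => p (g a) (g b)) ''
    {p | Z.IsNode p ∧ i ≤ classes p}) ?_ (Set.toFinite _)) (Set.ncard_image_le (Set.toFinite _))
  rintro q ⟨hq, hiq⟩
  obtain ⟨p, hp, rfl⟩ := hq.extend hZ (hZ.restrict g)
  exact ⟨p, ⟨hp, hiq.trans (classes_restrict_le p g)⟩, rfl⟩

theorem IsNode.classes_le_leafCount [Finite I] (hZ : Z.IsTree) {p : I → I → Prop}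
    (hp : Z.IsNode p) : classes p ≤ Z.leafCount :=
  classes_le_of_le hp.toIsPos.equivalence hZ.inducedBy.same_refl
    (hp.toIsPos.of_same hZ.inducedBy)

theorem IsTree.nodeCount_eq_zero [Finite I] (hZ : Z.IsTree) {i : ℕ} (hi : 3 ≤ i)
    (h : Z.leafCount < i) : Z.nodeCount i = 0 := by
  rw [hZ.nodeCount_eq hi, Set.ncard_eq_zero (Set.toFinite _)]
  ext p
  simp only [Set.mem_ofPred_eq, Set.mem_empty_iff_false, iff_false, not_and, not_le]
  exact fun hp => (hp.classes_le_leafCount hZ).trans_lt h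

theorem leafCount_eq_zero [Finite I] : Z.leafCount = 0 ↔ IsEmpty I := classes_eq_zero (p := Z.same)

/-- Maps of labels that meet every leaf are invertible. -/
theorem IsTree.exists_section [Finite I] (hZ : Z.IsTree) (g : J → I)
    (h : ∀ a, ∃ b, Z.same a (g b)) : ∃ s : I → J, (Z.restrict g).restrict s = Z := by
  choose s hs using h
  exact ⟨s, hZ.restrict_eq_self hs⟩

theorem IsTree.leafCount_restrict_eq [Finite I] [Finite J] (hZ : Z.IsTree) (g : J → I)
    (h : ∀ a, ∃ b, Z.same a (g b)) : (Z.restrict g).leafCount = Z.leafCount := by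
  obtain ⟨s, hs⟩ := hZ.exists_section g h
  refine le_antisymm (leafCount_restrict_le g) ?_
  conv_lhs => rw [← hs]
  exact leafCount_restrict_le s

theorem IsTree.nodeCount_restrict_eq [Finite I] [Finite J] (hZ : Z.IsTree) (g : J → I)
    (h : ∀ a, ∃ b, Z.same a (g b)) {i : ℕ} (hi : 3 ≤ i) :
    (Z.restrict g).nodeCount i = Z.nodeCount i := by
  obtain ⟨s, hs⟩ := hZ.exists_section g h
  refine le_antisymm (hZ.nodeCount_restrict_le g hi) ?_
  conv_lhs => rw [← hs]
  exact (hZ.restrict g).nodeCount_restrict_le s hi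

end Labelled

/-! ### Multiplicativity of the measure, and its vanishing above level `n`. -/

section Measure

open Labelled

variable {k : Type u} [CommRing k] {I J K : Type}

theorem treeMeasure_of_surjective [Finite I] [Finite J] (t : k) {Z : Labelled I} (hZ : Z.IsTree)
    (g : J → I) (h : ∀ a, ∃ b, Z.same a (g b)) : treeMeasure t g Z = 1 := by
  have h1 := hZ.leafCount_restrict_eq g h
  have h2 := fun i (hi : 3 ≤ i) => hZ.nodeCount_restrict_eq g h hi
  rw [treeMeasure, h1, if_neg (fun hh => hh.2 hh.1), h2 3 le_rfl, Nat.sub_self, Nat.sub_self,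
    pow_zero, pow_zero, one_mul, one_mul, one_mul]
  refine Finset.prod_eq_one fun i hi => ?_
  rw [h2 i (Finset.mem_Icc.1 hi).1, Nat.sub_self, pow_zero]

theorem treeMeasure_comp [Finite I] [Finite J] [Finite K] (t : k) (f : K → J) (g : J → I)
    {Z : Labelled I} (hZ : Z.IsTree) :
    treeMeasure t (g ∘ f) Z = treeMeasure t g Z * treeMeasure t f (Z.restrict g) := by
  have hY := hZ.restrict g
  have hl1 : (Z.restrict g).leafCount ≤ Z.leafCount := leafCount_restrict_le g
  have hl2 : (Z.restrict (g ∘ f)).leafCount ≤ (Z.restrict g).leafCount :=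
    leafCount_restrict_le (Z := Z.restrict g) f
  have hn1 := fun i (hi : 3 ≤ i) => hZ.nodeCount_restrict_le g hi
  have hn2 : ∀ i, 3 ≤ i → (Z.restrict (g ∘ f)).nodeCount i ≤ (Z.restrict g).nodeCount i :=
    fun i (hi : 3 ≤ i) => hY.nodeCount_restrict_le f hi
  simp only [treeMeasure, restrict_restrict]
  -- The range of the product depends on the tree; the extra factors are trivial because a valence
  -- is at most the number of leaves.
  have hprod : ∏ i ∈ Finset.Icc 3 (Z.restrict g).leafCount, (t - (i : k) + 1) ^
      ((Z.restrict g).nodeCount i - (Z.restrict (g ∘ f)).nodeCount i) =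
      ∏ i ∈ Finset.Icc 3 Z.leafCount, (t - (i : k) + 1) ^
      ((Z.restrict g).nodeCount i - (Z.restrict (g ∘ f)).nodeCount i) := by
    refine Finset.prod_subset (Finset.Icc_subset_Icc le_rfl hl1) fun i hi hi' => ?_
    rw [Finset.mem_Icc] at hi hi'
    rw [hY.nodeCount_eq_zero hi.1 (by omega), Nat.zero_sub, pow_zero]
  have hprod2 : ∏ i ∈ Finset.Icc 3 Z.leafCount, (t - (i : k) + 1) ^
      (Z.nodeCount i - (Z.restrict (g ∘ f)).nodeCount i) =
      (∏ i ∈ Finset.Icc 3 Z.leafCount, (t - (i : k) + 1) ^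
        (Z.nodeCount i - (Z.restrict g).nodeCount i)) *
      ∏ i ∈ Finset.Icc 3 Z.leafCount, (t - (i : k) + 1) ^
        ((Z.restrict g).nodeCount i - (Z.restrict (g ∘ f)).nodeCount i) := by
    rw [← Finset.prod_mul_distrib]
    refine Finset.prod_congr rfl fun i hi => ?_
    rw [← pow_add]
    have h1 := hn1 i (Finset.mem_Icc.1 hi).1
    have h2 := hn2 i (Finset.mem_Icc.1 hi).1
    congr 1
    omega
  have hif : (if (Z.restrict (g ∘ f)).leafCount = 0 ∧ Z.leafCount ≠ 0 then t else 1) =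
      (if (Z.restrict g).leafCount = 0 ∧ Z.leafCount ≠ 0 then t else 1) *
      (if (Z.restrict (g ∘ f)).leafCount = 0 ∧ (Z.restrict g).leafCount ≠ 0 then t else 1) := by
    by_cases h1 : (Z.restrict g).leafCount = 0
    · have h2 : (Z.restrict (g ∘ f)).leafCount = 0 := by omega
      simp [h1, h2]
    · have h2 : Z.leafCount ≠ 0 := by omega
      simp [h1, h2]
  have e1 : Z.nodeCount 3 - (Z.restrict (g ∘ f)).nodeCount 3 =
      (Z.nodeCount 3 - (Z.restrict g).nodeCount 3) +
      ((Z.restrict g).nodeCount 3 - (Z.restrict (g ∘ f)).nodeCount 3) := by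
    have h1 := hn1 3 le_rfl
    have h2 := hn2 3 le_rfl
    omega
  have e2 : Z.leafCount - (Z.restrict (g ∘ f)).leafCount =
      (Z.leafCount - (Z.restrict g).leafCount) +
      ((Z.restrict g).leafCount - (Z.restrict (g ∘ f)).leafCount) := by omega
  rw [hprod, hprod2, hif, e1, e2, pow_add, pow_add]
  exact (by intros; ring : ∀ x₁ x₂ a₁ a₂ b₁ b₂ c₁ c₂ : k, x₁ * x₂ * (a₁ * a₂) * (b₁ * b₂) *
    (c₁ * c₂) = x₁ * a₁ * b₁ * c₁ * (x₂ * a₂ * b₂ * c₂)) _ _ _ _ _ _ _ _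

/-- If `n` is the parameter, then the embeddings of trees of level `≤ n` into
trees of level `> n` have measure zero. -/
theorem treeMeasure_eq_zero [Finite I] [Finite J] (n : ℕ) (hn : 2 ≤ n) {Z : Labelled I}
    (hZ : Z.IsTree) (g : J → I) (hg : (Z.restrict g).InClass n) (h : ¬ Z.InClass n) :
    treeMeasure (n : k) g Z = 0 := by
  rw [inClass_iff] at hg h
  push Not at h
  obtain ⟨p, hp, hpn⟩ := h hZ
  have hpn' : n + 1 ≤ classes p := by exact_mod_cast hpn
  have hle := hp.classes_le_leafCount hZ
  have h0 : (Z.restrict g).nodeCount (n + 1) = 0 := by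
    rw [hg.1.nodeCount_eq (by omega), Set.ncard_eq_zero (Set.toFinite _)]
    ext q
    simp only [Set.mem_ofPred_eq, Set.mem_empty_iff_false, iff_false, not_and, not_le]
    intro hq
    have : classes q ≤ n := by exact_mod_cast hg.2 q hq
    omega
  have h1 : Z.nodeCount (n + 1) ≠ 0 := by
    rw [hZ.nodeCount_eq (by omega), Ne, Set.ncard_eq_zero (Set.toFinite _)]
    exact Set.Nonempty.ne_empty ⟨p, hp, hpn'⟩
  -- The factor for `i = n + 1` is `n - (n + 1) + 1 = 0`. Its exponent is positive, as `Z` has a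
  -- node of valence above `n` and the subtree has none.
  rw [treeMeasure, Finset.prod_eq_zero (i := n + 1) (Finset.mem_Icc.2 ⟨by omega, by omega⟩),
    mul_zero]
  rw [h0, Nat.sub_zero]
  push_cast
  rw [sub_add_eq_sub_sub, sub_self, zero_sub, neg_add_cancel, zero_pow h1]

end Measure

end Arboreal

namespace Arboreal

universe u

/-! ### One-point extensions -/

section Classes

variable {I J : Type}

theorem classes_restrict_eq [Finite I] {p : I → I → Prop} (hp : Equivalence p) (g : J → I)
    (h : ∀ a, ∃ b, p a (g b)) : classes (fun a b => p (g a) (g b)) = classes p := by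
  refine le_antisymm (classes_restrict_le p g) ?_
  choose s hs using h
  have hrow : (fun a b => p (g (s a)) (g (s b))) = p := by
    funext a b
    exact propext ⟨fun hh => hp.trans (hs a) (hp.trans hh (hp.symm (hs b))),
      fun hh => hp.trans (hp.symm (hs a)) (hp.trans hh (hs b))⟩
  have hfin : (Set.range fun a b => p (g a) (g b)).Finite := by
    refine (Set.toFinite ((fun r : I → Prop => r ∘ g) '' Set.range p)).subset ?_
    rintro _ ⟨a, rfl⟩
    exact ⟨p (g a), ⟨g a, rfl⟩, rfl⟩
  have hsub : Set.range p ⊆ (fun r : J → Prop => r ∘ s) ''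
      Set.range (fun a b => p (g a) (g b)) := by
    rintro _ ⟨a, rfl⟩
    exact ⟨_, ⟨s a, rfl⟩, congrFun hrow a⟩
  exact (Set.ncard_le_ncard hsub (hfin.image _)).trans (Set.ncard_image_le hfin)

theorem two_le_classes [Finite I] {p : I → I → Prop} (hp : Equivalence p) :
    2 ≤ classes p ↔ ∃ a b, ¬ p a b := by
  rw [classes, ← Nat.lt_iff_add_one_le, Set.one_lt_ncard_iff (Set.toFinite _)]
  constructor
  · rintro ⟨_, _, ⟨a, rfl⟩, ⟨b, rfl⟩, hab⟩
    exact ⟨a, b, fun h => hab ((row_eq_iff hp).2 h)⟩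
  · rintro ⟨a, b, hab⟩
    exact ⟨_, _, ⟨a, rfl⟩, ⟨b, rfl⟩, fun h => hab ((row_eq_iff hp).1 h)⟩

theorem three_le_classes [Finite I] {p : I → I → Prop} (hp : Equivalence p) :
    3 ≤ classes p ↔ ∃ a b c, ¬ p a b ∧ ¬ p a c ∧ ¬ p b c := by
  rw [classes, ← Nat.lt_iff_add_one_le, Set.two_lt_ncard_iff (Set.toFinite _)]
  constructor
  · rintro ⟨_, _, _, ⟨a, rfl⟩, ⟨b, rfl⟩, ⟨c, rfl⟩, hab, hac, hbc⟩
    exact ⟨a, b, c, fun h => hab ((row_eq_iff hp).2 h), fun h => hac ((row_eq_iff hp).2 h),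
      fun h => hbc ((row_eq_iff hp).2 h)⟩
  · rintro ⟨a, b, c, hab, hac, hbc⟩
    exact ⟨_, _, _, ⟨a, rfl⟩, ⟨b, rfl⟩, ⟨c, rfl⟩, fun h => hab ((row_eq_iff hp).1 h),
      fun h => hac ((row_eq_iff hp).1 h), fun h => hbc ((row_eq_iff hp).1 h)⟩

/-- Add one class, consisting of `none`. -/
def addClass (p : I → I → Prop) : Option I → Option I → Prop
  | none, none => True
  | some a, some b => p a b
  | _, _ => False

theorem equivalence_addClass {p : I → I → Prop} (hp : Equivalence p) :
    Equivalence (addClass p) := by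
  refine ⟨?_, ?_, ?_⟩
  · rintro (_ | a)
    exacts [trivial, hp.refl a]
  · rintro (_ | a) (_ | b) h
    exacts [h, h, h, hp.symm h]
  · rintro (_ | a) (_ | b) (_ | c) h h'
    exacts [h', h', h.elim, h.elim, h, h.elim, h', hp.trans h h']

theorem classes_addClass [Finite I] (p : I → I → Prop) :
    classes (addClass p) = classes p + 1 := by
  have hF : Function.Injective (fun (r : I → Prop) (o : Option I) => o.elim False r) :=
    fun r r' h => funext fun x => congrFun h (some x)
  have hrow : ∀ x, addClass p (some x) = fun o => o.elim False (p x) := by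
    intro x
    funext o
    cases o <;> rfl
  have hrange : Set.range (addClass p) = insert (addClass p none)
      ((fun (r : I → Prop) (o : Option I) => o.elim False r) '' Set.range p) := by
    ext r
    constructor
    · rintro ⟨_ | x, rfl⟩
      · exact Or.inl rfl
      · exact Or.inr ⟨_, ⟨x, rfl⟩, (hrow x).symm⟩
    · rintro (rfl | ⟨_, ⟨x, rfl⟩, rfl⟩)
      · exact ⟨none, rfl⟩
      · exact ⟨some x, hrow x⟩
  rw [classes, hrange, Set.ncard_insert_of_notMem _ (Set.toFinite _), Set.ncard_image_of_injective _ hF]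
  · rfl
  · rintro ⟨_, ⟨x, rfl⟩, h⟩
    exact ((congrFun h none).mpr trivial : False)

end Classes

namespace Labelled

variable {I : Type}

theorem InducedBy.sep_swap {Z : Labelled I} {S : Set (Set I)} (h : Z.InducedBy S) {a b c d : I}
    (hs : Z.Sep a b c d) : Z.Sep b a c d := by
  rw [h.sep_iff] at hs ⊢
  obtain ⟨A, hA, h1, h2, h3, h4⟩ := hs
  exact ⟨A, hA, h2, h1, h3, h4⟩

theorem InducedBy.sep_comm {Z : Labelled I} {S : Set (Set I)} (h : Z.InducedBy S) {a b c d : I}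
    (hs : Z.Sep a b c d) : Z.Sep c d a b := by
  rw [h.sep_iff] at hs ⊢
  obtain ⟨A, hA, h1, h2, h3, h4⟩ := hs
  exact ⟨Aᶜ, h.compl A hA, h3, h4, not_not.2 h1, not_not.2 h2⟩

/-- For a point of the tree, two labels on the same side of it are on the same side of an edge
that keeps them apart from all labels on the other sides. -/
theorem IsPos.exists_split [Finite I] {Z : Labelled I} {S : Set (Set I)} (h : Z.InducedBy S)
    {p : I → I → Prop} (hp : Z.IsPos p) (hne : ∃ a b, ¬ p a b) {x y : I} (hxy : p x y) :
    ∃ A ∈ S, x ∈ A ∧ y ∈ A ∧ ∀ z ∈ A, p x z := by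
  obtain ⟨w, hw⟩ : ∃ w, ¬ p x w := by
    obtain ⟨a, b, hab⟩ := hne
    by_contra hcon
    push Not at hcon
    exact hab (hp.trans (hp.symm (hcon a)) (hcon b))
  obtain ⟨A₀, hA₀, h1, h2, h3, -⟩ := h.sep_iff.1 (hp.sep hxy hw hw)
  -- A smallest side containing `x`, `y` and omitting `w`. If it contained some `z` of another
  -- branch, a side separating `x, y` from `w, z` would be comparable with it, and either inclusion
  -- puts `z` into that side, one of them by minimality.
  obtain ⟨A, ⟨hA, hx, hy, hwA⟩, hmin⟩ := Set.Finite.exists_minimal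
    (s := {A | A ∈ S ∧ x ∈ A ∧ y ∈ A ∧ w ∉ A}) (Set.toFinite _) ⟨A₀, hA₀, h1, h2, h3⟩
  refine ⟨A, hA, hx, hy, fun z hz => ?_⟩
  by_contra hxz
  obtain ⟨B, hB, b1, b2, b3, b4⟩ := h.sep_iff.1 (hp.sep hxy hw hxz)
  have hsub : A ⊆ B ∨ B ⊆ A := by
    by_contra hcon
    rw [not_or, Set.not_subset, Set.not_subset] at hcon
    obtain ⟨⟨u, u1, u2⟩, v, v1, v2⟩ := hcon
    exact h.compat A hA B hB x u v w hx b1 u1 u2 v2 v1 hwA b3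
  rcases hsub with hsub | hsub
  · exact b4 (hsub hz)
  · exact b4 (hmin ⟨hB, b1, b2, b3⟩ hsub hz)

/-- The partition of the remaining labels by the point at which the leaf `none` is attached. -/
def attach (W : Labelled (Option I)) (x y : I) : Prop := ∃ w, W.Sep (some x) (some y) none (some w)

section Attach

variable {W : Labelled (Option I)} (hW : W.IsTree) (hf : ∀ x, ¬ W.same none (some x))
include hW

theorem attach_iff {x y : I} : W.attach x y ↔
    ∃ A ∈ W.splits, some x ∈ A ∧ some y ∈ A ∧ none ∉ A ∧ ∃ w, some w ∉ A := by
  constructor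
  · rintro ⟨w, hw⟩
    obtain ⟨A, hA, h1, h2, h3, h4⟩ := hW.inducedBy.sep_iff.1 hw
    exact ⟨A, hA, h1, h2, h3, w, h4⟩
  · rintro ⟨A, hA, h1, h2, h3, w, h4⟩
    exact ⟨w, hW.inducedBy.sep_iff.2 ⟨A, hA, h1, h2, h3, h4⟩⟩

/-- Seen from `none`, two labels are together if a side away from `none` contains both and still
misses some old label. This last condition excludes the pendant edge of `none`, which separates no
old labels. -/
theorem attach_isPos (h2 : ∃ a b, ¬ W.same (some a) (some b)) (hf : ∀ x, ¬ W.same none (some x)) :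
    (W.restrict some).IsPos W.attach := by
  have h := hW.inducedBy
  refine ⟨?_, ?_, ?_, ?_, ?_⟩
  · intro x
    obtain ⟨w, hw⟩ : ∃ w, ¬ W.same (some x) (some w) := by
      obtain ⟨a, b, hab⟩ := h2
      by_contra hcon
      push Not at hcon
      exact hab (h.same_trans (h.same_symm (hcon a)) (hcon b))
    exact (attach_iff hW).2 ⟨_, h.leaf _ _ hw, h.same_refl _, h.same_refl _,
      fun hh => hf x (h.same_symm hh), w, hw⟩
  · intro x y hxy
    obtain ⟨A, hA, h1, h2, h3⟩ := (attach_iff hW).1 hxy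
    exact (attach_iff hW).2 ⟨A, hA, h2, h1, h3⟩
  · intro x y z hxy hyz
    obtain ⟨A, hA, a1, a2, a3, a4⟩ := (attach_iff hW).1 hxy
    obtain ⟨B, hB, b1, b2, b3, b4⟩ := (attach_iff hW).1 hyz
    rw [attach_iff hW]
    by_cases hz : some z ∈ A
    · exact ⟨A, hA, a1, hz, a3, a4⟩
    by_cases hx : some x ∈ B
    · exact ⟨B, hB, hx, b2, b3, b4⟩
    exact (h.compat A hA B hB _ _ _ _ a2 b1 a1 hx hz b2 a3 b3).elim
  · intro x y z w hxy hz hw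
    obtain ⟨A, hA, a1, a2, a3, a4⟩ := (attach_iff hW).1 hxy
    exact h.sep_iff.2 ⟨A, hA, a1, a2, fun hh => hz ((attach_iff hW).2 ⟨A, hA, a1, hh, a3, a4⟩),
      fun hh => hw ((attach_iff hW).2 ⟨A, hA, a1, hh, a3, a4⟩)⟩
  · intro x y z w hxy hzw hs
    obtain ⟨A, hA, a1, a2, a3, a4⟩ := h.sep_iff.1 hs
    by_cases hn : none ∈ A
    · exact hzw ((attach_iff hW).2 ⟨Aᶜ, h.compl A hA, a3, a4, not_not.2 hn, x, not_not.2 a1⟩)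
    · exact hxy ((attach_iff hW).2 ⟨A, hA, a1, a2, hn, z, a3⟩)

/-- Among the sides in the description of `attach`, a maximal one through `a` misses some `w`. A
side that joins `a` and `w` away from `none` would by compatibility contain it properly. -/
theorem exists_not_attach [Finite I] (h2 : ∃ a b, ¬ W.same (some a) (some b))
    (hf : ∀ x, ¬ W.same none (some x)) : ∃ a b, ¬ W.attach a b := by
  have h := hW.inducedBy
  obtain ⟨a, b, hab⟩ := h2
  obtain ⟨A, ⟨hA, ha, hn, w, hw⟩, hmax⟩ := Set.Finite.exists_maximal
    (s := {A | A ∈ W.splits ∧ some a ∈ A ∧ none ∉ A ∧ ∃ w, some w ∉ A}) (Set.toFinite _)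
    ⟨_, h.leaf _ _ hab, h.same_refl _, fun hh => hf a (h.same_symm hh), b, hab⟩
  refine ⟨a, w, fun hcon => ?_⟩
  obtain ⟨B, hB, b1, b2, b3, b4⟩ := (attach_iff hW).1 hcon
  have hsub : A ⊆ B := by
    intro u hu
    by_contra huB
    exact h.compat A hA B hB _ _ _ _ ha b1 hu huB hw b2 hn b3
  exact hw (hmax ⟨hB, b1, b3, b4⟩ hsub b2)

end Attach

/-- A one-point extension is determined by the point at which the leaf is attached. -/
theorem ext_attach [Finite I] {W W' : Labelled (Option I)} (hW : W.IsTree) (hW' : W'.IsTree)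
    (hf : ∀ x, ¬ W.same none (some x)) (hf' : ∀ x, ¬ W'.same none (some x))
    (hr : W.restrict some = W'.restrict some) (ha : W.attach = W'.attach) : W = W' := by
  have key : ∀ {W W' : Labelled (Option I)}, W.IsTree → W'.IsTree →
      (∀ x, ¬ W.same none (some x)) → (∀ x, ¬ W'.same none (some x)) →
      W.restrict some = W'.restrict some → W.attach = W'.attach →
      ∀ {a b c d}, W.Sep a b c d → W'.Sep a b c d := by
    intro W W' hW hW' hf hf' hr ha
    have h := hW.inducedBy
    have h' := hW'.inducedBy
    have hsome : ∀ {a b c d : I}, W.Sep (some a) (some b) (some c) (some d) →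
        W'.Sep (some a) (some b) (some c) (some d) := fun {a b c d} hs =>
      (congrArg (fun Z : Labelled I => Z.Sep a b c d) hr).mp hs
    -- The essential case. If `a` is in the branch of `b`, a label `x` of another branch replaces
    -- `none`: the split `bc|ax` is visible in the common subtree, and `none` lies on the side of
    -- `a` and `x`, which would otherwise be in one branch. If `a` is in another branch, no side
    -- that attaches `b` to `c` contains it.
    have one : ∀ {b c a : I}, W.Sep (some b) (some c) none (some a) →
        W'.Sep (some b) (some c) none (some a) := by
      intro b c a hs
      obtain ⟨A, hA, a1, a2, a3, a4⟩ := h.sep_iff.1 hs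
      have hbc : W'.attach b c := ha ▸ (attach_iff hW).2 ⟨A, hA, a1, a2, a3, a, a4⟩
      have h2 : ∃ a b, ¬ W.same (some a) (some b) := ⟨b, a, h.not_same_of_mem hA a1 a4⟩
      have hpos := attach_isPos hW h2 hf
      by_cases hba : W.attach b a
      · obtain ⟨x, hx⟩ : ∃ x, ¬ W.attach b x := by
          obtain ⟨u, v, huv⟩ := exists_not_attach hW h2 hf
          by_contra hcon
          push Not at hcon
          exact huv (hpos.trans (hpos.symm (hcon u)) (hcon v))
        have hxA : some x ∉ A := fun hxA => hx ((attach_iff hW).2 ⟨A, hA, a1, hxA, a3, a, a4⟩)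
        obtain ⟨B, hB, b1, b2, b3, b4⟩ := h'.sep_iff.1 (hsome (h.sep_iff.2 ⟨A, hA, a1, a2, a4, hxA⟩))
        by_cases hn : none ∈ B
        · have hax : W'.attach a x := (attach_iff hW').2
            ⟨Bᶜ, h'.compl B hB, b3, b4, not_not.2 hn, b, not_not.2 b1⟩
          exact (hx (hpos.trans hba (ha ▸ hax))).elim
        · exact h'.sep_iff.2 ⟨B, hB, b1, b2, hn, b3⟩
      · obtain ⟨B, hB, b1, b2, b3, b4⟩ := (attach_iff hW').1 hbc
        refine h'.sep_iff.2 ⟨B, hB, b1, b2, b3, fun haB => hba ?_⟩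
        rw [ha]
        exact (attach_iff hW').2 ⟨B, hB, b1, haB, b3, b4⟩
    have two : ∀ {c d : I}, W'.Sep none none (some c) (some d) := fun {c d} =>
      h'.sep_iff.2 ⟨_, h'.leaf _ _ (hf' c), h'.same_refl _, h'.same_refl _, hf' c, hf' d⟩
    intro a b c d hs
    have hs' := h.sep_iff.1 hs
    rcases a with _ | a <;> rcases b with _ | b <;> rcases c with _ | c <;> rcases d with _ | d <;>
      first
      | exact hsome hs
      | exact one hs
      | exact two
      | exact h'.sep_comm two
      | exact h'.sep_comm (h'.sep_swap (h'.sep_comm (one (h.sep_comm (h.sep_swap (h.sep_comm hs))))))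
      | exact h'.sep_comm (one (h.sep_comm hs))
      | exact h'.sep_swap (h'.sep_comm (one (h.sep_comm (h.sep_swap hs))))
      | exact absurd hs' (by rintro ⟨A, -, h1, h2, h3, h4⟩; first | exact h3 h1 | exact h3 h2 | exact h4 h1 | exact h4 h2)
  exact hW.inducedBy.ext_sep hW'.inducedBy fun a b c d =>
    ⟨key hW hW' hf hf' hr ha, key hW' hW hf' hf hr.symm ha.symm⟩

/-- The structure induced by a family of splits. -/
def ofSplits (S : Set (Set I)) : Labelled I where
  same a b := ∀ A ∈ S, a ∈ A → b ∈ A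
  rel a b c d :=
    (¬ (∀ A ∈ S, a ∈ A → b ∈ A) ∧ ¬ (∀ A ∈ S, a ∈ A → c ∈ A) ∧ ¬ (∀ A ∈ S, a ∈ A → d ∈ A) ∧
      ¬ (∀ A ∈ S, b ∈ A → c ∈ A) ∧ ¬ (∀ A ∈ S, b ∈ A → d ∈ A) ∧ ¬ (∀ A ∈ S, c ∈ A → d ∈ A)) ∧
      ∃ A ∈ S, a ∈ A ∧ b ∉ A ∧ (c ∈ A ∧ d ∉ A ∨ d ∈ A ∧ c ∉ A)

/-- A split of the extended tree which restricts to a split of `Z`; here `p` is the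
point at which the new leaf `none` is attached. -/
def IsLift (Z : Labelled I) (p : I → I → Prop) (A : Set (Option I)) : Prop :=
  some ⁻¹' A ∈ Z.splits ∧ (none ∈ A → ∀ x y, some x ∉ A → some y ∉ A → p x y) ∧
    (none ∉ A → ∀ x y, some x ∈ A → some y ∈ A → p x y)

theorem IsLift.compl {Z : Labelled I} (hZ : Z.IsTree) {p : I → I → Prop} {A : Set (Option I)}
    (h : Z.IsLift p A) : Z.IsLift p Aᶜ :=
  ⟨hZ.inducedBy.compl _ h.1, fun hn x y hx hy => h.2.2 hn x y (not_not.1 hx) (not_not.1 hy),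
    fun hn x y hx hy => h.2.1 (not_not.1 hn) x y hx hy⟩

/-- The new leaf goes to the side of the point `p`: outside `A` if `A` lies in one class, inside
otherwise. In the second case `not_sep` puts the complement of `A` into one class. -/
theorem IsPos.exists_lift {Z : Labelled I} {p : I → I → Prop} (hp : Z.IsPos p)
    {A : Set I} (hA : A ∈ Z.splits) : ∃ B, Z.IsLift p B ∧ some ⁻¹' B = A := by
  by_cases h : ∀ x y, x ∈ A → y ∈ A → p x y
  · refine ⟨some '' A, ⟨?_, ?_, ?_⟩, Set.preimage_image_eq _ (Option.some_injective _)⟩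
    · rwa [Set.preimage_image_eq _ (Option.some_injective _)]
    · rintro ⟨x, -, hx⟩
      cases hx
    · rintro - x y ⟨x', hx, hx'⟩ ⟨y', hy, hy'⟩
      cases hx'
      cases hy'
      exact h _ _ hx hy
  · have hB : some ⁻¹' (insert none (some '' A)) = A := by
      ext x
      simp
    refine ⟨insert none (some '' A), ⟨by rwa [hB], fun _ x y hx hy => ?_,
      fun hn => absurd (Or.inl rfl) hn⟩, hB⟩
    push Not at h
    obtain ⟨u, v, hu, hv, huv⟩ := h
    by_contra hxy
    have hx' : x ∉ A := fun hh => hx (Or.inr ⟨x, hh, rfl⟩)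
    have hy' : y ∉ A := fun hh => hy (Or.inr ⟨y, hh, rfl⟩)
    exact hp.not_sep huv hxy (hA.2.2 u hu v hv x hx' y hy')

/-- Every point of a tree is the point of attachment of a one-point extension. -/
theorem IsPos.exists_attach_eq [Finite I] {Z : Labelled I} (hZ : Z.IsTree) {p : I → I → Prop}
    (hp : Z.IsPos p) (hne : ∃ a b, ¬ p a b) :
    ∃ W : Labelled (Option I), W.IsTree ∧ W.restrict some = Z ∧
      (∀ x, ¬ W.same none (some x)) ∧ W.attach = p := by
  have h := hZ.inducedBy
  -- The lifts of the old splits, and the pendant edge of the new leaf.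
  let S : Set (Set (Option I)) := {A | Z.IsLift p A ∨ A = {none} ∨ A = {none}ᶜ}
  have hn : {none} ∈ S := Or.inr (Or.inl rfl)
  have hcompl : ∀ A ∈ S, Aᶜ ∈ S := by
    rintro A (hA | rfl | rfl)
    · exact Or.inl (hA.compl hZ)
    · exact Or.inr (Or.inr rfl)
    · exact Or.inr (Or.inl (compl_compl _))
  -- If no old label were common, the complements would cover all old labels while each lies in the
  -- class of `d`, so `p` would have a single class.
  have hcov : ∀ A B, Z.IsLift p A → Z.IsLift p B → none ∈ A → none ∈ B →
      ∀ d, d ∉ A → d ∉ B → ∃ x, some x ∈ A ∧ some x ∈ B := by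
    intro A B hA hB hnA hnB d hdA hdB
    cases d with
    | none => exact absurd hnA hdA
    | some d =>
      by_contra hcon
      push Not at hcon
      obtain ⟨a, b, hab⟩ := hne
      have key : ∀ x, p d x := by
        intro x
        by_cases hx : some x ∈ A
        · exact hB.2.1 hnB d x hdB (hcon x hx)
        · exact hA.2.1 hnA d x hdA hx
      exact hab (hp.trans (hp.symm (key a)) (key b))
  -- A common element can be replaced by an old label. Used for the four combinations of sides, this
  -- reduces compatibility of lifts to that of the splits of `Z`.
  have hsomes : ∀ A B, Z.IsLift p A → Z.IsLift p B → ∀ a d, a ∈ A → a ∈ B → d ∉ A → d ∉ B →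
      ∃ x, some x ∈ A ∧ some x ∈ B := by
    intro A B hA hB a d a1 a2 d1 d2
    cases a with
    | none => exact hcov A B hA hB a1 a2 d d1 d2
    | some a => exact ⟨a, a1, a2⟩
  have hcompat : ∀ A ∈ S, ∀ B ∈ S, ∀ a b c d, a ∈ A → a ∈ B → b ∈ A → b ∉ B → c ∉ A → c ∈ B →
      d ∉ A → d ∉ B → False := by
    intro A hA B hB a b c d a1 a2 b1 b2 c1 c2 d1 d2
    have hsing : ∀ {x y : Option I} {B : Set (Option I)}, x ∈ ({none} : Set (Option I)) → y ∈ ({none} : Set _) →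
        x ∈ B → y ∉ B → False := by
      rintro x y B rfl rfl h1 h2
      exact h2 h1
    rcases hA with hA | rfl | rfl
    · rcases hB with hB | rfl | rfl
      · obtain ⟨a', ha1, ha2⟩ := hsomes A B hA hB a d a1 a2 d1 d2
        obtain ⟨b', hb1, hb2⟩ := hsomes A Bᶜ hA (hB.compl hZ) b c b1 b2 c1 (not_not.2 c2)
        obtain ⟨c', hc1, hc2⟩ := hsomes Aᶜ B (hA.compl hZ) hB c b c1 c2 (not_not.2 b1) b2
        obtain ⟨d', hd1, hd2⟩ := hsomes Aᶜ Bᶜ (hA.compl hZ) (hB.compl hZ) d a d1 d2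
          (not_not.2 a1) (not_not.2 a2)
        exact h.compat _ hA.1 _ hB.1 a' b' c' d' ha1 ha2 hb1 hb2 hc1 hc2 hd1 hd2
      · exact hsing a2 c2 a1 c1
      · exact hsing (not_not.1 b2) (not_not.1 d2) b1 d1
    · exact hsing a1 b1 a2 b2
    · exact hsing (not_not.1 c1) (not_not.1 d1) c2 d2
  have hfresh : ∀ x, ¬ (ofSplits S).same none (some x) := fun x hx => by
    cases hx {none} hn rfl
  have hsame : ∀ x y, (ofSplits S).same (some x) (some y) ↔ Z.same x y := by
    intro x y
    constructor
    · intro hxy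
      refine (h.same_iff x y).2 fun A hA hx => ?_
      obtain ⟨B, hB, rfl⟩ := hp.exists_lift hA
      exact hxy B (Or.inl hB) hx
    · rintro hxy A (hA | rfl | rfl) hx
      · exact (h.same_iff x y).1 hxy _ hA.1 hx
      · cases hx
      · rintro hy
        cases hy
  have hI : (ofSplits S).InducedBy S := by
    refine ⟨?_, hcompl, hcompat, fun a b => Iff.rfl, ?_, fun a b c d => Iff.rfl⟩
    · obtain ⟨a, -⟩ := hne
      rintro A (hA | rfl | rfl)
      · obtain ⟨x, hx⟩ := h.nonempty _ hA.1
        exact ⟨some x, hx⟩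
      · exact ⟨none, rfl⟩
      · exact ⟨some a, by rintro ⟨⟩⟩
    · rintro (_ | a) b hab
      · convert hn
        ext x
        exact ⟨fun hx => hx {none} hn rfl, fun hx => by cases hx; exact fun _ _ => id⟩
      · have hset : some ⁻¹' {x | (ofSplits S).same (some a) x} = {x | Z.same a x} := by
          ext x
          exact hsame a x
        have hnone : ¬ (ofSplits S).same (some a) none := fun hh => by
          exact hh {none}ᶜ (Or.inr (Or.inr rfl)) (by rintro ⟨⟩) rfl
        obtain ⟨b', hb'⟩ : ∃ b, ¬ Z.same a b := by
          obtain ⟨u, v, huv⟩ := hne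
          by_contra hcon
          push Not at hcon
          exact huv (hp.of_same h (h.same_trans (h.same_symm (hcon u)) (hcon v)))
        refine Or.inl ⟨by rw [hset]; exact h.leaf a b' hb', fun hh => absurd hh hnone,
          fun _ x y hx hy => ?_⟩
        exact hp.of_same h (h.same_trans (h.same_symm ((hsame a x).1 hx)) ((hsame a y).1 hy))
  have hT := hI.isTree
  refine ⟨ofSplits S, hT, ?_, hfresh, ?_⟩
  · refine (hT.restrict some).inducedBy.ext_sep h fun a b c d => ?_
    refine (hI.sep_iff (a := some a) (b := some b) (c := some c) (d := some d)).trans ?_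
    constructor
    · rintro ⟨A, hA | rfl | rfl, h1, h2, h3, h4⟩
      · exact h.sep_iff.2 ⟨_, hA.1, h1, h2, h3, h4⟩
      · cases h1
      · cases (not_not.1 h3)
    · intro hs
      obtain ⟨A, hA, h1, h2, h3, h4⟩ := h.sep_iff.1 hs
      obtain ⟨B, hB, rfl⟩ := hp.exists_lift hA
      exact ⟨B, Or.inl hB, h1, h2, h3, h4⟩
  · funext x y
    refine propext ⟨?_, fun hxy => ?_⟩
    · rintro ⟨w, hw⟩
      obtain ⟨A, hA | rfl | rfl, h1, h2, h3, h4⟩ := hI.sep_iff.1 hw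
      · exact hA.2.2 h3 x y h1 h2
      · cases h1
      · cases (not_not.1 h4)
    -- A side within the class of `x` lifts without the new leaf, and so attaches `x` to `y`.
    · obtain ⟨A, hA, hx, hy, hz⟩ := hp.exists_split h hne hxy
      obtain ⟨w, hw⟩ := hA.2.1
      have hw' : ∃ w, ¬ p x w := by
        obtain ⟨u, v, huv⟩ := hne
        by_contra hcon
        push Not at hcon
        exact huv (hp.trans (hp.symm (hcon u)) (hcon v))
      obtain ⟨v, hv⟩ := hw'
      refine ⟨v, hI.sep_iff.2 ⟨some '' A, Or.inl ⟨?_, ?_, ?_⟩, ⟨x, hx, rfl⟩, ⟨y, hy, rfl⟩, ?_, ?_⟩⟩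
      · rwa [Set.preimage_image_eq _ (Option.some_injective _)]
      · rintro ⟨_, -, hh⟩
        cases hh
      · rintro - u v ⟨u', hu, hu'⟩ ⟨v', hv, hv'⟩
        cases hu'
        cases hv'
        exact hp.trans (hp.symm (hz _ hu)) (hz _ hv)
      · rintro ⟨_, -, hh⟩
        cases hh
      · rintro ⟨v', hv', hh⟩
        cases hh
        exact hv (hz _ hv')

/-- The only node at which the new leaf is alone in its branch is the one where it is attached. -/
theorem eq_addClass_attach {W : Labelled (Option I)} {q : Option I → Option I → Prop} (hq : W.IsNode q)
    (hn : ∀ x, ¬ q none (some x)) : q = addClass W.attach := by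
  have hn' : ∀ x, ¬ q (some x) none := fun x hx => hn x (hq.symm hx)
  funext a b
  rcases a with _ | x <;> rcases b with _ | y
  · exact propext ⟨fun _ => trivial, fun _ => hq.refl _⟩
  · exact propext ⟨fun hh => hn y hh, False.elim⟩
  · exact propext ⟨fun hh => hn' x hh, False.elim⟩
  · refine propext ⟨fun hxy => ?_, ?_⟩
    · obtain ⟨w, hw⟩ : ∃ w, ¬ q (some x) (some w) := by
        obtain ⟨a, b, c, hab, hac, hbc⟩ := hq.three
        by_contra hcon
        push Not at hcon
        have hall : ∀ u, q u (some x) ∨ u = none := fun u => by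
          rcases u with _ | u
          · exact Or.inr rfl
          · exact Or.inl (hq.symm (hcon u))
        rcases hall a with h1 | rfl <;> rcases hall b with h2 | rfl <;>
          rcases hall c with h3 | rfl
        · exact hab (hq.trans h1 (hq.symm h2))
        · exact hab (hq.trans h1 (hq.symm h2))
        · exact hac (hq.trans h1 (hq.symm h3))
        · exact hbc (hq.refl _)
        · exact hbc (hq.trans h2 (hq.symm h3))
        · exact hac (hq.refl _)
        · exact hab (hq.refl _)
        · exact hab (hq.refl _)
      exact ⟨w, hq.sep hxy (hn' x) hw⟩
    · rintro ⟨w, hw⟩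
      by_contra hcon
      exact hq.not_sep hcon (hn w) hw

theorem same_eq_addClass {W : Labelled (Option I)} (hW : W.IsTree)
    (hf : ∀ x, ¬ W.same none (some x)) : W.same = addClass (W.restrict some).same := by
  have h := hW.inducedBy
  funext a b
  rcases a with _ | x <;> rcases b with _ | y
  · exact propext ⟨fun _ => trivial, fun _ => h.same_refl _⟩
  · exact propext ⟨fun hh => hf y hh, False.elim⟩
  · exact propext ⟨fun hh => hf x (h.same_symm hh), False.elim⟩
  · rfl

/-! ### The measure of a one-point extension -/

section Count

variable [Finite I] {W : Labelled (Option I)} (hW : W.IsTree)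
  (hf : ∀ x, ¬ W.same none (some x)) (h2 : ∃ a b, ¬ W.same (some a) (some b))
include hW hf

theorem addClass_attach_isNode (h2 : ∃ a b, ¬ W.same (some a) (some b)) :
    W.IsNode (addClass W.attach) := by
  have h := hW.inducedBy
  have hp := attach_isPos hW h2 hf
  have hE := equivalence_addClass hp.equivalence
  refine ⟨⟨hE.refl, hE.symm, hE.trans, ?_, ?_⟩, ?_⟩
  · rintro (_ | x) (_ | y) z w hxy hz hw
    · rcases z with _ | z
      · exact absurd trivial hz
      rcases w with _ | w
      · exact absurd trivial hw
      exact h.sep_iff.2 ⟨_, h.leaf _ _ (hf z), h.same_refl _, h.same_refl _, hf z, hf w⟩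
    · exact hxy.elim
    · exact hxy.elim
    · obtain ⟨A, hA, a1, a2, a3, a4⟩ := (attach_iff hW).1 hxy
      have key : ∀ z, ¬ addClass W.attach (some x) z → z ∉ A := by
        rintro (_ | z) hz hzA
        · exact a3 hzA
        · exact hz ((attach_iff hW).2 ⟨A, hA, a1, hzA, a3, a4⟩)
      exact h.sep_iff.2 ⟨A, hA, a1, a2, key z hz, key w hw⟩
  · have key : ∀ {x y z w} {A : Set (Option I)}, A ∈ W.splits → x ∈ A → y ∈ A → z ∉ A → w ∉ A →
        none ∉ A → ¬ addClass W.attach z w → addClass W.attach x y := by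
      intro x y z w A hA a1 a2 a3 a4 hn hzw
      rcases x with _ | x
      · exact absurd a1 hn
      rcases y with _ | y
      · exact absurd a2 hn
      refine (attach_iff hW).2 ⟨A, hA, a1, a2, hn, ?_⟩
      rcases z with _ | z
      · rcases w with _ | w
        · exact absurd trivial hzw
        · exact ⟨w, a4⟩
      · exact ⟨z, a3⟩
    intro x y z w hxy hzw hs
    obtain ⟨A, hA, a1, a2, a3, a4⟩ := h.sep_iff.1 hs
    by_cases hn : none ∈ A
    · exact hzw (key (h.compl A hA) a3 a4 (not_not.2 a1) (not_not.2 a2) (not_not.2 hn) hxy)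
    · exact hxy (key hA a1 a2 a3 a4 hn hzw)
  · obtain ⟨a, b, hab⟩ := exists_not_attach hW h2 hf
    exact ⟨none, some a, some b, id, id, hab⟩

/-- The point of attachment, with `c` branches, becomes a node with `c + 1`, and every other node
keeps its valence. So only the number of nodes of valence at least `c + 1` changes; for `c = 2` an
edge is subdivided and a trivalent node is created. -/
theorem nodeCount_extension (h2 : ∃ a b, ¬ W.same (some a) (some b)) {i : ℕ} (hi : 3 ≤ i) :
    W.nodeCount i = (W.restrict some).nodeCount i +
      if i = classes W.attach + 1 then 1 else 0 := by
  have hp := attach_isPos hW h2 hf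
  have hnode := addClass_attach_isNode hW hf h2
  have hcl := classes_addClass W.attach
  have hZ := hW.restrict some
  rw [hW.nodeCount_eq hi, hZ.nodeCount_eq hi]
  -- At any other node the new leaf shares its branch with an old label, so old labels represent all
  -- branches.
  have hthree : ∀ q, W.IsNode q → q ≠ addClass W.attach →
      (∃ x, q none (some x)) ∧
        ∃ a b c, ¬ q (some a) (some b) ∧ ¬ q (some a) (some c) ∧ ¬ q (some b) (some c) := by
    intro q hq hne
    obtain ⟨x, hx⟩ : ∃ x, q none (some x) := by
      by_contra hcon
      push Not at hcon
      exact hne (eq_addClass_attach hq hcon)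
    refine ⟨⟨x, hx⟩, ?_⟩
    have hrep : ∀ u, ∃ v, q u (some v) := by
      rintro (_ | u)
      · exact ⟨x, hx⟩
      · exact ⟨u, hq.refl _⟩
    have hsub : ∀ {u v u' v'}, ¬ q u v → q u u' → q v v' → ¬ q u' v' := fun h1 h2 h3 h4 =>
      h1 (hq.trans h2 (hq.trans h4 (hq.symm h3)))
    obtain ⟨a, b, c, hab, hac, hbc⟩ := hq.three
    obtain ⟨a', ha⟩ := hrep a
    obtain ⟨b', hb⟩ := hrep b
    obtain ⟨c', hc⟩ := hrep c
    exact ⟨a', b', c', hsub hab ha hb, hsub hac ha hc, hsub hbc hb hc⟩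
  have hinj : ∀ q q', W.IsNode q → W.IsNode q' → q ≠ addClass W.attach →
      (fun a b => q (some a) (some b)) = (fun a b => q' (some a) (some b)) → q = q' := by
    intro q q' hq hq' hne he
    obtain ⟨-, a, b, c, hab, hac, hbc⟩ := hthree q hq hne
    have he' : ∀ a b, q (some a) (some b) = q' (some a) (some b) := fun a b =>
      congrFun (congrFun he a) b
    exact hq.toIsPos.ext_of_three hq'.toIsPos hab hac hbc (he' a b ▸ hab) (he' a c ▸ hac)
      (he' b c ▸ hbc)
  have hcard : ({q | W.IsNode q ∧ i ≤ classes q} \ {addClass W.attach}).ncard =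
      ({q | (W.restrict some).IsNode q ∧ i ≤ classes q} \ {W.attach}).ncard := by
    refine Set.ncard_congr (fun q _ => fun a b => q (some a) (some b)) ?_ ?_ ?_
    · rintro q ⟨⟨hq, hiq⟩, hne⟩
      obtain ⟨⟨x, hx⟩, h3⟩ := hthree q hq hne
      refine ⟨⟨⟨hq.toIsPos.restrict some, h3⟩, ?_⟩, fun he => hne ?_⟩
      · rwa [classes_restrict_eq hq.toIsPos.equivalence some]
        rintro (_ | u)
        · exact ⟨x, hx⟩
        · exact ⟨u, hq.refl _⟩
      · exact hinj q _ hq hnode hne he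
    · rintro q q' ⟨⟨hq, -⟩, hne⟩ ⟨⟨hq', -⟩, -⟩ he
      exact hinj q q' hq hq' hne he
    · rintro q ⟨⟨hq, hiq⟩, hne⟩
      obtain ⟨p, hp, rfl⟩ := hq.extend hW hZ
      refine ⟨p, ⟨⟨hp, hiq.trans (classes_restrict_le p some)⟩, ?_⟩, rfl⟩
      rintro rfl
      exact hne rfl
  have hA : addClass W.attach ∈ {q | W.IsNode q ∧ i ≤ classes q} ↔ i ≤ classes W.attach + 1 := by
    simp only [Set.mem_ofPred_eq, hnode, true_and, hcl]
  have hB : W.attach ∈ {q | (W.restrict some).IsNode q ∧ i ≤ classes q} ↔ i ≤ classes W.attach := by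
    refine ⟨fun hh => hh.2, fun hh => ⟨⟨hp, ?_⟩, hh⟩⟩
    exact (three_le_classes hp.equivalence).1 (hi.trans hh)
  have cA := fun hmem => Set.ncard_sdiff_singleton_add_one
    (s := {q | W.IsNode q ∧ i ≤ classes q}) (a := addClass W.attach) hmem (Set.toFinite _)
  have cB := fun hmem => Set.ncard_sdiff_singleton_add_one
    (s := {q | (W.restrict some).IsNode q ∧ i ≤ classes q}) (a := W.attach) hmem (Set.toFinite _)
  rcases lt_trichotomy i (classes W.attach + 1) with hlt | heq | hgt
  · rw [if_neg hlt.ne, add_zero, ← cA (hA.2 hlt.le), ← cB (hB.2 (by omega)), hcard]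
  · rw [if_pos heq, ← cA (hA.2 heq.le), hcard, Set.sdiff_singleton_eq_self]
    rw [hB]
    omega
  · rw [if_neg hgt.ne', add_zero]
    rw [Set.sdiff_singleton_eq_self (by rw [hA]; omega),
      Set.sdiff_singleton_eq_self (by rw [hB]; omega)] at hcard
    exact hcard

theorem leafCount_extension : W.leafCount = (W.restrict some).leafCount + 1 := by
  rw [leafCount, same_eq_addClass hW hf]
  exact classes_addClass _

end Count

end Labelled

section Measure

open Labelled

variable {k : Type u} [CommRing k] {I : Type} [Finite I]

/-- The measure of the extension of a tree by a leaf attached at a point of valence `c`. -/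
noncomputable def extensionWeight (t : k) (c : ℕ) : k :=
  (if c = 2 then -(t - 2) else t - c) * Ring.inverse (t - 1)

/-- By `nodeCount_extension` only the factor for `i = c + 1` survives, which is `t - c`. The sign
changes only for `c = 2`, where a node is created. -/
theorem treeMeasure_extension (t : k) {W : Labelled (Option I)} (hW : W.IsTree)
    (hf : ∀ x, ¬ W.same none (some x)) (h2 : ∃ a b, ¬ W.same (some a) (some b)) :
    treeMeasure t some W = extensionWeight t (classes W.attach) := by
  have hp := attach_isPos hW h2 hf
  have hc : 2 ≤ classes W.attach :=
    (two_le_classes hp.equivalence).2 (exists_not_attach hW h2 hf)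
  have hle := (addClass_attach_isNode hW hf h2).classes_le_leafCount hW
  rw [classes_addClass W.attach] at hle
  have hl := leafCount_extension hW hf
  have hn := fun i (hi : 3 ≤ i) => nodeCount_extension hW hf h2 hi
  have h0 : (W.restrict some).leafCount ≠ 0 := by
    rw [Ne, leafCount_eq_zero, not_isEmpty_iff]
    obtain ⟨a, -⟩ := h2
    exact ⟨a⟩
  rw [treeMeasure, if_neg (fun hh => h0 hh.1), hn 3 le_rfl, Nat.add_sub_cancel_left, one_mul]
  have hprod : ∏ i ∈ Finset.Icc 3 W.leafCount, (t - (i : k) + 1) ^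
      (W.nodeCount i - (W.restrict some).nodeCount i) = t - (classes W.attach : k) := by
    rw [Finset.prod_eq_single (classes W.attach + 1)]
    · rw [hn _ (by omega), Nat.add_sub_cancel_left, if_pos rfl, pow_one]
      push_cast
      ring
    · intro i hi hne
      rw [hn i (Finset.mem_Icc.1 hi).1, Nat.add_sub_cancel_left, if_neg hne, pow_zero]
    · intro hh
      exact absurd (Finset.mem_Icc.2 ⟨by omega, hle⟩) hh
  rw [hprod, hl, Nat.add_sub_cancel_left, pow_one, extensionWeight]
  by_cases h : classes W.attach = 2
  · rw [if_pos (by omega), if_pos h, h]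
    push_cast
    ring
  · rw [if_neg (by omega), if_neg h]
    ring

/-- The degenerate extensions, from no leaf to one and from one leaf to two: no nodes occur, and the
factor `t` comes from the convention for the empty tree. -/
theorem treeMeasure_extension_of_leafCount (t : k) {W : Labelled (Option I)} (hW : W.IsTree)
    (hf : ∀ x, ¬ W.same none (some x)) (h2 : ∀ a b, W.same (some a) (some b)) :
    treeMeasure t some W = (if (W.restrict some).leafCount = 0 then t else 1) * Ring.inverse (t - 1) := by
  have hl := leafCount_extension hW hf
  have h1 : (W.restrict some).leafCount ≤ 1 := by
    by_contra hcon
    obtain ⟨a, b, hab⟩ := (two_le_classes (p := (W.restrict some).same)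
      ⟨fun x => hW.inducedBy.same_refl (some x), hW.inducedBy.same_symm, hW.inducedBy.same_trans⟩).1
      (by rw [not_le] at hcon; exact hcon)
    exact hab (h2 a b)
  have hn : ∀ i, 3 ≤ i → W.nodeCount i = 0 := fun i hi => hW.nodeCount_eq_zero hi (by omega)
  rw [treeMeasure, hn 3 le_rfl, Nat.zero_sub, pow_zero, mul_one, hl, Nat.add_sub_cancel_left,
    pow_one, Finset.prod_eq_one, mul_one]
  · simp only [ne_eq, Nat.succ_ne_zero, not_false_eq_true, and_true]
  · intro i hi
    rw [hn i (Finset.mem_Icc.1 hi).1, Nat.zero_sub, pow_zero]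

end Measure

end Arboreal

namespace Arboreal

universe u

/-! ### Amalgamating two one-point extensions -/

namespace Labelled

variable {I X : Type}

/-- A split gives the midpoint of an edge, with the two sides as branches. For `not_sep`: a split
each of whose sides contains labels from both sides of `H` is incompatible with `H`. -/
theorem isPos_of_split {Z : Labelled I} {S : Set (Set I)} (h : Z.InducedBy S) {H : I → Prop}
    (hs : ∀ x y z w, H x → H y → ¬ H z → ¬ H w → Z.Sep x y z w) :
    Z.IsPos (fun x y => H x ↔ H y) := by
  have hns : ∀ x y z w, H x → ¬ H y → H z → ¬ H w → ¬ Z.Sep x y z w := by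
    intro x y z w hx hy hz hw hsep
    obtain ⟨A, hA, a1, a2, a3, a4⟩ := h.sep_iff.1 hsep
    obtain ⟨B, hB, b1, b2, b3, b4⟩ := h.sep_iff.1 (hs x z y w hx hz hy hw)
    exact h.compat A hA B hB x y z w a1 b1 a2 b3 a3 b2 a4 b4
  have hswap : ∀ {x y z w}, Z.Sep x y z w → Z.Sep x y w z := fun hh =>
    h.sep_comm (h.sep_swap (h.sep_comm hh))
  refine ⟨fun _ => Iff.rfl, Iff.symm, Iff.trans, ?_, ?_⟩
  · intro x y z w hxy hz hw
    by_cases hx : H x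
    · exact hs x y z w hx (hxy.1 hx) (fun hh => hz ⟨fun _ => hh, fun _ => hx⟩)
        (fun hh => hw ⟨fun _ => hh, fun _ => hx⟩)
    · exact h.sep_comm (hs z w x y (by tauto) (by tauto) hx (by tauto))
  · intro x y z w hxy hzw hsep
    by_cases hx : H x <;> by_cases hz : H z
    · exact hns x y z w hx (by tauto) hz (by tauto) hsep
    · exact hns x y w z hx (by tauto) (by tauto) hz (hswap hsep)
    · exact hns y x z w (by tauto) hx hz (by tauto) (h.sep_swap hsep)
    · exact hns y x w z (by tauto) hx (by tauto) hz (h.sep_swap (hswap hsep))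

/-- Points that keep `none` apart. -/
theorem eq_addClass_of_forall_not {W : Labelled (Option I)} {p : Option I → Option I → Prop}
    (hp : W.IsPos p) {x y : I} (hxy : ¬ p (some x) (some y)) (hn : ∀ x, ¬ p none (some x)) :
    p = addClass W.attach :=
  eq_addClass_attach ⟨hp, none, some x, some y, hn x, hn y, hxy⟩ hn

section

variable {W : Labelled (Option I)} (hW : W.IsTree)
include hW

/-- The point at the end of the pendant edge of the leaf `none`. -/
theorem isPos_addClass_true (hf : ∀ x, ¬ W.same none (some x)) :
    W.IsPos (addClass fun _ _ => True) := by
  have h := hW.inducedBy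
  have hpos := isPos_of_split h (H := fun o => o = none) (by
    rintro _ _ (_ | z) (_ | w) rfl rfl hz hw
    · exact absurd rfl hz
    · exact absurd rfl hz
    · exact absurd rfl hw
    · exact h.sep_iff.2 ⟨_, h.leaf _ _ (hf z), h.same_refl _, h.same_refl _, hf z, hf w⟩)
  convert hpos using 1
  funext a b
  rcases a with _ | a <;> rcases b with _ | b <;> simp [addClass]

/-- This occurs when `none` subdivides the edge with midpoint `P`, and `p₁`, `p₂` are the two half
edges. Compatibility forces the classes of `x₁` and `x₂` to be all classes of `P`, and then these
are the branches where `none` is attached. -/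
theorem attach_eq_of_two_points (p₁ p₂ : Option I → Option I → Prop) (P : I → I → Prop)
    (h₁ : W.IsPos p₁) (h₂ : W.IsPos p₂) (r₁ : ∀ x y, p₁ (some x) (some y) ↔ P x y)
    (r₂ : ∀ x y, p₂ (some x) (some y) ↔ P x y) {x₁ x₂ : I} (n₁ : p₁ none (some x₁))
    (n₂ : p₂ none (some x₂)) (hne : ¬ P x₁ x₂) : P = W.attach := by
  have h := hW.inducedBy
  have hsymm : ∀ {x y}, P x y → P y x := fun {x y} hxy =>
    (r₁ _ _).1 (h₁.symm ((r₁ x y).2 hxy))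
  have htrans : ∀ {x y z}, P x y → P y z → P x z := fun {x y z} hxy hyz =>
    (r₁ _ _).1 (h₁.trans ((r₁ x y).2 hxy) ((r₁ y z).2 hyz))
  have q₁ : ∀ {x}, ¬ P x₁ x → ¬ p₁ none (some x) := fun hx hh =>
    hx ((r₁ _ _).1 (h₁.trans (h₁.symm n₁) hh))
  have q₂ : ∀ {x}, ¬ P x₂ x → ¬ p₂ none (some x) := fun hx hh =>
    hx ((r₂ _ _).1 (h₂.trans (h₂.symm n₂) hh))
  have hcov : ∀ x, P x₁ x ∨ P x₂ x := by
    intro x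
    by_contra hcon
    rw [not_or] at hcon
    obtain ⟨A, hA, a1, a2, a3, a4⟩ := h.sep_iff.1 (h₁.sep n₁ (q₁ hne) (q₁ hcon.1))
    obtain ⟨B, hB, b1, b2, b3, b4⟩ := h.sep_iff.1
      (h₂.sep n₂ (q₂ fun hh => hne (hsymm hh)) (q₂ hcon.2))
    exact h.compat A hA B hB _ _ _ _ a1 b1 a2 b3 a3 b2 a4 b4
  have s₁ : ∀ {x y z}, P x₁ x → P x₁ y → P x₂ z → W.Sep (some x) (some y) none (some z) := by
    intro x y z hx hy hz
    refine h₂.sep ((r₂ _ _).2 (htrans (hsymm hx) hy)) (fun hh => ?_) (fun hh => ?_)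
    · exact q₂ (fun h' => hne (htrans hx (hsymm h'))) (h₂.symm hh)
    · exact hne (htrans hx (htrans ((r₂ _ _).1 hh) (hsymm hz)))
  have s₂ : ∀ {x y z}, P x₂ x → P x₂ y → P x₁ z → W.Sep (some x) (some y) none (some z) := by
    intro x y z hx hy hz
    refine h₁.sep ((r₁ _ _).2 (htrans (hsymm hx) hy)) (fun hh => ?_) (fun hh => ?_)
    · exact q₁ (fun h' => hne (htrans h' (hsymm hx))) (h₁.symm hh)
    · exact hne (htrans hz (htrans (hsymm ((r₁ _ _).1 hh)) (hsymm hx)))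
  have hmix : ∀ {x y w}, P x₁ x → P x₂ y → ¬ W.Sep (some x) (some y) none (some w) := by
    intro x y w hx hy hs
    obtain ⟨A, hA, a1, a2, a3, a4⟩ := h.sep_iff.1 hs
    rcases hcov w with hw | hw
    · obtain ⟨B, hB, b1, b2, b3, b4⟩ := h.sep_iff.1 (s₁ hx hw hy)
      exact h.compat A hA B hB _ _ _ _ a1 b1 a2 b4 a4 b2 a3 b3
    · obtain ⟨B, hB, b1, b2, b3, b4⟩ := h.sep_iff.1 (s₂ hy hw hx)
      exact h.compat A hA B hB _ _ _ _ a2 b1 a1 b4 a4 b2 a3 b3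
  have refl₁ := (r₁ x₁ x₁).1 (h₁.refl _)
  have refl₂ := (r₁ x₂ x₂).1 (h₁.refl _)
  funext x y
  refine propext ⟨fun hxy => ?_, ?_⟩
  · rcases hcov x with hx | hx
    · exact ⟨x₂, s₁ hx (htrans hx hxy) refl₂⟩
    · exact ⟨x₁, s₂ hx (htrans hx hxy) refl₁⟩
  · rintro ⟨w, hw⟩
    rcases hcov x with hx | hx <;> rcases hcov y with hy | hy
    · exact htrans (hsymm hx) hy
    · exact absurd hw (hmix hx hy)
    · exact absurd (h.sep_swap hw) (hmix hy hx)
    · exact htrans (hsymm hx) hy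

/-- A point of the smaller tree that is not the point of attachment of the leaf `none` comes from a
point of the larger tree. -/
theorem exists_isPos_of_ne_attach [Finite I] (hf : ∀ x, ¬ W.same none (some x)) {P : I → I → Prop}
    (hP : (W.restrict some).IsPos P) (hne : ∃ a b, ¬ P a b) (hPQ : P ≠ W.attach) :
    ∃ p, W.IsPos p ∧ ∀ x y, p (some x) (some y) ↔ P x y := by
  have h := hW.inducedBy
  have h2 : ∃ a b, ¬ W.same (some a) (some b) := by
    obtain ⟨a, b, hab⟩ := hne
    exact ⟨a, b, fun hh => hab (hP.of_same (hW.restrict some).inducedBy hh)⟩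
  have hQ := attach_isPos hW h2 hf
  -- Sides whose old labels lie in one class of `P`; the lifted point joins two labels when such a
  -- side contains both.
  let ok : Set (Option I) → Prop := fun A => ∀ x y, some x ∈ A → some y ∈ A → P x y
  let p : Option I → Option I → Prop := fun u v => ∃ A ∈ W.splits, u ∈ A ∧ v ∈ A ∧ ok A
  have hother : ∀ x, ∃ y, ¬ P x y := by
    intro x
    obtain ⟨a, b, hab⟩ := hne
    by_contra hcon
    push Not at hcon
    exact hab (hP.trans (hP.symm (hcon a)) (hcon b))
  -- Transitivity could only fail through two such sides that contain `none` and cover all old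
  -- labels. Then `P` and the point of attachment of `none` both have exactly these two sides as
  -- classes, against `hPQ`.
  have hcover : ∀ A B, A ∈ W.splits → B ∈ W.splits → ok A → ok B → none ∈ A → none ∈ B →
      ¬ ∀ x, some x ∈ A ∨ some x ∈ B := by
    intro A B hA hB okA okB nA nB hcov
    have hdisj : ∀ x, some x ∈ A → some x ∉ B := by
      intro x hxA hxB
      obtain ⟨y, hy⟩ := hother x
      rcases hcov y with hy' | hy'
      · exact hy (okA x y hxA hy')
      · exact hy (okB x y hxB hy')
    have hPA : ∀ x y, some x ∈ A → some y ∈ B → ¬ P x y := by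
      intro x y hx hy hxy
      obtain ⟨z, hz⟩ := hother x
      rcases hcov z with hz' | hz'
      · exact hz (okA x z hx hz')
      · exact hz (hP.trans hxy (okB y z hy hz'))
    obtain ⟨a, ha⟩ : ∃ a, some a ∉ A := by
      obtain ⟨x, hx⟩ := hA.2.1
      rcases x with _ | x
      · exact absurd nA hx
      · exact ⟨x, hx⟩
    obtain ⟨b, hb⟩ : ∃ b, some b ∉ B := by
      obtain ⟨x, hx⟩ := hB.2.1
      rcases x with _ | x
      · exact absurd nB hx
      · exact ⟨x, hx⟩
    have ha' := (hcov a).resolve_left ha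
    have hb' := (hcov b).resolve_right hb
    have hQA : ∀ x y, some x ∈ A → some y ∈ A → W.attach x y := fun x y hx hy =>
      (attach_iff hW).2 ⟨Bᶜ, h.compl B hB, hdisj x hx, hdisj y hy, not_not.2 nB, a, not_not.2 ha'⟩
    have hQB : ∀ x y, some x ∈ B → some y ∈ B → W.attach x y := fun x y hx hy =>
      (attach_iff hW).2 ⟨Aᶜ, h.compl A hA, fun hh => hdisj x hh hx, fun hh => hdisj y hh hy,
        not_not.2 nA, b, not_not.2 hb'⟩
    obtain ⟨u, v, huv⟩ := exists_not_attach hW h2 hf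
    have hQAB : ∀ x y, some x ∈ A → some y ∈ B → ¬ W.attach x y := by
      intro x y hx hy hxy
      have key : ∀ z, W.attach x z := fun z => by
        rcases hcov z with hz | hz
        · exact hQA x z hx hz
        · exact hQ.trans hxy (hQB y z hy hz)
      exact huv (hQ.trans (hQ.symm (key u)) (key v))
    refine hPQ (funext fun x => funext fun y => propext ?_)
    rcases hcov x with hx | hx <;> rcases hcov y with hy | hy
    · exact iff_of_true (okA x y hx hy) (hQA x y hx hy)
    · exact iff_of_false (hPA x y hx hy) (hQAB x y hx hy)
    · exact iff_of_false (fun hh => hPA y x hy hx (hP.symm hh))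
        (fun hh => hQAB y x hy hx (hQ.symm hh))
    · exact iff_of_true (okB x y hx hy) (hQB x y hx hy)
  refine ⟨p, ⟨?_, ?_, ?_, ?_, ?_⟩, fun x y => ⟨?_, fun hxy => ?_⟩⟩
  · rintro (_ | x)
    · obtain ⟨a, -⟩ := hne
      exact ⟨_, h.leaf _ _ (hf a), h.same_refl _, h.same_refl _, fun x y hx _ => absurd hx (hf x)⟩
    · refine ⟨_, h.leaf (some x) none (fun hh => hf x (h.same_symm hh)), h.same_refl _,
        h.same_refl _, fun y z hy hz => ?_⟩
      exact hP.of_same (hW.restrict some).inducedBy (h.same_trans (h.same_symm hy) hz)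
  · rintro u v ⟨A, hA, hu, hv, hok⟩
    exact ⟨A, hA, hv, hu, hok⟩
  · rintro u v w ⟨A, hA, hu, hv, hok⟩ ⟨B, hB, hv', hw, hok'⟩
    by_cases hwA : w ∈ A
    · exact ⟨A, hA, hu, hwA, hok⟩
    by_cases huB : u ∈ B
    · exact ⟨B, hB, huB, hw, hok'⟩
    have hcov : ∀ x, x ∈ A ∨ x ∈ B := by
      intro x
      by_contra hx
      rw [not_or] at hx
      exact h.compat A hA B hB _ _ _ _ hv hv' hu huB hwA hw hx.1 hx.2
    exfalso
    rcases v with _ | v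
    · exact hcover A B hA hB hok hok' hv hv' fun x => hcov (some x)
    · obtain ⟨y, hy⟩ := hother v
      rcases hcov (some y) with hy' | hy'
      · exact hy (hok v y hv hy')
      · exact hy (hok' v y hv' hy')
  · rintro x y z w ⟨A, hA, hx, hy, hok⟩ hz hw
    exact h.sep_iff.2 ⟨A, hA, hx, hy, fun hh => hz ⟨A, hA, hx, hh, hok⟩,
      fun hh => hw ⟨A, hA, hx, hh, hok⟩⟩
  · intro x y z w hxy hzw hs
    obtain ⟨A, hA, a1, a2, a3, a4⟩ := h.sep_iff.1 hs
    have n1 : ¬ ok A := fun hok => hxy ⟨A, hA, a1, a2, hok⟩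
    have n2 : ¬ ok Aᶜ := fun hok => hzw ⟨Aᶜ, h.compl A hA, a3, a4, hok⟩
    simp only [ok] at n1 n2
    push Not at n1 n2
    obtain ⟨u, v, hu, hv, huv⟩ := n1
    obtain ⟨u', v', hu', hv', huv'⟩ := n2
    exact hP.not_sep huv huv' (h.sep_iff.2 ⟨A, hA, hu, hv, hu', hv'⟩)
  · rintro ⟨A, hA, hx, hy, hok⟩
    exact hok x y hx hy
  · obtain ⟨_, ⟨A, hA, rfl, -⟩, hx, hy, hz⟩ := hP.exists_split (h.restrict some) hne hxy
    exact ⟨A, hA, hx, hy, fun u v hu hv => hP.trans (hP.symm (hz u hu)) (hz v hv)⟩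

/-- If the leaf `none` is attached in the middle of an edge, then each half of this edge is a
point of the larger tree. -/
theorem isPos_half_edge {a b : I} (hcov : ∀ x, W.attach a x ∨ W.attach b x)
    (hQ : (W.restrict some).IsPos W.attach) :
    W.IsPos (fun u v => (u.elim True (W.attach a) ↔ v.elim True (W.attach a))) := by
  have h := hW.inducedBy
  refine isPos_of_split h (H := fun u => u.elim True (W.attach a)) ?_
  rintro x y (_ | z) (_ | w) hx hy hz hw
  · exact absurd trivial hz
  · exact absurd trivial hz
  · exact absurd trivial hw
  · have hz' := (hcov z).resolve_left hz
    have hw' := (hcov w).resolve_left hw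
    have hzw := hQ.trans (hQ.symm hz') hw'
    obtain ⟨A, hA, a1, a2, a3, a4⟩ := (attach_iff hW).1 hzw
    have key : ∀ u : Option I, u.elim True (W.attach a) → u ∉ A := by
      rintro (_ | u) hu huA
      · exact a3 huA
      · exact hz (hQ.trans hu (hQ.symm ((attach_iff hW).2 ⟨A, hA, a1, huA, a3, a4⟩)))
    exact h.sep_iff.2 ⟨Aᶜ, h.compl A hA, key x hx, key y hy, not_not.2 a1, not_not.2 a2⟩

end

/-- The trees on the label set `W` of level `≤ N` that induce given structures on `Y` and `X`. -/
noncomputable def amalgams (N : ℕ∞) {W Y X : Type} [Finite W] (u : Y → W) (v : X → W)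
    (S : Labelled Y) (S' : Labelled X) : Finset (Labelled W) :=
  (Set.toFinite {Z : Labelled W | Z.InClass N ∧ Z.restrict u = S ∧ Z.restrict v = S'}).toFinset

@[simp] theorem mem_amalgams {N : ℕ∞} {W Y X : Type} [Finite W] {u : Y → W} {v : X → W}
    {S : Labelled Y} {S' : Labelled X} {Z : Labelled W} :
    Z ∈ amalgams N u v S S' ↔ Z.InClass N ∧ Z.restrict u = S ∧ Z.restrict v = S' := by
  simp [amalgams]

theorem inClass_top {Z : Labelled I} : Z.InClass ⊤ ↔ Z.IsTree := by
  simp [InClass]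

theorem exists_two_of_fresh [Nonempty X] {S : Labelled (Option X)}
    (hf : ∀ x, ¬ S.same none (some x)) : ∃ a b, ¬ S.same a b := by
  obtain ⟨x⟩ := ‹Nonempty X›
  exact ⟨none, some x, hf x⟩

/-- Two leaves `none` and `some none` are added to a tree: the point at which `none` is attached
to the tree with `some none` removed. -/
theorem restrict_map_some_eq_iff [Finite X] [Nonempty X] {S S' : Labelled (Option X)}
    (hS : S.IsTree) (hf : ∀ x, ¬ S.same none (some x)) (hf' : ∀ x, ¬ S'.same none (some x))
    (hr : S.restrict some = S'.restrict some) {W : Labelled (Option (Option X))} (hW : W.IsTree)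
    (hWr : W.restrict some = S') (hWf : ∀ x, ¬ W.same none (some x)) :
    W.restrict (Option.map some) = S ↔
      (((∃ x y : X, ¬ W.attach (some x) (some y)) ∧
          ∀ x y : X, W.attach (some x) (some y) ↔ S.attach x y) ∨
        ((∀ x y : X, W.attach (some x) (some y)) ∧ S.attach = S'.attach)) := by
  subst hWr
  have h := hW.inducedBy
  have hS' := hW.restrict some
  have h2 : ∃ a b, ¬ W.same (some a) (some b) := exists_two_of_fresh hf'
  have hp := attach_isPos hW h2 hWf
  have hR := hW.restrict (Option.map some : Option X → _)
  have hRf : ∀ x, ¬ (W.restrict (Option.map some : Option X → _)).same none (some x) :=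
    fun x => hWf (some x)
  have hRr : (W.restrict (Option.map some : Option X → _)).restrict some = S.restrict some :=
    hr.symm
  have hiff : W.restrict (Option.map some) = S ↔
      (W.restrict (Option.map some : Option X → _)).attach = S.attach :=
    ⟨fun hh => by rw [hh], ext_attach hR hS hRf hf hRr⟩
  have hsep : ∀ x y, (W.restrict (Option.map some : Option X → _)).attach x y ↔
      ∃ A ∈ W.splits, some (some x) ∈ A ∧ some (some y) ∈ A ∧ none ∉ A ∧
        ∃ w : X, some (some w) ∉ A := by
    intro x y
    constructor
    · rintro ⟨w, hw⟩
      obtain ⟨A, hA, h1, h2, h3, h4⟩ := h.sep_iff.1 hw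
      exact ⟨A, hA, h1, h2, h3, w, h4⟩
    · rintro ⟨A, hA, h1, h2, h3, w, h4⟩
      exact ⟨w, h.sep_iff.2 ⟨A, hA, h1, h2, h3, h4⟩⟩
  rw [hiff]
  -- Either the point of attachment of `none` still separates labels of `X` and survives the removal
  -- of `some none`, or it lies on the pendant edge of `some none`, and after the removal `none`
  -- takes the place of that leaf.
  by_cases htriv : ∃ x y : X, ¬ W.attach (some x) (some y)
  · have key : ∀ x y, (W.restrict (Option.map some : Option X → _)).attach x y ↔
        W.attach (some x) (some y) := by
      intro x y
      rw [hsep]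
      constructor
      · rintro ⟨A, hA, h1, h2, h3, w, h4⟩
        exact (attach_iff hW).2 ⟨A, hA, h1, h2, h3, some w, h4⟩
      · intro hxy
        obtain ⟨A, hA, h1, h2, h3, h4⟩ := (attach_iff hW).1 hxy
        refine ⟨A, hA, h1, h2, h3, ?_⟩
        by_contra hcon
        push Not at hcon
        obtain ⟨u, v, huv⟩ := htriv
        exact huv ((attach_iff hW).2 ⟨A, hA, hcon u, hcon v, h3, h4⟩)
    constructor
    · intro hh
      exact Or.inl ⟨htriv, fun x y => by rw [← key, hh]⟩
    · rintro (⟨-, hh⟩ | ⟨hh, -⟩)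
      · funext x y
        exact propext ((key x y).trans (hh x y))
      · obtain ⟨u, v, huv⟩ := htriv
        exact absurd (hh u v) huv
  · have hall : ∀ x y : X, W.attach (some x) (some y) := by
      intro x y
      by_contra hcon
      exact htriv ⟨x, y, hcon⟩
    have hnone : ∀ x : X, ¬ W.attach none (some x) := by
      intro x hx
      obtain ⟨u, v, huv⟩ := exists_not_attach hW h2 hWf
      have hu : ∀ u : Option X, W.attach (some x) u := by
        rintro (_ | u)
        · exact hp.symm hx
        · exact hall x u
      exact huv (hp.trans (hp.symm (hu u)) (hu v))
    have key : (W.restrict (Option.map some : Option X → _)).attach = (W.restrict some).attach := by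
      funext x y
      refine propext ((hsep x y).trans ⟨?_, ?_⟩)
      · rintro ⟨A, hA, h1, h2, h3, w, h4⟩
        refine ⟨w, h.sep_iff.2 ⟨A, hA, h1, h2, fun hh => ?_, h4⟩⟩
        exact hnone x ((attach_iff hW).2 ⟨A, hA, hh, h1, h3, some w, h4⟩)
      · rintro ⟨w, hw⟩
        obtain ⟨A, hA, h1, h2, h3, h4⟩ := h.sep_iff.1 hw
        refine ⟨A, hA, h1, h2, fun hh => ?_, w, h4⟩
        exact hnone w ((attach_iff hW).2 ⟨Aᶜ, h.compl A hA, h3, h4, not_not.2 hh, some x,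
          not_not.2 h1⟩)
    rw [key]
    constructor
    · exact fun hh => Or.inr ⟨hall, hh.symm⟩
    · rintro (⟨⟨u, v, huv⟩, -⟩ | ⟨-, hh⟩)
      · exact absurd (hall u v) huv
      · exact hh.symm

theorem elim_comp_map_some :
    (fun o : Option (Option X) => o.elim none id) ∘ Option.map some = id := by
  funext o
  cases o <;> rfl

/-- The two new leaves coincide. -/
theorem mem_amalgams_not_fresh_iff [Finite X] {S S' : Labelled (Option X)}
    (hS' : S'.IsTree) (hf : ∀ x, ¬ S.same none (some x)) {W : Labelled (Option (Option X))} :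
    (W ∈ amalgams ⊤ (Option.map some) some S S' ∧ ¬ ∀ x, ¬ W.same none (some x)) ↔
      S = S' ∧ W = S'.restrict (fun o => o.elim none id) := by
  rw [mem_amalgams, inClass_top]
  constructor
  · rintro ⟨⟨hW, hWS, hWS'⟩, hn⟩
    push Not at hn
    obtain ⟨_ | x, hx⟩ := hn
    · have hWe : W = S'.restrict (fun o => o.elim none id) := by
        rw [← hWS', restrict_restrict]
        refine (hW.restrict_eq_self ?_).symm
        rintro (_ | o)
        · exact hx
        · exact hW.inducedBy.same_refl _
      refine ⟨?_, hWe⟩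
      rw [← hWS, hWe, restrict_restrict, elim_comp_map_some]
      rfl
    · refine absurd ?_ (hf x)
      rw [← hWS]
      exact hx
  · rintro ⟨rfl, rfl⟩
    refine ⟨⟨hS'.restrict _, ?_, rfl⟩, fun hh => hh none (hS'.inducedBy.same_refl none)⟩
    rw [restrict_restrict, elim_comp_map_some]
    rfl

/-- The tree with two leaves. -/
theorem IsTree.exists_extension_of_subsingleton [Finite I] [Nonempty I] {Z : Labelled I}
    (hZ : Z.IsTree) (h : ∀ a b, Z.same a b) :
    ∃ W : Labelled (Option I), W.IsTree ∧ W.restrict some = Z ∧ ∀ x, ¬ W.same none (some x) := by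
  let S : Set (Set (Option I)) := {{none}, {none}ᶜ}
  have hfresh : ∀ x, ¬ (ofSplits S).same none (some x) := fun x hx => by
    cases hx {none} (Or.inl rfl) rfl
  have hsame : ∀ x y, (ofSplits S).same (some x) (some y) := by
    rintro x y A (rfl | rfl) hx
    · cases hx
    · rintro ⟨⟩
  have hsing : ∀ {x y : Option I} {B : Set (Option I)}, x ∈ ({none} : Set (Option I)) →
      y ∈ ({none} : Set _) → x ∈ B → y ∉ B → False := by
    rintro x y B rfl rfl h1 h2
    exact h2 h1
  have hI : (ofSplits S).InducedBy S := by
    refine ⟨?_, ?_, ?_, fun a b => Iff.rfl, ?_, fun a b c d => Iff.rfl⟩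
    · rintro A (rfl | rfl)
      · exact ⟨none, rfl⟩
      · obtain ⟨x⟩ := ‹Nonempty I›
        exact ⟨some x, by rintro ⟨⟩⟩
    · rintro A (rfl | rfl)
      · exact Or.inr rfl
      · exact Or.inl (compl_compl _)
    · rintro A (rfl | rfl) B - a b c d a1 a2 b1 b2 c1 c2 d1 d2
      · exact hsing a1 b1 a2 b2
      · exact hsing (not_not.1 c1) (not_not.1 d1) c2 d2
    · rintro (_ | a) (_ | b) hab
      · exact absurd (fun _ _ => id) hab
      · left
        ext (_ | x)
        · exact iff_of_true (fun _ _ => id) rfl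
        · exact iff_of_false (hfresh x) (by rintro ⟨⟩)
      · right
        ext (_ | x)
        · exact iff_of_false hab (fun hh => hh rfl)
        · exact iff_of_true (hsame a x) (by rintro ⟨⟩)
      · exact absurd (hsame a b) hab
  have hT := hI.isTree
  refine ⟨ofSplits S, hT, ?_, hfresh⟩
  refine (hT.restrict some).inducedBy.ext_sep hZ.inducedBy fun a b c d => iff_of_false ?_ ?_
  · intro hs
    obtain ⟨A, hA, h1, -, h3, -⟩ := hI.sep_iff.1 hs
    exact h3 (hsame a c A hA h1)
  · intro hs
    obtain ⟨A, hA, h1, -, h3, -⟩ := hZ.inducedBy.sep_iff.1 hs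
    exact h3 ((hZ.inducedBy.same_iff a c).1 (h a c) A hA h1)

end Labelled

end Arboreal

/-! ### Points over a point of the common subtree, and the identity of weights. -/

namespace Arboreal

universe u

namespace Labelled

variable {X : Type} [Finite X] {k : Type u} [CommRing k]

/-- The points of the tree `S'`, with labels `Option X`, which lie over the point `P` of the
tree obtained by removing the leaf `none`. -/
def pointsOver (S' : Labelled (Option X)) (P : X → X → Prop) :
    Set (Option X → Option X → Prop) :=
  {p | S'.IsPos p ∧ (∃ a b, ¬ p a b) ∧
    (((∃ x y : X, ¬ p (some x) (some y)) ∧ ∀ x y : X, p (some x) (some y) ↔ P x y) ∨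
      ((∀ x y : X, p (some x) (some y)) ∧ P = S'.attach))}

section

variable {S S' : Labelled (Option X)} (hS : S.IsTree) (hS' : S'.IsTree)
  (hf : ∀ x, ¬ S.same none (some x)) (hf' : ∀ x, ¬ S'.same none (some x))
  (hr : S.restrict some = S'.restrict some)
include hS hS' hf hf' hr

/-- If the two new leaves differ, the amalgamation is an extension of `S'` by one leaf, hence a
point of `S'`; `restrict_map_some_eq_iff` tells which points induce `S`. -/
theorem sum_fresh [Nonempty X] (t : k) :
    ∑ᶠ W ∈ {W | W ∈ amalgams ⊤ (Option.map some) some S S' ∧ ∀ x, ¬ W.same none (some x)},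
      treeMeasure t some W = ∑ᶠ p ∈ pointsOver S' S.attach, extensionWeight t (classes p) := by
  have h2 : ∀ {W : Labelled (Option (Option X))}, W.restrict some = S' →
      ∃ a b, ¬ W.same (some a) (some b) := by
    rintro W rfl
    exact exists_two_of_fresh hf'
  refine finsum_mem_eq_of_bijOn attach ⟨?_, ?_, ?_⟩ ?_
  · rintro W ⟨hW, hWf⟩
    rw [mem_amalgams, inClass_top] at hW
    obtain ⟨hW, hWS, hWS'⟩ := hW
    refine ⟨hWS' ▸ attach_isPos hW (h2 hWS') hWf, exists_not_attach hW (h2 hWS') hWf, ?_⟩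
    exact (restrict_map_some_eq_iff hS hf hf' hr hW hWS' hWf).1 hWS
  · rintro W ⟨hW, hWf⟩ W' ⟨hW', hWf'⟩ he
    rw [mem_amalgams, inClass_top] at hW hW'
    exact ext_attach hW.1 hW'.1 hWf hWf' (hW.2.2.trans hW'.2.2.symm) he
  · rintro p ⟨hp, hne, hover⟩
    obtain ⟨W, hW, hWS', hWf, rfl⟩ := hp.exists_attach_eq hS' hne
    refine ⟨W, ⟨?_, hWf⟩, rfl⟩
    rw [mem_amalgams, inClass_top]
    exact ⟨hW, (restrict_map_some_eq_iff hS hf hf' hr hW hWS' hWf).2 hover, hWS'⟩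
  · rintro W ⟨hW, hWf⟩
    rw [mem_amalgams, inClass_top] at hW
    exact treeMeasure_extension t hW.1 hWf (h2 hW.2.2)

omit [Finite X] hS hf hr in
theorem addClass_true_mem_pointsOver [Nonempty X] :
    addClass (fun _ _ => True) ∈ pointsOver S' S'.attach := by
  obtain ⟨x⟩ := ‹Nonempty X›
  exact ⟨isPos_addClass_true hS' hf', ⟨none, some x, id⟩, Or.inr ⟨fun _ _ => trivial, rfl⟩⟩

omit [Finite X] hS hS' hf hf' hr in
theorem eq_addClass_true {p : Option X → Option X → Prop} (hp : S'.IsPos p)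
    (hne : ∃ a b, ¬ p a b) (h : ∀ x y : X, p (some x) (some y)) :
    p = addClass (fun _ _ => True) := by
  have hn : ∀ x, ¬ p none (some x) := by
    intro x hx
    obtain ⟨a, b, hab⟩ := hne
    have key : ∀ a, p (some x) a := by
      rintro (_ | a)
      · exact hp.symm hx
      · exact h x a
    exact hab (hp.trans (hp.symm (key a)) (key b))
  funext a b
  rcases a with _ | a <;> rcases b with _ | b
  · exact propext (iff_of_true (hp.refl _) trivial)
  · exact propext (iff_of_false (hn b) id)
  · exact propext (iff_of_false (fun hh => hn a (hp.symm hh)) id)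
  · exact propext (iff_of_true (h a b) trivial)

omit hS hS' hf hf' hr in
theorem classes_addClass_true [Nonempty X] :
    classes (addClass fun _ _ : X => True) = 2 := by
  rw [classes_addClass]
  have : classes (fun _ _ : X => True) = 1 := by
    rw [classes, Set.range_const, Set.ncard_singleton]
  rw [this]

omit [Finite X] hS hf hr in
/-- All labels other than `none` label the same leaf. -/
theorem pointsOver_of_subsingleton [Nonempty X]
    (h1 : ∀ x y : X, S'.same (some x) (some y)) :
    pointsOver S' S'.attach = {addClass fun _ _ => True} := by
  ext p
  rw [Set.mem_singleton_iff]
  constructor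
  · rintro ⟨hp, hne, -⟩
    exact eq_addClass_true hp hne fun x y => hp.of_same hS'.inducedBy (h1 x y)
  · rintro rfl
    exact addClass_true_mem_pointsOver hS' hf'

end

section

variable {S' : Labelled (Option X)} (hS' : S'.IsTree) (hf' : ∀ x, ¬ S'.same none (some x))
  {P : X → X → Prop} (hP : (S'.restrict some).IsPos P) (hne : ∃ a b, ¬ P a b)
include hS' hf' hP hne

/-- Away from its point of attachment, `none` merely joins an existing branch. Lifts that put it
into different branches would make `P` the point of attachment by `attach_eq_of_two_points`. -/
theorem pointsOver_of_ne (hPQ : P ≠ S'.attach) :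
    ∃ p, classes p = classes P ∧ pointsOver S' P = {p} := by
  obtain ⟨a, b, hab⟩ := hne
  have key : ∀ p, S'.IsPos p → (∀ x y, p (some x) (some y) ↔ P x y) → ∃ x, p none (some x) := by
    intro p hp hr
    by_contra hcon
    push Not at hcon
    apply hPQ
    have he := eq_addClass_of_forall_not hp (fun hh => hab ((hr a b).1 hh)) hcon
    funext x y
    rw [← propext (hr x y), he]
    rfl
  obtain ⟨p, hp, hr⟩ := exists_isPos_of_ne_attach hS' hf' hP ⟨a, b, hab⟩ hPQ
  refine ⟨p, ?_, ?_⟩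
  · have hrp : (fun x y => p (some x) (some y)) = P := by
      funext x y
      exact propext (hr x y)
    rw [← hrp]
    refine (classes_restrict_eq hp.equivalence some ?_).symm
    rintro (_ | x)
    · exact key p hp hr
    · exact ⟨x, hp.refl _⟩
  · ext q
    rw [Set.mem_singleton_iff]
    constructor
    · rintro ⟨hq, hqne, ⟨-, hqr⟩ | ⟨-, hh⟩⟩
      · obtain ⟨x, hx⟩ := key p hp hr
        obtain ⟨y, hy⟩ := key q hq hqr
        have hxy : P x y := by
          by_contra hxy
          exact hPQ (attach_eq_of_two_points hS' p q P hp hq hr hqr hx hy hxy)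
        have hnone : ∀ z, p none (some z) ↔ q none (some z) := by
          intro z
          constructor
          · intro hz
            have hxz := (hr x z).1 (hp.trans (hp.symm hx) hz)
            exact hq.trans hy ((hqr y z).2 (hP.trans (hP.symm hxy) hxz))
          · intro hz
            have hyz := (hqr y z).1 (hq.trans (hq.symm hy) hz)
            exact hp.trans hx ((hr x z).2 (hP.trans hxy hyz))
        funext u v
        refine propext ?_
        rcases u with _ | u <;> rcases v with _ | v
        · exact iff_of_true (hq.refl _) (hp.refl _)
        · exact (hnone v).symm
        · exact ⟨fun hh => hp.symm ((hnone u).2 (hq.symm hh)),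
            fun hh => hq.symm ((hnone u).1 (hp.symm hh))⟩
        · rw [hr, hqr]
      · exact absurd hh hPQ
    · rintro rfl
      exact ⟨hp, ⟨some a, some b, fun hh => hab ((hr a b).1 hh)⟩,
        Or.inl ⟨⟨a, b, fun hh => hab ((hr a b).1 hh)⟩, hr⟩⟩

end

section

variable {S' : Labelled (Option X)} (hS' : S'.IsTree) (hf' : ∀ x, ¬ S'.same none (some x))
  (h2 : ∃ a b, ¬ S'.same (some a) (some b))
include hS' hf' h2

theorem addClass_attach_mem_pointsOver :
    addClass S'.attach ∈ pointsOver S' S'.attach := by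
  obtain ⟨a, b, hab⟩ := exists_not_attach hS' h2 hf'
  exact ⟨(addClass_attach_isNode hS' hf' h2).toIsPos, ⟨some a, some b, hab⟩,
    Or.inl ⟨⟨a, b, hab⟩, fun _ _ => Iff.rfl⟩⟩

omit [Finite X] hS' hf' h2 in
theorem pointsOver_attach_cases {p : Option X → Option X → Prop}
    (hp : p ∈ pointsOver S' S'.attach) : p = addClass (fun _ _ => True) ∨ p = addClass S'.attach ∨
      (S'.IsPos p ∧ (∀ x y, p (some x) (some y) ↔ S'.attach x y) ∧ ∃ x, p none (some x)) := by
  obtain ⟨hp, hne, ⟨⟨a, b, hab⟩, hr⟩ | ⟨hh, -⟩⟩ := hp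
  · right
    by_cases hn : ∃ x, p none (some x)
    · exact Or.inr ⟨hp, hr, hn⟩
    · push Not at hn
      exact Or.inl (eq_addClass_of_forall_not hp hab hn)
  · exact Or.inl (eq_addClass_true hp hne hh)

/-- The leaf `none` is attached at a node. -/
theorem pointsOver_attach_of_three (h3 : 3 ≤ classes S'.attach) :
    pointsOver S' S'.attach = {addClass (fun _ _ => True), addClass S'.attach} := by
  have : Nonempty X := ⟨h2.choose⟩
  have hQ := attach_isPos hS' h2 hf'
  ext p
  constructor
  · intro hmem
    rcases pointsOver_attach_cases hmem with h | h | ⟨hp, hr, x, hx⟩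
    · exact Or.inl h
    · exact Or.inr h
    · exfalso
      -- A lift with `none` in the branch of `x` would separate `none, x` from labels `y`, `z` of
      -- two further branches, and that split attaches `y` to `z`.
      obtain ⟨y, z, hxy, hxz, hyz⟩ : ∃ y z, ¬ S'.attach x y ∧ ¬ S'.attach x z ∧
          ¬ S'.attach y z := by
        obtain ⟨a, b, c, hab, hac, hbc⟩ := (three_le_classes hQ.equivalence).1 h3
        have hcl : ∀ {u v}, S'.attach x u → ¬ S'.attach u v → ¬ S'.attach x v :=
          fun h1 h2 h3 => h2 (hQ.trans (hQ.symm h1) h3)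
        by_cases ha : S'.attach x a
        · exact ⟨b, c, hcl ha hab, hcl ha hac, hbc⟩
        by_cases hb : S'.attach x b
        · exact ⟨a, c, ha, hcl hb hbc, hac⟩
        exact ⟨a, b, ha, hb, hab⟩
      have hn : ∀ {u}, ¬ S'.attach x u → ¬ p none (some u) := fun hu hh =>
        hu ((hr _ _).1 (hp.trans (hp.symm hx) hh))
      exact hyz ⟨x, hS'.inducedBy.sep_comm (hp.sep hx (hn hxy) (hn hxz))⟩
  · rintro (rfl | rfl)
    · exact addClass_true_mem_pointsOver hS' hf'
    · exact addClass_attach_mem_pointsOver hS' hf' h2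

/-- The leaf `none` is attached in the middle of an edge. -/
theorem pointsOver_attach_of_two {a b : X} (hab : ¬ S'.attach a b)
    (hcov : ∀ x, S'.attach a x ∨ S'.attach b x) :
    pointsOver S' S'.attach = {addClass (fun _ _ => True), addClass S'.attach,
      (fun u v => (u.elim True (S'.attach a) ↔ v.elim True (S'.attach a))),
      (fun u v => (u.elim True (S'.attach b) ↔ v.elim True (S'.attach b)))} := by
  have : Nonempty X := ⟨a⟩
  have hQ := attach_isPos hS' h2 hf'
  have hiff : ∀ {a b}, ¬ S'.attach a b → (∀ x, S'.attach a x ∨ S'.attach b x) → ∀ x y,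
      (S'.attach a x ↔ S'.attach a y) ↔ S'.attach x y := by
    intro a b hab hcov x y
    constructor
    · intro hxy
      by_cases hx : S'.attach a x
      · exact hQ.trans (hQ.symm hx) (hxy.1 hx)
      · exact hQ.trans (hQ.symm ((hcov x).resolve_left hx))
          ((hcov y).resolve_left fun hy => hx (hxy.2 hy))
    · intro hxy
      exact ⟨fun hx => hQ.trans hx hxy, fun hy => hQ.trans hy (hQ.symm hxy)⟩
  have hba : ¬ S'.attach b a := fun hh => hab (hQ.symm hh)
  have hcov' : ∀ x, S'.attach b x ∨ S'.attach a x := fun x => (hcov x).symm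
  have hmem : ∀ {a b}, ¬ S'.attach a b → (∀ x, S'.attach a x ∨ S'.attach b x) →
      (fun u v : Option X => (u.elim True (S'.attach a) ↔ v.elim True (S'.attach a))) ∈
        pointsOver S' S'.attach := by
    intro a b hab hcov
    have hn : ¬ (S'.attach a a ↔ S'.attach a b) := fun hh => hab (hh.1 (hQ.refl a))
    exact ⟨isPos_half_edge hS' hcov hQ, ⟨some a, some b, hn⟩,
      Or.inl ⟨⟨a, b, hn⟩, hiff hab hcov⟩⟩
  have heq : ∀ {a b}, ¬ S'.attach a b → (∀ x, S'.attach a x ∨ S'.attach b x) → ∀ p,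
      S'.IsPos p → (∀ x y, p (some x) (some y) ↔ S'.attach x y) → p none (some a) →
      p = (fun u v : Option X => (u.elim True (S'.attach a) ↔ v.elim True (S'.attach a))) := by
    intro a b hab hcov p hp hr ha
    have hn : ∀ x, p none (some x) ↔ S'.attach a x := fun x =>
      ⟨fun hx => (hr a x).1 (hp.trans (hp.symm ha) hx), fun hx => hp.trans ha ((hr a x).2 hx)⟩
    funext u v
    refine propext ?_
    rcases u with _ | u <;> rcases v with _ | v
    · exact iff_of_true (hp.refl _) Iff.rfl
    · simpa using hn v
    · simpa using (⟨fun hh => hp.symm hh, fun hh => hp.symm hh⟩ : p (some u) none ↔ _).trans (hn u)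
    · exact (hr u v).trans (hiff hab hcov u v).symm
  ext p
  simp only [Set.mem_insert_iff, Set.mem_singleton_iff]
  constructor
  · intro hp
    rcases pointsOver_attach_cases hp with h | h | ⟨hp, hr, x, hx⟩
    · exact Or.inl h
    · exact Or.inr (Or.inl h)
    · rcases hcov x with hax | hbx
      · exact Or.inr (Or.inr (Or.inl (heq hab hcov p hp hr
          (hp.trans hx ((hr _ _).2 (hQ.symm hax))))))
      · exact Or.inr (Or.inr (Or.inr (heq hba hcov' p hp hr
          (hp.trans hx ((hr _ _).2 (hQ.symm hbx))))))
  · rintro (rfl | rfl | rfl | rfl)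
    · exact addClass_true_mem_pointsOver hS' hf'
    · exact addClass_attach_mem_pointsOver hS' hf' h2
    · exact hmem hab hcov
    · exact hmem hba hcov'

/-- The term `1` accounts for the amalgamation that identifies the two new leaves. After
multiplication by `t - 1`, the case of `c ≥ 3` branches reads `(t - 1) - (t - 2) + (t - c - 1) = t -
c`. For `c = 2` there are three edges and one node: `(t - 1) - 3(t - 2) + (t - 3) = -(t - 2)`. -/
theorem sum_pointsOver_attach (t : k) (ht : IsUnit (t - 1)) :
    1 + ∑ᶠ p ∈ pointsOver S' S'.attach, extensionWeight t (classes p) =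
      extensionWeight t (classes S'.attach) := by
  have : Nonempty X := ⟨h2.choose⟩
  have hQ := attach_isPos hS' h2 hf'
  have hinv : (t - 1) * Ring.inverse (t - 1) = 1 := Ring.mul_inverse_cancel _ ht
  have hnt := exists_not_attach hS' h2 hf'
  have hc := (two_le_classes hQ.equivalence).2 hnt
  have hne : addClass (fun _ _ : X => True) ≠ addClass S'.attach := by
    intro hh
    obtain ⟨a, b, hab⟩ := hnt
    have : addClass S'.attach (some a) (some b) := hh ▸ trivial
    exact hab this
  by_cases h3 : 3 ≤ classes S'.attach
  · rw [pointsOver_attach_of_three hS' hf' h2 h3, finsum_mem_pair hne, classes_addClass_true,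
      classes_addClass, extensionWeight, extensionWeight, extensionWeight, if_pos rfl,
      if_neg (by omega), if_neg (by omega)]
    push_cast
    linear_combination -hinv
  · obtain ⟨a, b, hab⟩ := hnt
    have hcov : ∀ x, S'.attach a x ∨ S'.attach b x := by
      intro x
      by_contra hx
      rw [not_or] at hx
      exact h3 ((three_le_classes hQ.equivalence).2 ⟨a, b, x, hab, hx.1, hx.2⟩)
    have hc2 : classes S'.attach = 2 := by omega
    have hhalf : ∀ a : X, (∃ b, ¬ S'.attach a b) → classes (fun u v : Option X =>
        (u.elim True (S'.attach a) ↔ v.elim True (S'.attach a))) = 2 := by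
      rintro a ⟨b, hab⟩
      have hE : Equivalence (fun u v : Option X =>
        (u.elim True (S'.attach a) ↔ v.elim True (S'.attach a))) :=
        ⟨fun _ => Iff.rfl, Iff.symm, Iff.trans⟩
      refine le_antisymm ?_ ((two_le_classes hE).2 ⟨some a, some b,
        fun hh => hab (hh.1 (hQ.refl a))⟩)
      by_contra hcon
      obtain ⟨x, y, z, hxy, hxz, hyz⟩ := (three_le_classes hE).1 (not_le.1 hcon)
      tauto
    have hba : ¬ S'.attach b a := fun hh => hab (hQ.symm hh)
    have n1 : ∀ {a b}, ¬ S'.attach a b → ∀ r : X → X → Prop, addClass r ≠ (fun u v : Option X =>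
        (u.elim True (S'.attach a) ↔ v.elim True (S'.attach a))) := by
      intro a b hab r hh
      have h1 := congrFun (congrFun hh none) (some a)
      have h2 : addClass r none (some a) := h1.mpr (iff_of_true trivial (hQ.refl a))
      exact h2
    have n2 : (fun u v : Option X =>
        (u.elim True (S'.attach a) ↔ v.elim True (S'.attach a))) ≠ (fun u v : Option X =>
        (u.elim True (S'.attach b) ↔ v.elim True (S'.attach b))) := by
      intro hh
      have h1 := congrFun (congrFun hh none) (some a)
      exact hba ((h1.mp (iff_of_true trivial (hQ.refl a))).1 trivial)
    rw [pointsOver_attach_of_two hS' hf' h2 hab hcov, finsum_mem_insert _ _ (Set.toFinite _),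
      finsum_mem_insert _ _ (Set.toFinite _), finsum_mem_pair n2, classes_addClass_true,
      classes_addClass, hhalf a ⟨b, hab⟩, hhalf b ⟨a, hba⟩, hc2]
    · simp only [extensionWeight, if_true, if_neg (show ¬ 2 + 1 = 2 by omega)]
      push_cast
      linear_combination -hinv
    · simp only [Set.mem_insert_iff, Set.mem_singleton_iff, not_or]
      exact ⟨n1 hab _, n1 hba _⟩
    · simp only [Set.mem_insert_iff, Set.mem_singleton_iff, not_or]
      exact ⟨hne, n1 hab _, n1 hba _⟩

end

/-- The amalgamation formula for two one-point extensions. -/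
theorem treeMeasure_amalgamation_extensions {S S' : Labelled (Option X)} (hS : S.IsTree)
    (hS' : S'.IsTree) (hf : ∀ x, ¬ S.same none (some x)) (hf' : ∀ x, ¬ S'.same none (some x))
    (hr : S.restrict some = S'.restrict some) (t : k) (ht : IsUnit (t - 1)) :
    treeMeasure t some S =
      ∑ W ∈ amalgams ⊤ (Option.map some) some S S', treeMeasure t some W := by
  classical
  have hinv : (t - 1) * Ring.inverse (t - 1) = 1 := Ring.mul_inverse_cancel _ ht
  have hSS' : S = S' ↔ S.attach = S'.attach :=
    ⟨fun h => by rw [h], ext_attach hS hS' hf hf' hr⟩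
  have hnf : ∑ W ∈ amalgams ⊤ (Option.map some) some S S' with ¬ ∀ x, ¬ W.same none (some x),
      treeMeasure t some W = if S = S' then 1 else 0 := by
    split_ifs with he
    · have hset : (amalgams ⊤ (Option.map some) some S S').filter
          (fun W => ¬ ∀ x, ¬ W.same none (some x)) =
          {S'.restrict (fun o => o.elim none id)} := by
        ext W
        rw [Finset.mem_filter, mem_amalgams_not_fresh_iff hS' hf, Finset.mem_singleton]
        exact and_iff_right he
      rw [hset, Finset.sum_singleton]
      refine treeMeasure_of_surjective t (hS'.restrict _) some ?_
      rintro (_ | o)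
      · exact ⟨none, hS'.inducedBy.same_refl none⟩
      · exact ⟨o, hS'.inducedBy.same_refl o⟩
    · refine Finset.sum_eq_zero fun W hW => absurd ?_ he
      rw [Finset.mem_filter, mem_amalgams_not_fresh_iff hS' hf] at hW
      exact hW.1
  have hfr : ∑ W ∈ amalgams ⊤ (Option.map some) some S S' with ∀ x, ¬ W.same none (some x),
      treeMeasure t some W = ∑ᶠ W ∈ {W | W ∈ amalgams ⊤ (Option.map some) some S S' ∧
        ∀ x, ¬ W.same none (some x)}, treeMeasure t some W := by
    rw [← finsum_mem_coe_finset]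
    refine finsum_congr fun W => ?_
    simp only [Finset.coe_filter]
  -- The new leaves can coincide only if `S = S'`, and that amalgamation has measure `1`.
  rw [← Finset.sum_filter_add_sum_filter_not _ (fun W => ∀ x, ¬ W.same none (some x)), hnf, hfr]
  have h2iff : (∃ a b, ¬ S.same (some a) (some b)) ↔ ∃ a b, ¬ S'.same (some a) (some b) := by
    have : ∀ a b, S.same (some a) (some b) = S'.same (some a) (some b) := fun a b =>
      congrArg (fun Z : Labelled X => Z.same a b) hr
    simp only [this]
  by_cases h2 : ∃ a b, ¬ S.same (some a) (some b)
  · have h2' := h2iff.1 h2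
    have : Nonempty X := ⟨h2.choose⟩
    rw [sum_fresh hS hS' hf hf' hr, treeMeasure_extension t hS hf h2]
    by_cases he : S = S'
    · subst he
      rw [if_pos rfl, add_comm, sum_pointsOver_attach hS hf h2 t ht]
    · obtain ⟨p, hp, hset⟩ := pointsOver_of_ne hS' hf' (hr ▸ attach_isPos hS h2 hf)
        (exists_not_attach hS h2 hf) (fun hh => he (hSS'.2 hh))
      rw [if_neg he, add_zero, hset, finsum_mem_singleton, hp]
  · have hall : ∀ a b, S.same (some a) (some b) := by
      intro a b
      by_contra hcon
      exact h2 ⟨a, b, hcon⟩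
    have hall' : ∀ a b, S'.same (some a) (some b) := by
      intro a b
      by_contra hcon
      exact h2 (h2iff.2 ⟨a, b, hcon⟩)
    have hno : ∀ {S : Labelled (Option X)}, S.IsTree → (∀ a b, S.same (some a) (some b)) →
        S.attach = fun _ _ => False := by
      intro S hS hall
      funext x y
      refine propext (iff_of_false ?_ id)
      rintro ⟨w, hw⟩
      obtain ⟨A, hA, h1, -, -, h4⟩ := hS.inducedBy.sep_iff.1 hw
      exact h4 ((hS.inducedBy.same_iff _ _).1 (hall x w) A hA h1)
    obtain rfl : S = S' := hSS'.2 (by rw [hno hS hall, hno hS' hall'])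
    rw [if_pos rfl, treeMeasure_extension_of_leafCount t hS hf hall]
    -- Over the empty tree the identity is `t / (t - 1) = 1 + 1 / (t - 1)`, the last term being the
    -- two-leaf tree; over one leaf it is `1 / (t - 1) = 1 - (t - 2) / (t - 1)`.
    rcases isEmpty_or_nonempty X with hX | hX
    · rw [if_pos (leafCount_eq_zero.2 hX)]
      have hone : ∀ a b : Option X, S.same a b := by
        rintro (_ | a) (_ | b)
        · exact hS.inducedBy.same_refl none
        · exact isEmptyElim b
        · exact isEmptyElim a
        · exact isEmptyElim a
      obtain ⟨W, hW, hWS, hWf⟩ := hS.exists_extension_of_subsingleton hone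
      have hset : {W | W ∈ amalgams ⊤ (Option.map some) some S S ∧ ∀ x, ¬ W.same none (some x)} =
          {W} := by
        have hno' : ∀ {W : Labelled (Option (Option X))}, W.IsTree → W.restrict some = S →
            W.attach = fun _ _ => False := by
          rintro W hW rfl
          funext x y
          refine propext (iff_of_false ?_ id)
          rintro ⟨w, hw⟩
          obtain ⟨A, hA, h1, -, -, h4⟩ := hW.inducedBy.sep_iff.1 hw
          exact h4 ((hW.inducedBy.same_iff _ _).1 (hone x w) A hA h1)
        ext W'
        rw [Set.mem_ofPred_eq, mem_amalgams, inClass_top, Set.mem_singleton_iff]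
        constructor
        · rintro ⟨⟨h1, -, h3⟩, h4⟩
          exact ext_attach h1 hW h4 hWf (h3.trans hWS.symm) (by rw [hno' h1 h3, hno' hW hWS])
        · rintro rfl
          refine ⟨⟨hW, ?_, hWS⟩, hWf⟩
          refine ext_attach (hW.restrict _) hS (fun x => isEmptyElim x) hf ?_ ?_
          · refine Labelled.ext ?_ ?_
            · funext x
              exact isEmptyElim x
            · funext x
              exact isEmptyElim x
          · funext x
            exact isEmptyElim x
      have hl : (W.restrict some).leafCount ≠ 0 := by
        rw [Ne, leafCount_eq_zero, not_isEmpty_iff]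
        exact ⟨none⟩
      rw [hset, finsum_mem_singleton, treeMeasure_extension_of_leafCount t hW hWf
        (fun a b => by
          have := hone a b
          rw [← hWS] at this
          exact this), if_neg hl]
      linear_combination hinv
    · rw [sum_fresh hS hS hf hf rfl, pointsOver_of_subsingleton hS hf hall, finsum_mem_singleton,
        classes_addClass_true, extensionWeight, if_pos rfl, if_neg]
      · linear_combination hinv
      · rw [leafCount_eq_zero, not_isEmpty_iff]
        exact hX

end Labelled

end Arboreal

namespace Arboreal

universe u

/-! ### The amalgamation formula -/

namespace Labelled

variable {I J X Y X' W : Type} {k : Type u} [CommRing k]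

/-- The amalgamations of `S` and `S'` over the structure they both induce along `i` and `j`. -/
noncomputable def pushouts [Finite Y] [Finite X'] (N : ℕ∞) (i : X → Y) (j : X → X')
    (S : Labelled Y) (S' : Labelled X') : Finset (Labelled (Y ⊕ X')) :=
  (Set.toFinite {Z : Labelled (Y ⊕ X') | Z.InClass N ∧ Z.restrict Sum.inl = S ∧
    Z.restrict Sum.inr = S' ∧ ∀ x, Z.same (Sum.inl (i x)) (Sum.inr (j x))}).toFinset

@[simp] theorem mem_pushouts [Finite Y] [Finite X'] {N : ℕ∞} {i : X → Y} {j : X → X'}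
    {S : Labelled Y} {S' : Labelled X'} {Z : Labelled (Y ⊕ X')} :
    Z ∈ pushouts N i j S S' ↔ Z.InClass N ∧ Z.restrict Sum.inl = S ∧
      Z.restrict Sum.inr = S' ∧ ∀ x, Z.same (Sum.inl (i x)) (Sum.inr (j x)) := by
  simp [pushouts]

/-- Amalgamations may be labelled by any set `W` in which the labels that
have to label the same leaf are identified. -/
theorem sum_pushouts_eq [Finite Y] [Finite X'] [Finite W] (t : k) (N : ℕ∞) (i : X → Y)
    (j : X → X') (u : Y → W) (v : X' → W) (S : Labelled Y) (S' : Labelled X')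
    (hsurj : Function.Surjective (Sum.elim u v)) (hij : ∀ x, u (i x) = v (j x))
    (hident : ∀ Z ∈ pushouts N i j S S', ∀ a b, Sum.elim u v a = Sum.elim u v b → Z.same a b) :
    ∑ Z ∈ pushouts N i j S S', treeMeasure t Sum.inr Z =
      ∑ Z ∈ amalgams N u v S S', treeMeasure t v Z := by
  symm
  choose s hs using hsurj
  have hself : ∀ Z : Labelled W, (Z.restrict (Sum.elim u v)).restrict s = Z := by
    intro Z
    rw [restrict_restrict, show Sum.elim u v ∘ s = id from funext hs]
    rfl
  refine Finset.sum_nbij (fun Z => Z.restrict (Sum.elim u v)) ?_ ?_ ?_ ?_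
  · intro Z hZ
    rw [mem_amalgams] at hZ
    refine mem_pushouts.2 ⟨hZ.1.restrict _, hZ.2.1, hZ.2.2, fun x => ?_⟩
    change Z.same (u (i x)) (v (j x))
    rw [hij]
    exact hZ.1.1.inducedBy.same_refl _
  · intro Z _ Z' _ he
    rw [← hself Z, ← hself Z']
    exact congrArg (fun Z => Z.restrict s) he
  · intro Z hZ
    have hZ' := mem_pushouts.1 hZ
    have he : (Z.restrict s).restrict (Sum.elim u v) = Z :=
      hZ'.1.1.restrict_eq_self fun a => hident Z hZ _ _ (hs _).symm
    refine ⟨Z.restrict s, mem_amalgams.2 ⟨hZ'.1.restrict s, ?_, ?_⟩, he⟩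
    · exact (congrArg (fun Z => Z.restrict Sum.inl) he).trans hZ'.2.1
    · exact (congrArg (fun Z => Z.restrict Sum.inr) he).trans hZ'.2.2.1
  · intro Z hZ
    have hZ' := (mem_amalgams.1 hZ).1
    have hc := treeMeasure_comp t (Sum.inr : X' → Y ⊕ X') (Sum.elim u v) hZ'.1
    rw [treeMeasure_of_surjective t hZ'.1 (Sum.elim u v) (fun w => ⟨s w, by
      rw [hs]; exact hZ'.1.inducedBy.same_refl _⟩), one_mul] at hc
    exact hc

/-- The new label names an old leaf, so the only amalgamation is `S'` with one label repeated, and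
both measures are `1`. -/
theorem sum_amalgams_map_of_same [Finite X] [Finite X'] (t : k) {S : Labelled (Option X)}
    {S' : Labelled X'} (hS : S.IsTree) (hS' : S'.IsTree) (j : X → X')
    (hr : S.restrict some = S'.restrict j) {x : X} (hx : S.same none (some x)) :
    treeMeasure t some S = ∑ W ∈ amalgams ⊤ (Option.map j) some S S', treeMeasure t some W := by
  have hset : amalgams ⊤ (Option.map j) some S S' = {S'.restrict fun o => o.elim (j x) id} := by
    ext W
    rw [mem_amalgams, inClass_top, Finset.mem_singleton]
    constructor
    · rintro ⟨hW, rfl, rfl⟩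
      refine (hW.restrict_eq_self (f := fun o => some (o.elim (j x) id)) ?_).symm
      rintro (_ | o)
      · exact hx
      · exact hW.inducedBy.same_refl _
    · rintro rfl
      refine ⟨hS'.restrict _, ?_, rfl⟩
      have h1 : S'.restrict ((fun o : Option X' => o.elim (j x) id) ∘ Option.map j) =
          (S'.restrict j).restrict (fun o => o.elim x id) := by
        rw [restrict_restrict]
        congr 1
        funext o
        cases o <;> rfl
      rw [restrict_restrict, h1, ← hr]
      refine hS.restrict_eq_self (f := fun o => some (o.elim x id)) ?_
      rintro (_ | o)
      · exact hx
      · exact hS.inducedBy.same_refl _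
  have h1 : treeMeasure t some (S'.restrict fun o : Option X' => o.elim (j x) id) = 1 := by
    refine treeMeasure_of_surjective t (hS'.restrict _) _ ?_
    rintro (_ | o)
    · exact ⟨j x, hS'.inducedBy.same_refl _⟩
    · exact ⟨o, hS'.inducedBy.same_refl _⟩
  rw [hset, Finset.sum_singleton, h1]
  refine treeMeasure_of_surjective t hS _ ?_
  rintro (_ | o)
  · exact ⟨x, hx⟩
  · exact ⟨o, hS.inducedBy.same_refl _⟩

/-- When `j` meets every leaf, the only amalgamation is `S` relabelled; factoring its measure in two
ways gives the equality. -/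
theorem sum_amalgams_map_of_surjective [Finite X] [Finite X'] (t : k) {S : Labelled (Option X)}
    {S' : Labelled X'} (hS : S.IsTree) (hS' : S'.IsTree) (j : X → X')
    (hr : S.restrict some = S'.restrict j) (hj : ∀ a, ∃ x, S'.same a (j x)) :
    treeMeasure t some S = ∑ W ∈ amalgams ⊤ (Option.map j) some S S', treeMeasure t some W := by
  have hone := treeMeasure_of_surjective t hS' j hj
  choose s hs using hj
  have hsS : ∀ x, S.same (some x) (some (s (j x))) := fun x =>
    (congrArg (fun Z : Labelled X => Z.same x (s (j x))) hr).mpr (hs (j x))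
  have hset : amalgams ⊤ (Option.map j) some S S' = {S.restrict (Option.map s)} := by
    ext W
    rw [mem_amalgams, inClass_top, Finset.mem_singleton]
    constructor
    · rintro ⟨hW, rfl, rfl⟩
      refine (hW.restrict_eq_self (f := Option.map j ∘ Option.map s) ?_).symm
      rintro (_ | o)
      · exact hW.inducedBy.same_refl _
      · exact hs o
    · rintro rfl
      refine ⟨hS.restrict _, ?_, ?_⟩
      · refine hS.restrict_eq_self (f := Option.map s ∘ Option.map j) ?_
        rintro (_ | o)
        · exact hS.inducedBy.same_refl _
        · exact hsS o
      · refine (congrArg (fun Z : Labelled X => Z.restrict s) hr).trans ?_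
        exact hS'.restrict_eq_self (f := j ∘ s) hs
  rw [hset, Finset.sum_singleton]
  have hW := hS.restrict (Option.map s)
  have hmem : S.restrict (Option.map s) ∈ amalgams ⊤ (Option.map j) some S S' := by
    rw [hset]; exact Finset.mem_singleton_self _
  obtain ⟨-, h1, h2⟩ := mem_amalgams.1 hmem
  have c1 := treeMeasure_comp t j some hW
  have c2 := treeMeasure_comp t some (Option.map j) hW
  rw [h2, hone, mul_one] at c1
  rw [h1, treeMeasure_of_surjective t hW (Option.map j), one_mul] at c2
  · rw [← c1, ← c2]
    rfl
  · rintro (_ | o)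
    · exact ⟨none, hW.inducedBy.same_refl _⟩
    · refine ⟨some (s o), ?_⟩
      exact (congrArg (fun Z : Labelled X' => Z.same o (j (s o))) h2).mpr (hs o)

/-- The amalgamation formula for a one-point extension and an arbitrary one. -/
theorem treeMeasure_amalgamation_extension {X X' : Type} [Finite X] [Finite X'] (t : k) (ht : IsUnit (t - 1))
    {S : Labelled (Option X)} {S' : Labelled X'} (hS : S.IsTree) (hS' : S'.IsTree) (j : X → X')
    (hr : S.restrict some = S'.restrict j) :
    treeMeasure t some S = ∑ W ∈ amalgams ⊤ (Option.map j) some S S', treeMeasure t some W := by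
  classical
  by_cases hf : ∀ x, ¬ S.same none (some x)
  swap
  · push Not at hf
    obtain ⟨x, hx⟩ := hf
    exact sum_amalgams_map_of_same t hS hS' j hr hx
  by_cases hj : ∀ a, ∃ x, S'.same a (j x)
  · exact sum_amalgams_map_of_surjective t hS hS' j hr hj
  push Not at hj
  obtain ⟨y, hy⟩ := hj
  -- Induction on the number of leaves missed by `j`: first amalgamate `S` with the single leaf `y`,
  -- then each result with all of `S'`. The second amalgamations are the fibres of restriction to
  -- the first.
  let j' : Option X → X' := fun o => o.elim y j
  have hmap : Option.map j' ∘ Option.map some = Option.map j := by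
    funext o
    cases o <;> rfl
  have hlt : {a | ∀ o, ¬ S'.same a (j' o)}.ncard < {a | ∀ x, ¬ S'.same a (j x)}.ncard := by
    refine Set.ncard_lt_ncard ⟨fun a ha x => ha (some x), fun hsub => ?_⟩ (Set.toFinite _)
    exact hsub (show y ∈ {a | ∀ x, ¬ S'.same a (j x)} from hy) none (hS'.inducedBy.same_refl y)
  rw [treeMeasure_amalgamation_extensions hS (hS'.restrict j') hf hy hr t ht]
  have hmaps : ∀ Z ∈ amalgams ⊤ (Option.map j) some S S', Z.restrict (Option.map j') ∈
      amalgams ⊤ (Option.map some) some S (S'.restrict j') := by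
    intro Z hZ
    rw [mem_amalgams] at hZ ⊢
    refine ⟨hZ.1.restrict _, ?_, ?_⟩
    · rw [restrict_restrict, hmap, hZ.2.1]
    · exact congrArg (fun Z => Z.restrict j') hZ.2.2
  rw [← Finset.sum_fiberwise_of_maps_to hmaps]
  refine Finset.sum_congr rfl fun W hW => ?_
  rw [mem_amalgams, inClass_top] at hW
  rw [treeMeasure_amalgamation_extension t ht hW.1 hS' j' hW.2.2]
  refine Finset.sum_congr ?_ fun _ _ => rfl
  ext Z
  rw [Finset.mem_filter, mem_amalgams, mem_amalgams]
  constructor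
  · rintro ⟨h1, h2, h3⟩
    refine ⟨⟨h1, ?_, h3⟩, h2⟩
    rw [← hmap, ← restrict_restrict, h2, hW.2.1]
  · rintro ⟨⟨h1, h2, h3⟩, h4⟩
    exact ⟨h1, h4, h3⟩
termination_by {a | ∀ x, ¬ S'.same a (j x)}.ncard

/-- The amalgamation formula. -/
theorem treeMeasure_amalgamation {X Y X' : Type} [Finite X] [Finite Y] [Finite X'] (t : k)
    (ht : IsUnit (t - 1))
    (i : X → Y) (j : X → X') {S : Labelled Y} {S' : Labelled X'} (hS : S.IsTree) (hS' : S'.IsTree)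
    (hr : S.restrict i = S'.restrict j) :
    treeMeasure t i S = ∑ Z ∈ pushouts ⊤ i j S S', treeMeasure t Sum.inr Z := by
  classical
  by_cases hi : ∀ a, ∃ x, S.same a (i x)
  · rw [treeMeasure_of_surjective t hS i hi]
    choose s hs using hi
    have hset : pushouts ⊤ i j S S' = {S'.restrict (Sum.elim (j ∘ s) id)} := by
      ext Z
      rw [mem_pushouts, inClass_top, Finset.mem_singleton]
      constructor
      · rintro ⟨hZ, rfl, rfl, hsame⟩
        refine (hZ.restrict_eq_self (f := Sum.inr ∘ Sum.elim (j ∘ s) id) ?_).symm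
        rintro (y | x)
        · exact hZ.inducedBy.same_trans (hs y) (hsame (s y))
        · exact hZ.inducedBy.same_refl _
      · rintro rfl
        refine ⟨hS'.restrict _, ?_, rfl, fun x => ?_⟩
        · refine (congrArg (fun Z : Labelled X => Z.restrict s) hr).symm.trans ?_
          exact hS.restrict_eq_self (f := i ∘ s) hs
        · refine (congrArg (fun Z : Labelled X => Z.same (s (i x)) x) hr).mp ?_
          exact hS.inducedBy.same_symm (hs (i x))
    rw [hset, Finset.sum_singleton]
    refine (treeMeasure_of_surjective t (hS'.restrict _) _ ?_).symm
    rintro (y | x)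
    · exact ⟨j (s y), hS'.inducedBy.same_refl _⟩
    · exact ⟨x, hS'.inducedBy.same_refl _⟩
  push Not at hi
  obtain ⟨y, hy⟩ := hi
  -- Induction on the number of leaves missed by `i`: the measure factors into the step adding `y`,
  -- covered by the one-leaf case, and the rest, which is amalgamated over each result of that step.
  let i' : Option X → Y := fun o => o.elim y i
  have hlt : {a | ∀ o, ¬ S.same a (i' o)}.ncard < {a | ∀ x, ¬ S.same a (i x)}.ncard := by
    refine Set.ncard_lt_ncard ⟨fun a ha x => ha (some x), fun hsub => ?_⟩ (Set.toFinite _)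
    exact hsub (show y ∈ {a | ∀ x, ¬ S.same a (i x)} from hy) none (hS.inducedBy.same_refl y)
  have hT := hS.restrict i'
  have hstep : treeMeasure t some (S.restrict i') =
      ∑ Z ∈ pushouts ⊤ some j (S.restrict i') S', treeMeasure t Sum.inr Z := by
    rw [treeMeasure_amalgamation_extension t ht hT hS' j hr]
    refine (sum_pushouts_eq t ⊤ some j (Option.map j) some _ S' ?_ (fun x => rfl) ?_).symm
    · rintro (_ | x)
      · exact ⟨Sum.inl none, rfl⟩
      · exact ⟨Sum.inr x, rfl⟩
    · intro Z hZ
      rw [mem_pushouts, inClass_top] at hZ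
      obtain ⟨hZ, -, -, hsame⟩ := hZ
      have h := hZ.inducedBy
      rintro ((_ | a) | a) ((_ | b) | b) hab
      · exact h.same_refl _
      · cases hab
      · cases hab
      · cases hab
      · have hab' : j a = j b := Option.some_injective _ hab
        have h1 := hsame a
        rw [hab'] at h1
        exact h.same_trans h1 (h.same_symm (hsame b))
      · have hab' : j a = b := Option.some_injective _ hab
        exact hab' ▸ hsame a
      · cases hab
      · have hab' : a = j b := Option.some_injective _ hab
        exact hab' ▸ h.same_symm (hsame b)
      · have hab' : a = b := Option.some_injective _ hab
        exact hab' ▸ h.same_refl _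
  have hmaps : ∀ Z ∈ pushouts ⊤ i j S S', Z.restrict (Sum.map i' id) ∈
      pushouts ⊤ some j (S.restrict i') S' := by
    intro Z hZ
    rw [mem_pushouts] at hZ ⊢
    refine ⟨hZ.1.restrict _, ?_, hZ.2.2.1, hZ.2.2.2⟩
    exact congrArg (fun Z => Z.restrict i') hZ.2.1
  have hcomp : treeMeasure t i S = treeMeasure t i' S * treeMeasure t some (S.restrict i') :=
    treeMeasure_comp t some i' hS
  rw [hcomp, hstep, Finset.mul_sum, ← Finset.sum_fiberwise_of_maps_to hmaps]
  refine Finset.sum_congr rfl fun Z₁ hZ₁ => ?_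
  rw [mem_pushouts, inClass_top] at hZ₁
  obtain ⟨hZ₁, h1, h2, h3⟩ := hZ₁
  rw [treeMeasure_amalgamation t ht i' Sum.inl hS hZ₁ h1.symm,
    sum_pushouts_eq t ⊤ i' Sum.inl Sum.inl (Sum.map i' id) S Z₁ ?_ (fun x => rfl) ?_,
    Finset.sum_mul]
  · refine Finset.sum_congr ?_ ?_
    · ext Z
      rw [Finset.mem_filter, mem_amalgams, mem_pushouts]
      constructor
      · rintro ⟨h4, h5, h6⟩
        refine ⟨⟨h4, h5, ?_, fun x => ?_⟩, h6⟩
        · rw [← h2, ← h6]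
          rfl
        · have := h3 x
          rw [← h6] at this
          exact this
      · rintro ⟨⟨h4, h5, -, -⟩, h6⟩
        exact ⟨h4, h5, h6⟩
    · intro Z hZ
      rw [Finset.mem_filter, mem_pushouts, inClass_top] at hZ
      rw [← hZ.2]
      exact (treeMeasure_comp t Sum.inr (Sum.map i' id) hZ.1.1).symm
  · rintro (y | x)
    · exact ⟨Sum.inl y, rfl⟩
    · exact ⟨Sum.inr (Sum.inr x), rfl⟩
  · intro Z hZ
    rw [mem_pushouts, inClass_top] at hZ
    obtain ⟨hZ, -, -, hsame⟩ := hZ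
    have h := hZ.inducedBy
    rintro (a | a | a) (b | b | b) hab
    · cases hab
      exact h.same_refl _
    · have hab' : a = i' b := Sum.inl_injective hab
      exact hab' ▸ hsame b
    · cases hab
    · have hab' : i' a = b := Sum.inl_injective hab
      exact hab' ▸ h.same_symm (hsame a)
    · have hab' : i' a = i' b := Sum.inl_injective hab
      have h1 := hsame a
      rw [hab'] at h1
      exact h.same_trans (h.same_symm h1) (hsame b)
    · cases hab
    · cases hab
    · cases hab
    · have hab' : a = b := Sum.inr_injective hab
      exact hab' ▸ h.same_refl _
termination_by {a | ∀ x, ¬ S.same a (i x)}.ncard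

theorem finsum_pushouts [Finite Y] [Finite X'] (N : ℕ∞) (i : X → Y) (j : X → X')
    (S : Labelled Y) (S' : Labelled X') (F : Labelled (Y ⊕ X') → k) :
    ∑ᶠ Z : {Z : Labelled (Y ⊕ X') // Z.InClass N ∧ Z.restrict Sum.inl = S ∧
      Z.restrict Sum.inr = S' ∧ ∀ x, Z.same (Sum.inl (i x)) (Sum.inr (j x))}, F Z.1 =
    ∑ Z ∈ pushouts N i j S S', F Z := by
  rw [pushouts, ← finsum_mem_eq_finite_toFinset_sum]
  exact finsum_set_coe_eq_finsum_mem {Z : Labelled (Y ⊕ X') | Z.InClass N ∧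
    Z.restrict Sum.inl = S ∧ Z.restrict Sum.inr = S' ∧
      ∀ x, Z.same (Sum.inl (i x)) (Sum.inr (j x))}

end Labelled

/-! ### The measure axioms and the normalisation. -/

section Measure

open Labelled

variable {k : Type u} [CommRing k]

theorem treeMeasure_isMeasure (t : k) (ht : IsUnit (t - 1)) : IsMeasure ⊤ (treeMeasure t) where
  iso g Z hZ h := treeMeasure_of_surjective t hZ.1 g h
  comp f g Z hZ := treeMeasure_comp t f g hZ.1
  amalgamation i j S S' hS hS' hr := by
    rw [treeMeasure_amalgamation t ht i j hS.1 hS'.1 hr]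
    exact (finsum_pushouts ⊤ i j S S' _).symm

/-- Compared with the formula for all trees, only terms of level above `n` are missing, and they
vanish by `treeMeasure_eq_zero`. -/
theorem treeMeasure_isMeasure_level (n : ℕ) (hn : 2 ≤ n) (ht : IsUnit ((n : k) - 1)) :
    IsMeasure (n : ℕ∞) (treeMeasure (n : k)) where
  iso g Z hZ h := treeMeasure_of_surjective _ hZ.1 g h
  comp f g Z hZ := treeMeasure_comp _ f g hZ.1
  amalgamation i j S S' hS hS' hr := by
    rw [treeMeasure_amalgamation _ ht i j hS.1 hS'.1 hr, finsum_pushouts]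
    symm
    refine Finset.sum_subset ?_ ?_
    · intro Z hZ
      rw [mem_pushouts] at hZ ⊢
      exact ⟨inClass_top.2 hZ.1.1, hZ.2⟩
    · intro Z hZ hZ'
      rw [mem_pushouts, inClass_top] at hZ
      refine treeMeasure_eq_zero n hn hZ.1 _ (hZ.2.2.1 ▸ hS') fun hh => hZ' ?_
      exact mem_pushouts.2 ⟨hh, hZ.2⟩

/-- The measure of the extension of a tree by a single leaf `y`. -/
theorem treeMeasure_eq_extensionWeight {I J : Type} [Finite I] [Finite J] (t : k)
    {Z : Labelled I} (hZ : Z.IsTree) (g : J → I) (y : I) (hy : ∀ x, ¬ Z.same y (g x))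
    (hcov : ∀ a, Z.same a y ∨ ∃ x, Z.same a (g x)) (h2 : ∃ a b, ¬ Z.same (g a) (g b)) :
    treeMeasure t g Z = extensionWeight t (classes (Z.restrict fun o => o.elim y g).attach) := by
  have hW := hZ.restrict (fun o : Option J => o.elim y g)
  rw [← treeMeasure_extension t hW hy h2]
  have hc := treeMeasure_comp t some (fun o : Option J => o.elim y g) hZ
  rw [treeMeasure_of_surjective t hZ (fun o : Option J => o.elim y g), one_mul] at hc
  · exact hc
  · intro a
    rcases hcov a with h | ⟨x, h⟩
    · exact ⟨none, h⟩
    · exact ⟨some x, h⟩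

/-- In both normalisations the leaf is attached in the middle of an edge, so the weight is the one
for two branches. -/
theorem treeMeasure_isPrimaryMeasure (t : k) (ht : IsUnit (t - 1)) :
    IsPrimaryMeasure t (treeMeasure t) where
  isMeasure := treeMeasure_isMeasure t ht
  star Z hZ hsame := by
    have hy : ∀ x : Fin 2, ¬ Z.same 2 (Fin.castSucc x) := by
      intro x hx
      rw [hsame] at hx
      revert hx
      revert x
      decide
    have h2 : ∃ a b : Fin 2, ¬ Z.same (Fin.castSucc a) (Fin.castSucc b) := by
      refine ⟨0, 1, fun hx => ?_⟩
      rw [hsame] at hx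
      revert hx
      decide
    have hW := hZ.restrict (fun o : Option (Fin 2) => o.elim 2 Fin.castSucc)
    have hp := attach_isPos hW h2 hy
    have hc := (two_le_classes hp.equivalence).2 (exists_not_attach hW h2 hy)
    have hc3 : ¬ 3 ≤ classes (Z.restrict fun o : Option (Fin 2) =>
        o.elim 2 Fin.castSucc).attach := by
      rw [three_le_classes hp.equivalence]
      rintro ⟨a, b, c, hab, hac, hbc⟩
      have hne : ∀ {a b}, ¬ (Z.restrict fun o : Option (Fin 2) =>
          o.elim 2 Fin.castSucc).attach a b → a ≠ b := fun h he => h (he ▸ hp.refl _)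
      have h1 := hne hab
      have h2 := hne hac
      have h3 := hne hbc
      omega
    rw [treeMeasure_eq_extensionWeight t hZ Fin.castSucc 2 hy ?_ h2,
      show classes _ = 2 by omega, extensionWeight, if_pos rfl]
    intro a
    simp only [hsame]
    revert a
    decide
  quartet Z hZ hsame hrel := by
    have hy : ∀ x : Fin 3, ¬ Z.same 3 (Fin.castSucc x) := by
      intro x hx
      rw [hsame] at hx
      revert hx
      revert x
      decide
    have h2 : ∃ a b : Fin 3, ¬ Z.same (Fin.castSucc a) (Fin.castSucc b) := by
      refine ⟨0, 1, fun hx => ?_⟩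
      rw [hsame] at hx
      revert hx
      decide
    have hW := hZ.restrict (fun o : Option (Fin 3) => o.elim 3 Fin.castSucc)
    have hp := attach_isPos hW h2 hy
    have hc := (two_le_classes hp.equivalence).2 (exists_not_attach hW h2 hy)
    have hc3 : ¬ 3 ≤ classes (Z.restrict fun o : Option (Fin 3) =>
        o.elim 3 Fin.castSucc).attach := by
      rw [three_le_classes hp.equivalence]
      rintro ⟨a, b, c, hab, hac, hbc⟩
      have hall : ∀ x y : Fin 3, x ≠ y → ¬ (Z.restrict fun o : Option (Fin 3) =>
          o.elim 3 Fin.castSucc).attach x y := by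
        have hne : ∀ {a b}, ¬ (Z.restrict fun o : Option (Fin 3) =>
          o.elim 3 Fin.castSucc).attach a b → a ≠ b := fun h he => h (he ▸ hp.refl _)
        have h1 := hne hab
        have h2 := hne hac
        have h3 := hne hbc
        have hcov : ∀ x : Fin 3, x = a ∨ x = b ∨ x = c := by omega
        intro x y hxy hatt
        rcases hcov x with rfl | rfl | rfl <;> rcases hcov y with rfl | rfl | rfl
        · exact hxy rfl
        · exact hab hatt
        · exact hac hatt
        · exact hab (hp.symm hatt)
        · exact hxy rfl
        · exact hbc hatt
        · exact hac (hp.symm hatt)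
        · exact hbc (hp.symm hatt)
        · exact hxy rfl
      have h := hZ.inducedBy
      -- The edge shared by the paths `0—1` and `2—3` gives the split `02|13` or `03|12`; either
      -- puts two of the leaves `0, 1, 2` into one branch where `3` is attached.
      rcases (h.rel_iff_sep.1 hrel).2 with hs | hs
      · exact hall 0 2 (by decide) ⟨1, h.sep_comm (h.sep_swap (h.sep_comm hs))⟩
      · exact hall 1 2 (by decide) ⟨0, h.sep_comm (h.sep_swap hs)⟩
    rw [treeMeasure_eq_extensionWeight t hZ Fin.castSucc 3 hy ?_ h2,
      show classes _ = 2 by omega, extensionWeight, if_pos rfl]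
    intro a
    simp only [hsame]
    revert a
    decide

end Measure

end Arboreal

namespace Arboreal

universe u

/-! ### Associativity and units -/

namespace Labelled

variable {I J E R P Q W : Type} {k : Type u} [CommRing k]

/-- The trees of level `≤ N` on the label set `W` that satisfy `p`. -/
noncomputable def treesWith [Finite W] (N : ℕ∞) (p : Labelled W → Prop) : Finset (Labelled W) :=
  (Set.toFinite {Z : Labelled W | Z.InClass N ∧ p Z}).toFinset

@[simp] theorem mem_treesWith [Finite W] {N : ℕ∞} {p : Labelled W → Prop} {Z : Labelled W} :
    Z ∈ treesWith N p ↔ Z.InClass N ∧ p Z := by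
  simp [treesWith]

/-- The amalgamation axiom with the disjoint union of label sets replaced by their pushout `W`;
`hpull` says that labels are identified only along `R`. -/
theorem measure_amalgamation_labels [Finite R] [Finite P] [Finite Q] [Finite W] {t : k} {N : ℕ∞}
    (hμ : IsMeasure N (treeMeasure t)) {i : R → P} {j : R → Q} {u : P → W} {v : Q → W}
    (hu : Function.Injective u) (hv : Function.Injective v)
    (hsurj : Function.Surjective (Sum.elim u v)) (hij : ∀ x, u (i x) = v (j x))
    (hpull : ∀ a b, u a = v b → ∃ x, i x = a ∧ j x = b) {S : Labelled P} {S' : Labelled Q}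
    (hS : S.InClass N) (hS' : S'.InClass N) (hr : S.restrict i = S'.restrict j) :
    treeMeasure t i S = ∑ Z ∈ amalgams N u v S S', treeMeasure t v Z := by
  rw [hμ.amalgamation i j S S' hS hS' hr, finsum_pushouts]
  refine sum_pushouts_eq t N i j u v S S' hsurj hij ?_
  intro Z hZ
  obtain ⟨hZ, -, -, hsame⟩ := mem_pushouts.1 hZ
  have h := hZ.1.inducedBy
  rintro (a | a) (b | b) hab
  · exact hu hab ▸ h.same_refl _
  · obtain ⟨x, rfl, rfl⟩ := hpull a b hab
    exact hsame x
  · obtain ⟨x, rfl, rfl⟩ := hpull b a hab.symm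
    exact h.same_symm (hsame x)
  · exact hv hab ▸ h.same_refl _

/-- The amalgamation axiom turns `μ(A → Z₁)` into the sum of `μ(Z₂ → Z)` over the trees `Z` gluing
`Z₁` and `Z₂` along `A`, and multiplicativity absorbs the second factor. As `Z` determines `Z₁`,
`Z₂` and `A`, the whole sum runs over `Z` alone. -/
theorem sum_measure_mul_measure {X Y : TreeStructure} [Finite P] [Finite Q] [Finite W] [Finite E]
    {t : k} {N : ℕ∞} (hμ : IsMeasure N (treeMeasure t)) {i : X ⊕ Y → P} {j : X ⊕ Y → Q}
    {u : P → W} {v : Q → W} (hu : Function.Injective u) (hv : Function.Injective v)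
    (hsurj : Function.Surjective (Sum.elim u v)) (hij : ∀ x, u (i x) = v (j x))
    (hpull : ∀ a b, u a = v b → ∃ x, i x = a ∧ j x = b) (e : E → Q) (p : Labelled P → Prop)
    (q : Labelled Q → Prop) (hp : ∀ Z, p Z → Z.restrict (i ∘ Sum.inl) = X.toLabelled ∧
      Z.restrict (i ∘ Sum.inr) = Y.toLabelled) :
    ∑ A : Amalg N X Y, (∑ Z ∈ treesWith N fun Z => p Z ∧ Z.restrict i = A.1, treeMeasure t i Z) *
        (∑ Z ∈ treesWith N fun Z => q Z ∧ Z.restrict j = A.1, treeMeasure t e Z) =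
      ∑ Z ∈ treesWith N fun Z => p (Z.restrict u) ∧ q (Z.restrict v), treeMeasure t (v ∘ e) Z := by
  have hstep : ∀ A : Amalg N X Y,
      (∑ Z ∈ treesWith N fun Z => p Z ∧ Z.restrict i = A.1, treeMeasure t i Z) *
        (∑ Z ∈ treesWith N fun Z => q Z ∧ Z.restrict j = A.1, treeMeasure t e Z) =
      ∑ Z₁ ∈ treesWith N fun Z => p Z ∧ Z.restrict i = A.1,
        ∑ Z₂ ∈ treesWith N fun Z => q Z ∧ Z.restrict j = A.1,
          ∑ Z ∈ amalgams N u v Z₁ Z₂, treeMeasure t (v ∘ e) Z := by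
    intro A
    rw [Finset.sum_mul_sum]
    refine Finset.sum_congr rfl fun Z₁ h₁ => Finset.sum_congr rfl fun Z₂ h₂ => ?_
    rw [mem_treesWith] at h₁ h₂
    rw [measure_amalgamation_labels hμ hu hv hsurj hij hpull h₁.1 h₂.1
      (h₁.2.2.trans h₂.2.2.symm), Finset.sum_mul]
    refine Finset.sum_congr rfl fun Z hZ => ?_
    rw [mem_amalgams] at hZ
    rw [← hZ.2.2]
    exact (treeMeasure_comp t e v hZ.1.1).symm
  simp only [hstep, Finset.sum_sigma']
  refine Finset.sum_bij (fun x _ => x.2.2.2) ?_ ?_ ?_ fun _ _ => rfl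
  · rintro ⟨A, Z₁, Z₂, Z⟩ hx
    simp only [Finset.mem_sigma, mem_treesWith, mem_amalgams] at hx
    obtain ⟨-, ⟨-, h1, -⟩, ⟨-, h2, -⟩, h3, rfl, rfl⟩ := hx
    exact mem_treesWith.2 ⟨h3, h1, h2⟩
  · rintro ⟨⟨A, hA⟩, Z₁, Z₂, Z⟩ hx ⟨⟨A', hA'⟩, Z₁', Z₂', Z'⟩ hx' hZ
    simp only [Finset.mem_sigma, mem_treesWith, mem_amalgams] at hx hx'
    obtain ⟨-, ⟨-, -, rfl⟩, -, -, rfl, rfl⟩ := hx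
    obtain ⟨-, ⟨-, -, rfl⟩, -, -, rfl, rfl⟩ := hx'
    obtain rfl : Z = Z' := hZ
    rfl
  · intro Z hZ
    obtain ⟨hZ, h1, h2⟩ := mem_treesWith.1 hZ
    have h3 := hp _ h1
    have h4 : (Z.restrict v).restrict j = (Z.restrict u).restrict i := by
      rw [restrict_restrict, restrict_restrict, show u ∘ i = v ∘ j from funext hij]
    refine ⟨⟨⟨(Z.restrict u).restrict i, (hZ.restrict u).restrict i, h3⟩, Z.restrict u,
      Z.restrict v, Z⟩, ?_, rfl⟩
    simp only [Finset.mem_sigma, mem_treesWith, mem_amalgams, and_true]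
    exact ⟨Finset.mem_univ _, ⟨hZ.restrict u, h1⟩, ⟨hZ.restrict v, h2, h4⟩, hZ⟩

end Labelled

open Labelled

variable {k : Type u} [CommRing k] {N : ℕ∞} {t : k}

theorem structureConstant_eq {X₁ X₂ X₃ : TreeStructure} (Y₁ : Amalg N X₁ X₂) (Y₂ : Amalg N X₂ X₃)
    (Y₃ : Amalg N X₁ X₃) : structureConstant t Y₁ Y₂ Y₃ =
      ∑ Z ∈ treesWith N fun Z : Labelled (X₁ ⊕ X₂ ⊕ X₃) => Z.restrict lab12 = Y₁.1 ∧
        Z.restrict lab23 = Y₂.1 ∧ Z.restrict lab13 = Y₃.1, treeMeasure t lab13 Z := by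
  rw [structureConstant]
  refine Finset.sum_bij (fun Z _ => Z.1) (fun Z _ => mem_treesWith.2 Z.2)
    (fun _ _ _ _ => Subtype.ext) (fun Z hZ => ?_) fun _ _ => rfl
  exact ⟨⟨Z, mem_treesWith.1 hZ⟩, Finset.mem_univ _, rfl⟩

/-- Both sides are a sum over amalgamations of all four trees with the pairs 12, 23, 34 and 14
prescribed. On the left the triples 234 and 124 are glued along 24, on the right 123 and 134 along
13. -/
theorem sum_structureConstant_mul (hμ : IsMeasure N (treeMeasure t)) {X₁ X₂ X₃ X₄ : TreeStructure}
    (Y₁ : Amalg N X₁ X₂) (Y₂ : Amalg N X₂ X₃) (Y₃ : Amalg N X₃ X₄) (Y : Amalg N X₁ X₄) :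
    ∑ A : Amalg N X₂ X₄, structureConstant t Y₂ Y₃ A * structureConstant t Y₁ A Y =
      ∑ A : Amalg N X₁ X₃, structureConstant t Y₁ Y₂ A * structureConstant t A Y₃ Y := by
  have hL := sum_measure_mul_measure hμ (X := X₂) (Y := X₄)
    (i := (lab13 : X₂ ⊕ X₄ → X₂ ⊕ X₃ ⊕ X₄)) (j := (lab23 : _ → X₁ ⊕ X₂ ⊕ X₄))
    (u := (lab23 : _ → X₁ ⊕ X₂ ⊕ X₃ ⊕ X₄)) (v := Sum.map id lab13)
    Sum.inr_injective (Sum.map_injective.2 ⟨Function.injective_id,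
      Sum.map_injective.2 ⟨Function.injective_id, Sum.inr_injective⟩⟩)
    (by
      rintro (x | x | x | x)
      · exact ⟨Sum.inr (Sum.inl x), rfl⟩
      · exact ⟨Sum.inl (Sum.inl x), rfl⟩
      · exact ⟨Sum.inl (Sum.inr (Sum.inl x)), rfl⟩
      · exact ⟨Sum.inl (Sum.inr (Sum.inr x)), rfl⟩)
    (by rintro (x | x) <;> rfl)
    (by
      rintro (a | a | a) (b | b | b) hab <;> cases hab
      · exact ⟨Sum.inl _, rfl, rfl⟩
      · exact ⟨Sum.inr _, rfl, rfl⟩)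
    (lab13 : X₁ ⊕ X₄ → X₁ ⊕ X₂ ⊕ X₄)
    (fun Z => Z.restrict lab12 = Y₂.1 ∧ Z.restrict lab23 = Y₃.1)
    (fun Z => Z.restrict lab12 = Y₁.1 ∧ Z.restrict lab13 = Y.1)
    (fun Z hZ => ⟨(congrArg (fun Z => Z.restrict Sum.inl) hZ.1).trans Y₂.2.2.1,
      (congrArg (fun Z => Z.restrict Sum.inr) hZ.2).trans Y₃.2.2.2⟩)
  have hR := sum_measure_mul_measure hμ (X := X₁) (Y := X₃)
    (i := (lab13 : X₁ ⊕ X₃ → X₁ ⊕ X₂ ⊕ X₃)) (j := (lab12 : _ → X₁ ⊕ X₃ ⊕ X₄))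
    (u := Sum.map id lab12) (v := (lab13 : _ → X₁ ⊕ X₂ ⊕ X₃ ⊕ X₄))
    (Sum.map_injective.2 ⟨Function.injective_id,
      Sum.map_injective.2 ⟨Function.injective_id, Sum.inl_injective⟩⟩)
    (Sum.map_injective.2 ⟨Function.injective_id, Sum.inr_injective⟩)
    (by
      rintro (x | x | x | x)
      · exact ⟨Sum.inl (Sum.inl x), rfl⟩
      · exact ⟨Sum.inl (Sum.inr (Sum.inl x)), rfl⟩
      · exact ⟨Sum.inl (Sum.inr (Sum.inr x)), rfl⟩
      · exact ⟨Sum.inr (Sum.inr (Sum.inr x)), rfl⟩)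
    (by rintro (x | x) <;> rfl)
    (by
      rintro (a | a | a) (b | b | b) hab <;> cases hab
      · exact ⟨Sum.inl _, rfl, rfl⟩
      · exact ⟨Sum.inr _, rfl, rfl⟩)
    (lab13 : X₁ ⊕ X₄ → X₁ ⊕ X₃ ⊕ X₄)
    (fun Z => Z.restrict lab12 = Y₁.1 ∧ Z.restrict lab23 = Y₂.1)
    (fun Z => Z.restrict lab23 = Y₃.1 ∧ Z.restrict lab13 = Y.1)
    (fun Z hZ => ⟨(congrArg (fun Z => Z.restrict Sum.inl) hZ.1).trans Y₁.2.2.1,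
      (congrArg (fun Z => Z.restrict Sum.inr) hZ.2).trans Y₂.2.2.2⟩)
  simp only [restrict_restrict] at hL hR
  have e12 : (Sum.map id lab13 : X₁ ⊕ X₂ ⊕ X₄ → X₁ ⊕ X₂ ⊕ X₃ ⊕ X₄) ∘ lab12 =
      Sum.map id lab12 ∘ lab12 := by
    funext x
    rcases x with x | x <;> rfl
  have e23 : (lab23 : X₂ ⊕ X₃ ⊕ X₄ → X₁ ⊕ X₂ ⊕ X₃ ⊕ X₄) ∘ lab12 =
      Sum.map id lab12 ∘ lab23 := by
    funext x
    rcases x with x | x <;> rfl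
  have e34 : (lab23 : X₂ ⊕ X₃ ⊕ X₄ → X₁ ⊕ X₂ ⊕ X₃ ⊕ X₄) ∘ lab23 = lab13 ∘ lab23 := by
    funext x
    rcases x with x | x <;> rfl
  have e14 : (Sum.map id lab13 : X₁ ⊕ X₂ ⊕ X₄ → X₁ ⊕ X₂ ⊕ X₃ ⊕ X₄) ∘ lab13 = lab13 ∘ lab13 := by
    funext x
    rcases x with x | x <;> rfl
  rw [e12, e23, e34, e14] at hL
  simp only [structureConstant_eq]
  refine Eq.trans ?_ (hL.trans (Eq.trans ?_ (hR.symm.trans ?_)))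
  · refine Finset.sum_congr rfl fun A _ => ?_
    congr! 4 <;> tauto
  · congr! 2
    funext Z
    exact propext (by tauto)
  · refine Finset.sum_congr rfl fun A _ => ?_
    congr! 4 <;> tauto

theorem Amalg.IsIdentity.eq {X : TreeStructure} {I : Amalg N X X} (hI : I.IsIdentity) :
    I.1 = X.toLabelled.restrict (Sum.elim id id) := by
  have h : I.1.restrict (Sum.inl ∘ Sum.elim id id) = I.1 := by
    refine I.2.1.1.restrict_eq_self ?_
    rintro (x | x)
    · exact I.2.1.1.inducedBy.same_refl _
    · exact I.2.1.1.inducedBy.same_symm (hI x)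
  rw [← h, ← restrict_restrict, I.2.2.1]

theorem Amalg.exists_isIdentity {X : TreeStructure} (hX : X.toLabelled.InClass N) :
    ∃ I : Amalg N X X, I.IsIdentity :=
  ⟨⟨X.toLabelled.restrict (Sum.elim id id), hX.restrict _, rfl, rfl⟩, fun _ => rfl⟩

theorem Amalg.inClass_left {X Y : TreeStructure} (A : Amalg N X Y) : X.toLabelled.InClass N :=
  A.2.2.1 ▸ A.2.1.restrict Sum.inl

theorem Amalg.inClass_right {X Y : TreeStructure} (A : Amalg N X Y) : Y.toLabelled.InClass N :=
  A.2.2.2 ▸ A.2.1.restrict Sum.inr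

open Classical in
-- In every triple over the identity the first two trees are glued label by label, so `A` determines
-- the triple, and its outer pair is again `A`.
theorem structureConstant_identity_left {X Y : TreeStructure} {I : Amalg N X X}
    (hI : I.IsIdentity) (A A' : Amalg N X Y) :
    structureConstant t I A A' = if A = A' then 1 else 0 := by
  have hsame : ∀ Z : Labelled (X ⊕ X ⊕ Y), Z.restrict lab12 = I.1 →
      ∀ x, Z.same (Sum.inl x) (Sum.inr (Sum.inl x)) := by
    intro Z hZ x
    have := hI x
    rw [← hZ] at this
    exact this
  rw [structureConstant_eq]
  split_ifs with hA
  · subst hA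
    have hs : A.1.restrict (Sum.elim Sum.inl id) ∈ treesWith N fun Z : Labelled (X ⊕ X ⊕ Y) =>
        Z.restrict lab12 = I.1 ∧ Z.restrict lab23 = A.1 ∧ Z.restrict lab13 = A.1 := by
      refine mem_treesWith.2 ⟨A.2.1.restrict _, ?_, rfl, ?_⟩
      · refine Eq.trans ?_ ((congrArg (fun Z => Z.restrict (Sum.elim id id)) A.2.2.1).trans
          hI.eq.symm)
        rw [restrict_restrict, restrict_restrict]
        congr 1
        funext x
        rcases x with x | x <;> rfl
      · rw [restrict_restrict, show Sum.elim Sum.inl id ∘ lab13 = id by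
          funext x
          rcases x with x | x <;> rfl]
        rfl
    rw [Finset.sum_eq_single_of_mem _ hs]
    · refine treeMeasure_of_surjective t (A.2.1.1.restrict _) _ ?_
      have h := A.2.1.1.inducedBy
      rintro (x | x | x)
      · exact ⟨Sum.inl x, h.same_refl _⟩
      · exact ⟨Sum.inl x, h.same_refl _⟩
      · exact ⟨Sum.inr x, h.same_refl _⟩
    · intro Z hZ hne
      obtain ⟨hZ, h1, h2, -⟩ := mem_treesWith.1 hZ
      refine absurd ?_ hne
      rw [← h2]
      refine (hZ.1.restrict_eq_self (f := lab23 ∘ Sum.elim Sum.inl id) ?_).symm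
      rintro (x | x)
      · exact hsame Z h1 x
      · exact hZ.1.inducedBy.same_refl _
  · refine Finset.sum_eq_zero fun Z hZ => absurd ?_ hA
    obtain ⟨hZ, h1, h2, h3⟩ := mem_treesWith.1 hZ
    refine Subtype.ext ?_
    rw [← h2, ← h3]
    refine hZ.1.restrict_eq_of_same ?_
    rintro (x | x)
    · exact hZ.1.inducedBy.same_symm (hsame Z h1 x)
    · exact hZ.1.inducedBy.same_refl _

open Classical in
theorem structureConstant_identity_right {X Y : TreeStructure} {I : Amalg N Y Y}
    (hI : I.IsIdentity) (A A' : Amalg N X Y) :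
    structureConstant t A I A' = if A = A' then 1 else 0 := by
  have hsame : ∀ Z : Labelled (X ⊕ Y ⊕ Y), Z.restrict lab23 = I.1 →
      ∀ x, Z.same (Sum.inr (Sum.inl x)) (Sum.inr (Sum.inr x)) := by
    intro Z hZ x
    have := hI x
    rw [← hZ] at this
    exact this
  rw [structureConstant_eq]
  split_ifs with hA
  · subst hA
    have hs : A.1.restrict (Sum.map id (Sum.elim id id)) ∈ treesWith N
        fun Z : Labelled (X ⊕ Y ⊕ Y) =>
        Z.restrict lab12 = A.1 ∧ Z.restrict lab23 = I.1 ∧ Z.restrict lab13 = A.1 := by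
      refine mem_treesWith.2 ⟨A.2.1.restrict _, ?_, ?_, ?_⟩
      · rw [restrict_restrict, show Sum.map id (Sum.elim id id) ∘ lab12 = id by
          funext x
          rcases x with x | x <;> rfl]
        rfl
      · exact (congrArg (fun Z => Z.restrict (Sum.elim id id)) A.2.2.2).trans hI.eq.symm
      · rw [restrict_restrict, show Sum.map id (Sum.elim id id) ∘ lab13 = id by
          funext x
          rcases x with x | x <;> rfl]
        rfl
    rw [Finset.sum_eq_single_of_mem _ hs]
    · refine treeMeasure_of_surjective t (A.2.1.1.restrict _) _ ?_
      have h := A.2.1.1.inducedBy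
      rintro (x | x | x)
      · exact ⟨Sum.inl x, h.same_refl _⟩
      · exact ⟨Sum.inr x, h.same_refl _⟩
      · exact ⟨Sum.inr x, h.same_refl _⟩
    · intro Z hZ hne
      obtain ⟨hZ, -, h2, h3⟩ := mem_treesWith.1 hZ
      refine absurd ?_ hne
      rw [← h3]
      refine (hZ.1.restrict_eq_self (f := lab13 ∘ Sum.map id (Sum.elim id id)) ?_).symm
      rintro (x | x | x)
      · exact hZ.1.inducedBy.same_refl _
      · exact hsame Z h2 x
      · exact hZ.1.inducedBy.same_refl _
  · refine Finset.sum_eq_zero fun Z hZ => absurd ?_ hA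
    obtain ⟨hZ, h1, h2, h3⟩ := mem_treesWith.1 hZ
    refine Subtype.ext ?_
    rw [← h1, ← h3]
    refine hZ.1.restrict_eq_of_same ?_
    rintro (x | x)
    · exact hZ.1.inducedBy.same_refl _
    · exact hsame Z h2 x

namespace ArborealAlgebra

variable {ι : Type} [Fintype ι] {T : ι → TreeStructure}

theorem mul_apply (f g : ArborealAlgebra N t T) (i l : ι) (Y : Amalg N (T i) (T l)) :
    (f * g) i l Y = ∑ j, ∑ Y₁ : Amalg N (T i) (T j), ∑ Y₂ : Amalg N (T j) (T l),
      f j l Y₂ * g i j Y₁ * structureConstant t Y₁ Y₂ Y := rfl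

open Classical in
omit [Fintype ι] in
theorem one_apply_self (i : ι) (Z : Amalg N (T i) (T i)) :
    (1 : ArborealAlgebra N t T) i i Z = if Z.IsIdentity then (1 : k) else 0 := by
  change (Pi.single i (fun Z : Amalg N (T i) (T i) => if Z.IsIdentity then (1 : k) else 0) :
    ∀ j, Amalg N (T i) (T j) → k) i Z = _
  rw [Pi.single_eq_same]

omit [Fintype ι] in
theorem one_apply_of_ne {i j : ι} (h : i ≠ j) (Z : Amalg N (T i) (T j)) :
    (1 : ArborealAlgebra N t T) i j Z = 0 := by
  classical
  change (Pi.single i (fun Z : Amalg N (T i) (T i) => if Z.IsIdentity then (1 : k) else 0) :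
    ∀ j, Amalg N (T i) (T j) → k) j Z = _
  rw [Pi.single_eq_of_ne h.symm]
  rfl

theorem sum_rotate {α β γ : Type} [Fintype α] [Fintype β] [Fintype γ] (f : α → β → γ → k) :
    ∑ a, ∑ b, ∑ c, f a b c = ∑ c, ∑ a, ∑ b, f a b c := by
  rw [Finset.sum_comm]
  simp only [Finset.sum_comm (s := (Finset.univ : Finset γ))]
  exact Finset.sum_comm

theorem isUnitalAssociative (hμ : IsMeasure N (treeMeasure t)) :
    IsUnitalAssociative (ArborealAlgebra N t T) where
  mul_assoc f g h := by
    funext i l Y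
    simp only [mul_apply, Finset.mul_sum, Finset.sum_mul]
    -- The sum over the intermediate amalgamation is moved inside, where `sum_structureConstant_mul`
    -- applies.
    trans ∑ j, ∑ Y₁ : Amalg N (T i) (T j), ∑ m, ∑ Y₂ : Amalg N (T j) (T m),
      ∑ Y₃ : Amalg N (T m) (T l), f m l Y₃ * g j m Y₂ * h i j Y₁ *
        ∑ A : Amalg N (T j) (T l), structureConstant t Y₂ Y₃ A * structureConstant t Y₁ A Y
    · refine Finset.sum_congr rfl fun j _ => Finset.sum_congr rfl fun Y₁ _ => ?_
      rw [Finset.sum_comm]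
      refine Finset.sum_congr rfl fun m _ => ?_
      rw [← sum_rotate]
      refine Finset.sum_congr rfl fun Y₂ _ => Finset.sum_congr rfl fun Y₃ _ => ?_
      rw [Finset.mul_sum]
      exact Finset.sum_congr rfl fun A _ => by ring
    simp only [sum_structureConstant_mul hμ]
    symm
    trans ∑ m, ∑ j, ∑ Y₁ : Amalg N (T i) (T j), ∑ Y₂ : Amalg N (T j) (T m),
      ∑ Y₃ : Amalg N (T m) (T l), f m l Y₃ * g j m Y₂ * h i j Y₁ *
        ∑ A : Amalg N (T i) (T m), structureConstant t Y₁ Y₂ A * structureConstant t A Y₃ Y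
    · refine Finset.sum_congr rfl fun m _ => ?_
      rw [sum_rotate]
      refine Finset.sum_congr rfl fun j _ => ?_
      rw [sum_rotate]
      refine Finset.sum_congr rfl fun Y₁ _ => ?_
      rw [sum_rotate]
      refine Finset.sum_congr rfl fun Y₂ _ => ?_
      rw [Finset.sum_comm]
      refine Finset.sum_congr rfl fun Y₃ _ => ?_
      rw [Finset.mul_sum]
      exact Finset.sum_congr rfl fun A _ => by ring
    rw [Finset.sum_comm]
    exact Finset.sum_congr rfl fun j _ => Finset.sum_comm
  one_mul f := by
    classical
    funext i l Y
    obtain ⟨I, hI⟩ := Amalg.exists_isIdentity Y.inClass_right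
    rw [mul_apply, Finset.sum_eq_single_of_mem l (Finset.mem_univ _)]
    · rw [Finset.sum_eq_single_of_mem Y (Finset.mem_univ _),
        Finset.sum_eq_single_of_mem I (Finset.mem_univ _)]
      · rw [one_apply_self, if_pos hI, structureConstant_identity_right hI, if_pos rfl, one_mul,
          mul_one]
      · intro J _ hJ
        rw [one_apply_self, if_neg, zero_mul, zero_mul]
        exact fun hJ' => hJ (Subtype.ext (hJ'.eq.trans hI.eq.symm))
      · intro A _ hA
        refine Finset.sum_eq_zero fun J _ => ?_
        rw [one_apply_self]
        split_ifs with hJ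
        · rw [structureConstant_identity_right hJ, if_neg hA, mul_zero]
        · rw [zero_mul, zero_mul]
    · intro j _ hj
      refine Finset.sum_eq_zero fun _ _ => Finset.sum_eq_zero fun _ _ => ?_
      rw [one_apply_of_ne hj, zero_mul, zero_mul]
  mul_one f := by
    classical
    funext i l Y
    obtain ⟨I, hI⟩ := Amalg.exists_isIdentity Y.inClass_left
    rw [mul_apply, Finset.sum_eq_single_of_mem i (Finset.mem_univ _)]
    · rw [Finset.sum_eq_single_of_mem I (Finset.mem_univ _),
        Finset.sum_eq_single_of_mem Y (Finset.mem_univ _)]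
      · rw [one_apply_self, if_pos hI, structureConstant_identity_left hI, if_pos rfl, mul_one,
          mul_one]
      · intro A _ hA
        rw [structureConstant_identity_left hI, if_neg hA, mul_zero]
      · intro J _ hJ
        refine Finset.sum_eq_zero fun A _ => ?_
        rw [one_apply_self, if_neg, mul_zero, zero_mul]
        exact fun hJ' => hJ (Subtype.ext (hJ'.eq.trans hI.eq.symm))
    · intro j _ hj
      refine Finset.sum_eq_zero fun _ _ => Finset.sum_eq_zero fun _ _ => ?_
      rw [one_apply_of_ne hj.symm, mul_zero, zero_mul]

end ArborealAlgebra

end Arboreal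

namespace Arboreal

universe u

/-! ### Amalgamations of trees of small level -/

namespace Labelled

/-- Every class contains a label from `I` or from `J`. -/
theorem classes_sum_le {I J : Type} [Finite I] [Finite J] {p : I ⊕ J → I ⊕ J → Prop}
    (hp : Equivalence p) : classes p ≤ classes (fun a b => p (Sum.inl a) (Sum.inl b)) +
      classes (fun a b => p (Sum.inr a) (Sum.inr b)) := by
  have key : ∀ {K : Type} [Finite K] (g : K → I ⊕ J),
      (Set.range (p ∘ g)).ncard ≤ classes (fun a b => p (g a) (g b)) := by
    intro K _ g
    refine Set.ncard_le_ncard_of_injOn (fun r => r ∘ g) ?_ ?_ (Set.toFinite _)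
    · rintro _ ⟨a, rfl⟩
      exact ⟨a, rfl⟩
    · rintro _ ⟨a, rfl⟩ _ ⟨b, rfl⟩ hab
      refine (row_eq_iff hp).2 ?_
      have := congrFun hab b
      exact this.mpr (hp.refl _)
  have hunion : Set.range p = Set.range (p ∘ Sum.inl) ∪ Set.range (p ∘ Sum.inr) := by
    rw [← Set.Sum.elim_range, Sum.elim_comp_inl_inr]
  rw [classes, hunion]
  exact (Set.ncard_union_le _ _).trans (add_le_add (key _) (key _))

end Labelled

open Labelled

namespace TreeStructure

variable (X : TreeStructure)

theorem inClass_iff_level_le {n : ℕ} : X.toLabelled.InClass n ↔ X.level ≤ n :=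
  ⟨fun h => by exact_mod_cast h.2, fun h => ⟨X.isTree, by exact_mod_cast h⟩⟩

/-- Nodes are bounded by the level. A point with at most two branches is harmless for `n ≥ 4`. For
`n = 3` the level is at most one, so there are no nodes and at most two leaves; two being excluded,
there is at most one class. -/
theorem two_mul_classes_le {n : ℕ} (hn : 3 ≤ n) (hX : 2 * X.level ≤ n)
    (h3 : n = 3 → Nat.card X ≠ 2) {p : X → X → Prop} (hp : X.toLabelled.IsPos p) :
    2 * classes p ≤ n := by
  have hlevel := (X.isTree.level_le_iff (N := X.level)).1 le_rfl
  by_cases hc : 3 ≤ classes p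
  · have := hlevel p ⟨hp, (three_le_classes hp.equivalence).1 hc⟩
    omega
  by_cases hn3 : n = 3
  · have hcard : Nat.card X ≤ 2 := by
      by_contra hcard
      rw [not_le, ← Set.ncard_univ, Set.two_lt_ncard_iff (Set.toFinite _)] at hcard
      obtain ⟨a, b, c, -, -, -, hab, hac, hbc⟩ := hcard
      obtain ⟨q, hq, -⟩ := IsTree.exists_node (Z := X.toLabelled) X.isTree hab hac hbc
      have h1 := hlevel q hq
      have h2 := (three_le_classes hq.toIsPos.equivalence).2 hq.three
      omega
    have hle : classes p ≤ Nat.card X := by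
      rw [classes, ← Set.image_univ, ← Set.ncard_univ]
      exact Set.ncard_image_le (Set.toFinite _)
    have := h3 hn3
    omega
  · omega

end TreeStructure

/-- A node restricts to a point of `X` and a point of `Y`, with at most `n / 2` branches each, and
`classes_sum_le` adds the bounds. The restricted points need not be nodes, which is why midpoints of
edges matter. -/
theorem Amalg.inClass_of_two_mul_level_le {X Y : TreeStructure} (A : Amalg ⊤ X Y) {n : ℕ}
    (hn : 3 ≤ n) (hX : 2 * X.level ≤ n) (hY : 2 * Y.level ≤ n) (hX3 : n = 3 → Nat.card X ≠ 2)
    (hY3 : n = 3 → Nat.card Y ≠ 2) : A.1.InClass n := by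
  refine inClass_iff.2 ⟨A.2.1.1, fun p hp => ?_⟩
  have h1 := classes_sum_le hp.toIsPos.equivalence
  have h2 := X.two_mul_classes_le hn hX hX3 (A.2.2.1 ▸ hp.toIsPos.restrict Sum.inl)
  have h3 := Y.two_mul_classes_le hn hY hY3 (A.2.2.2 ▸ hp.toIsPos.restrict Sum.inr)
  have : classes p ≤ n := by omega
  exact_mod_cast this

/-! ### Restriction to the trees of bounded level -/

/-- An amalgamation of bounded level as an amalgamation in the class of all trees. -/
def Amalg.toTop {N : ℕ∞} {X Y : TreeStructure} (A : Amalg N X Y) : Amalg ⊤ X Y :=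
  ⟨A.1, inClass_top.2 A.2.1.1, A.2.2⟩

theorem Amalg.toTop_injective {N : ℕ∞} {X Y : TreeStructure} :
    Function.Injective (Amalg.toTop : Amalg N X Y → Amalg ⊤ X Y) := fun _ _ h =>
  Subtype.ext (congrArg (fun A : Amalg ⊤ X Y => A.1) h)

theorem Amalg.mem_range_toTop {N : ℕ∞} {X Y : TreeStructure} {A : Amalg ⊤ X Y} :
    A ∈ Set.range (Amalg.toTop : Amalg N X Y → Amalg ⊤ X Y) ↔ A.1.InClass N :=
  ⟨by rintro ⟨B, rfl⟩; exact B.2.1, fun h => ⟨⟨A.1, h, A.2.2⟩, rfl⟩⟩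

section

variable {k : Type u} [CommRing k] {n : ℕ} {X₁ X₂ X₃ : TreeStructure}

/-- The further triples in the class of all trees have level above `n`, while `Y₃` has not, so their
measure is zero. -/
theorem structureConstant_toTop (hn : 2 ≤ n) (Y₁ : Amalg n X₁ X₂) (Y₂ : Amalg n X₂ X₃)
    (Y₃ : Amalg n X₁ X₃) : structureConstant (n : k) Y₁.toTop Y₂.toTop Y₃.toTop =
      structureConstant (n : k) Y₁ Y₂ Y₃ := by
  rw [structureConstant_eq, structureConstant_eq]
  symm
  refine Finset.sum_subset ?_ ?_
  · intro Z hZ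
    rw [mem_treesWith] at hZ ⊢
    exact ⟨inClass_top.2 hZ.1.1, hZ.2⟩
  · intro Z hZ hZ'
    rw [mem_treesWith, inClass_top] at hZ
    refine treeMeasure_eq_zero n hn hZ.1 _ (hZ.2.2.2 ▸ Y₃.2.1) fun h => hZ' ?_
    exact mem_treesWith.2 ⟨h, hZ.2⟩

/-- A triple of level `≤ n` would restrict to `Y₁` and `Y₂` of level `≤ n`; hence every triple has
larger level and measure zero over `Y₃`. -/
theorem structureConstant_eq_zero (hn : 2 ≤ n) (Y₁ : Amalg ⊤ X₁ X₂) (Y₂ : Amalg ⊤ X₂ X₃)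
    (Y₃ : Amalg n X₁ X₃) (h : ¬ (Y₁.1.InClass n ∧ Y₂.1.InClass n)) :
    structureConstant (n : k) Y₁ Y₂ Y₃.toTop = 0 := by
  rw [structureConstant_eq]
  refine Finset.sum_eq_zero fun Z hZ => ?_
  rw [mem_treesWith, inClass_top] at hZ
  refine treeMeasure_eq_zero n hn hZ.1 _ (hZ.2.2.2 ▸ Y₃.2.1) fun hc => h ?_
  exact ⟨hZ.2.1 ▸ hc.restrict _, hZ.2.2.1 ▸ hc.restrict _⟩

end

/-! ### The truncation homomorphism. -/

namespace ArborealAlgebra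

variable {k : Type u} [CommRing k]

section Basis

variable {ι : Type} {N : ℕ∞} {t : k} {T : ι → TreeStructure}

open Classical in
theorem phi_apply_self {i j : ι} (Z W : Amalg N (T i) (T j)) :
    (phi t Z : ArborealAlgebra N t T) i j W = if W = Z then 1 else 0 := by
  change (Pi.single i (Pi.single j (Pi.single Z (1 : k))) :
    ∀ i j, Amalg N (T i) (T j) → k) i j W = _
  rw [Pi.single_eq_same, Pi.single_eq_same, Pi.single_apply]

theorem phi_apply_of_ne {i j i' j' : ι} (Z : Amalg N (T i) (T j)) (W : Amalg N (T i') (T j'))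
    (h : ¬ (i' = i ∧ j' = j)) : (phi t Z : ArborealAlgebra N t T) i' j' W = 0 := by
  classical
  change (Pi.single i (Pi.single j (Pi.single Z (1 : k))) :
    ∀ i j, Amalg N (T i) (T j) → k) i' j' W = _
  by_cases hi : i' = i
  · subst hi
    rw [Pi.single_eq_same, Pi.single_eq_of_ne fun hj => h ⟨rfl, hj⟩]
    rfl
  · rw [Pi.single_eq_of_ne hi]
    rfl

end Basis

variable {r n : ℕ} {T : Fin r → TreeStructure}

/-- The linear map from `A` to `B` that kills the basis elements of level `> n`. -/
def truncation (n : ℕ) (T : Fin r → TreeStructure) : AlgA (n : k) T →ₗ[k] AlgB k n T where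
  toFun f := fun i j W => f i.1 j.1 W.toTop
  map_add' _ _ := rfl
  map_smul' _ _ := rfl

theorem truncation_apply (f : AlgA (n : k) T) (i j : {i : Fin r // (T i).level ≤ n})
    (W : Amalg n (T i.1) (T j.1)) : truncation n T f i j W = f i.1 j.1 W.toTop := rfl

theorem truncation_one : truncation n T (1 : AlgA (n : k) T) = 1 := by
  classical
  funext i j W
  rw [truncation_apply]
  by_cases hij : i = j
  · subst hij
    rw [one_apply_self i.1 W.toTop]
    refine Eq.trans ?_ (one_apply_self (T := fun i : {i : Fin r // (T i).level ≤ n} => T i.1)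
      i W).symm
    rfl
  · rw [one_apply_of_ne fun h => hij (Subtype.ext h)]
    exact (one_apply_of_ne (T := fun i : {i : Fin r // (T i).level ≤ n} => T i.1) hij W).symm

/-- In a coefficient of level `≤ n`, all terms with a middle tree or a factor of larger level vanish
by `structureConstant_eq_zero`, and the remaining structure constants agree by
`structureConstant_toTop`. -/
theorem truncation_mul (hn : 2 ≤ n) (x y : AlgA (n : k) T) :
    truncation n T (x * y) = truncation n T x * truncation n T y := by
  funext i l W
  rw [truncation_apply, mul_apply, mul_apply]
  symm
  refine Fintype.sum_of_injective Subtype.val Subtype.val_injective _ _ ?_ ?_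
  · intro j hj
    refine Finset.sum_eq_zero fun Y₁ _ => Finset.sum_eq_zero fun Y₂ _ => ?_
    rw [structureConstant_eq_zero hn Y₁ Y₂ W, mul_zero]
    rintro ⟨h, -⟩
    refine hj ⟨⟨j, (T j).inClass_iff_level_le.1 ?_⟩, rfl⟩
    exact Y₁.2.2.2 ▸ h.restrict Sum.inr
  · intro j
    refine Fintype.sum_of_injective Amalg.toTop Amalg.toTop_injective _ _ ?_ ?_
    · intro Y₁ h₁
      refine Finset.sum_eq_zero fun Y₂ _ => ?_
      rw [structureConstant_eq_zero hn Y₁ Y₂ W, mul_zero]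
      exact fun h => h₁ (Amalg.mem_range_toTop.2 h.1)
    · intro Y₁
      refine Fintype.sum_of_injective Amalg.toTop Amalg.toTop_injective _ _ ?_ ?_
      · intro Y₂ h₂
        rw [structureConstant_eq_zero hn Y₁.toTop Y₂ W, mul_zero]
        exact fun h => h₂ (Amalg.mem_range_toTop.2 h.2)
      · intro Y₂
        rw [structureConstant_toTop hn]
        rfl

theorem truncation_surjective : Function.Surjective (truncation (k := k) n T) := by
  classical
  intro g
  refine ⟨fun i j Z => if h : ((T i).level ≤ n ∧ (T j).level ≤ n) ∧ Z.1.InClass n then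
    g ⟨i, h.1.1⟩ ⟨j, h.1.2⟩ ⟨Z.1, h.2, Z.2.2⟩ else 0, ?_⟩
  funext i j W
  exact dif_pos ⟨⟨i.2, j.2⟩, W.2.1⟩

theorem truncation_phi {i j : Fin r} (hi : (T i).level ≤ n) (hj : (T j).level ≤ n)
    (W : Amalg n (T i) (T j)) : truncation n T (phi (n : k) W.toTop) =
      phi (T := fun i : {i : Fin r // (T i).level ≤ n} => T i.1) (i := ⟨i, hi⟩) (j := ⟨j, hj⟩)
        (n : k) W := by
  classical
  funext ⟨i', hi'⟩ ⟨j', hj'⟩ V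
  rw [truncation_apply]
  by_cases h : i' = i ∧ j' = j
  · obtain ⟨rfl, rfl⟩ := h
    rw [phi_apply_self W.toTop V.toTop]
    refine Eq.trans ?_ (phi_apply_self (T := fun i : {i : Fin r // (T i).level ≤ n} => T i.1)
      (i := ⟨i', hi⟩) (j := ⟨j', hj⟩) W V).symm
    exact if_congr Amalg.toTop_injective.eq_iff rfl rfl
  · rw [phi_apply_of_ne W.toTop V.toTop h]
    refine (phi_apply_of_ne (T := fun i : {i : Fin r // (T i).level ≤ n} => T i.1)
      (i := ⟨i, hi⟩) (j := ⟨j, hj⟩) (i' := ⟨i', hi'⟩) (j' := ⟨j', hj'⟩) W V fun hh => h ?_).symm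
    exact ⟨congrArg Subtype.val hh.1, congrArg Subtype.val hh.2⟩

theorem truncation_phi_eq_zero {i j : Fin r} (Z : Amalg ⊤ (T i) (T j)) (hZ : ¬ Z.1.InClass n) :
    truncation n T (phi (n : k) Z) = 0 := by
  classical
  funext ⟨i', hi'⟩ ⟨j', hj'⟩ V
  rw [truncation_apply]
  by_cases h : i' = i ∧ j' = j
  · obtain ⟨rfl, rfl⟩ := h
    rw [phi_apply_self Z V.toTop, if_neg]
    · rfl
    · rintro rfl
      exact hZ V.2.1
  · exact phi_apply_of_ne Z V.toTop h

theorem truncation_injective (hT : ∀ i, (T i).level ≤ n)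
    (h : ∀ (i j) (Z : Amalg ⊤ (T i) (T j)), Z.1.InClass n) :
    Function.Injective (truncation (k := k) n T) := by
  intro f g hfg
  funext i j Z
  exact congrFun (congrFun (congrFun hfg ⟨i, hT i⟩) ⟨j, hT j⟩) ⟨Z.1, h i j Z, Z.2.2⟩

end ArborealAlgebra

end Arboreal
open Arboreal in
theorem corollary5p4 {k : Type*} [CommRing k] (n : ℕ) (hn : 3 ≤ n) (hk : IsUnit ((n : k) - 1))
    {r : ℕ} (T : Fin r → TreeStructure) :
    -- `μ_n` is the measure with parameter `n`, and it restricts to a measure on level `≤ n`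
    IsPrimaryMeasure (n : k) (treeMeasure (n : k)) ∧
    IsMeasure (n : ℕ∞) (treeMeasure (n : k)) ∧
    -- both algebras are associative with unit
    IsUnitalAssociative (AlgA (n : k) T) ∧
    IsUnitalAssociative (AlgB k n T) ∧
    -- the homomorphism
    ∃ F : AlgA (n : k) T →ₗ[k] AlgB k n T,
      F 1 = 1 ∧ (∀ x y, F (x * y) = F x * F y) ∧
      Function.Surjective F ∧
      (∀ (i j : Fin r) (Z : Amalg ⊤ (T i) (T j)),
        (Z.1.level ≤ n → ∃ (hi : (T i).level ≤ n) (hj : (T j).level ≤ n)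
          (W : Amalg (n : ℕ∞) (T i) (T j)), W.1 = Z.1 ∧
            F (ArborealAlgebra.phi (n : k) Z) =
              ArborealAlgebra.phi (T := fun i : {i : Fin r // (T i).level ≤ n} => T i.1)
                (i := ⟨i, hi⟩) (j := ⟨j, hj⟩) (n : k) W) ∧
        (n < Z.1.level → F (ArborealAlgebra.phi (n : k) Z) = 0)) ∧
      ((∀ i, 2 * (T i).level ≤ n) → (n = 3 → ∀ i, Nat.card (T i) ≠ 2) →
        Function.Bijective F) := by
  have hA := treeMeasure_isMeasure (n : k) hk
  have hB := treeMeasure_isMeasure_level (k := k) n (by omega) hk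
  refine ⟨treeMeasure_isPrimaryMeasure (n : k) hk, hB,
    ArborealAlgebra.isUnitalAssociative hA, ArborealAlgebra.isUnitalAssociative hB,
    ArborealAlgebra.truncation n T, ArborealAlgebra.truncation_one,
    ArborealAlgebra.truncation_mul (by omega), ArborealAlgebra.truncation_surjective,
    fun i j Z => ⟨fun hZ => ?_, fun hZ => ?_⟩, fun hT h3 => ⟨?_,
      ArborealAlgebra.truncation_surjective⟩⟩
  · let W : Amalg (n : ℕ∞) (T i) (T j) := ⟨Z.1, ⟨Z.2.1.1, by exact_mod_cast hZ⟩, Z.2.2⟩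
    -- Subtrees of a tree of level `≤ n` have level `≤ n`, so neither `T i` nor `T j` has been
    -- omitted.
    have hi := (T i).inClass_iff_level_le.1 W.inClass_left
    have hj := (T j).inClass_iff_level_le.1 W.inClass_right
    exact ⟨hi, hj, W, rfl, ArborealAlgebra.truncation_phi hi hj W⟩
  · refine ArborealAlgebra.truncation_phi_eq_zero Z fun h => ?_
    exact absurd h.2 (not_le.2 (by exact_mod_cast hZ))
  · exact ArborealAlgebra.truncation_injective (fun i => by have := hT i; omega) fun i j Z =>
      Z.inClass_of_two_mul_level_le hn (hT i) (hT j) (fun h => h3 h i) (fun h => h3 h j)
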